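/- **Geometric amortization.** *Setting.* Let $\Sigma$ be a finite alphabet with at least two letters and let $n=|x|$ denote the length of an input $x\in\Sigma^*$. A RAM has a read-only input (one letter per input register), registers $R_0,R_1,\dots$ holding natural numbers and initially zero, addition, subtraction, multiplication, comparison, indirect addressing, and an instruction that outputs the concatenation of the values of $R_i,\dots,R_j$. An instruction costs $1$ plus the sum of the bit sizes of its arguments divided by $\log n$ (where $\log n$ is read as $\lfloor\log_2 n\rfloor+1$ and the quotient is rounded down). The space used is the sum of the bit sizes of the integers in the input registers and in the registers up to the largest index accessed. We consider RAMs in the uniform cost model: the cost of every executed instruction is bounded by a constant, i.e. the integers manipulated are polynomial in $n$. $M(x)$ is the set of outputs of $M$ on $x$, $\sharp M(x)$ its cardinality, and $T_M(x,i)$ the time before the $i$-th output instruction is executed. $M$ solves an enumeration problem $A\subseteq\Sigma^*\times\Sigma^*$ if on each input $x$ it halts, $M(x)=A(x)$, no solution is output twice, and $M$ stops right after its last output. $A$ is in $\mathrm{EnumP}$ if all $y\in A(x)$ have length polynomial in $|x|$ and $y\in A(x)$ is decidable in polynomial time. For $A\in\mathrm{EnumP}$, a RAM $M$ solving $A$ is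 an $\mathrm{IncP}_1$-enumerator if $T_M(x,i)=O(i\,n^b)$ for some constant $b$ and all $1\le i\le\sharp M(x)$ (with $n$ replaced by $n+1$ to allow the empty word), and it has incremental delay $p(n)$ if $T_M(x,i)\le i\,p(n)$ for all $x$ and all such $i$; it is a $\mathrm{DelayP}$-enumerator if $T_M(x,1)$ (whenever there is an output) and all differences $T_M(x,i)-T_M(x,i-1)$, $1<i\le\sharp M(x)$, are less than $q(n)$ for some fixed polynomial $q$. *Theorem.* Let $I$ be an $\mathrm{IncP}_1$-enumerator for $A$ in the uniform cost model with incremental delay $p(n)$ and space complexity $s(n)$, where $p$ and $s$ are known: each of $p(n)$ and $s(n)$ can be computed from $x$ by a RAM in the uniform cost model, in time polynomial in $n$ and space $O(s(n))$. Then there is a $\mathrm{DelayP}$-enumerator $I'$ for $A$ in the uniform cost model (so $I'$ enumerates $I(x)$ on every input $x$) such that, for every $x$ and every $1\le i<\sharp I(x)$, $$T_{I'}(x,i+1)-T_{I'}(x,i)\;\le\; C\,\lceil\log_2\sharp I(x)\rceil\,p(n),$$ and $I'$ uses at most $C\,s(n)\,(1+\lceil\log_2 \sharp I(x)\rceil)$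 space on $x$, where $C$ is a constant that does not depend on $x$. Neither $\sharp I(x)$ nor any bound on it is given to $I'$. -/

import Mathlib

/-- Instructions of a random access machine with registers `R 0, R 1, …` and read-only input
registers. Register numbers and jump targets written in the program are constants;
`load`, `store`, `read` and `output` address registers indirectly. -/
inductive Instr where
  /-- `R d := c` -/
  | const (d c : ℕ)
  /-- `R d :=` the length of the input -/
  | len (d : ℕ)
  /-- `R d :=` the input letter at position `R a` (and `0` beyond the end of the input) -/
  | read (d a : ℕ)
  /-- `R d := R a + R b` -/
  | add (d a b : ℕ)
  /-- `R d := R a - R b` (natural-number subtraction) -/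
  | sub (d a b : ℕ)
  /-- `R d := R a * R b` -/
  | mul (d a b : ℕ)
  /-- `R d := R (R a)` -/
  | load (d a : ℕ)
  /-- `R (R a) := R b` -/
  | store (a b : ℕ)
  /-- jump to instruction `l` -/
  | jmp (l : ℕ)
  /-- jump to instruction `l` if `R a < R b` -/
  | jlt (a b l : ℕ)
  /-- output the concatenation of the values of the registers `R i, R (i+1), …, R j`,
  where `i` and `j` are the values of `R a` and `R b` -/
  | output (a b : ℕ)
  | halt

/-- A random access machine is given by its program. -/
structure RAM where
  prog : List Instr

/-- A configuration: index of the next instruction, contents of the registers, and the largest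
index of a register accessed so far (`R 0` counts as accessed from the start). -/
structure Config where
  pc : ℕ
  mem : ℕ → ℕ
  hi : ℕ

/-- The size (number of binary digits) of an integer; `0` has size `1`. -/
def intSize (v : ℕ) : ℕ := max 1 (Nat.size v)

/-- The digits of `v` in base `k`, most significant digit first; `0` is written with one digit. -/
def baseRepr (k v : ℕ) : List ℕ := if v = 0 then [0] else (Nat.digits k v).reverse

namespace Instr

/-- The integers an instruction works on in memory `R`. -/
def args (n : ℕ) (R : ℕ → ℕ) : Instr → List ℕ
  | const _ c => [c]
  | len _ => [n]
  | read _ a => [R a]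
  | add _ a b => [R a, R b]
  | sub _ a b => [R a, R b]
  | mul _ a b => [R a, R b]
  | load _ a => [R a, R (R a)]
  | store a b => [R a, R b]
  | jmp _ => []
  | jlt a b _ => [R a, R b]
  | output a b => [R a, R b]
  | halt => []

/-- The cost of an instruction on inputs of length `n`: the sum of the sizes of its arguments,
divided by `log n` (and at least `1`). -/
def cost (n : ℕ) (R : ℕ → ℕ) (i : Instr) : ℕ :=
  1 + ((i.args n R).map intSize).sum / (Nat.log 2 n + 1)

/-- The indices of the registers that an instruction accesses (for `output`, the largest ones). -/
def touched (R : ℕ → ℕ) : Instr → List ℕ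
  | const d _ => [d]
  | len d => [d]
  | read d a => [d, a]
  | add d a b => [d, a, b]
  | sub d a b => [d, a, b]
  | mul d a b => [d, a, b]
  | load d a => [d, a, R a]
  | store a b => [a, b, R a]
  | jmp _ => []
  | jlt a b _ => [a, b]
  | output a b => if R a ≤ R b then [a, b, R b] else [a, b]
  | halt => []

/-- The memory after an instruction has been executed. -/
def newMem (x : List ℕ) (R : ℕ → ℕ) : Instr → (ℕ → ℕ)
  | const d c => Function.update R d c
  | len d => Function.update R d x.length
  | read d a => Function.update R d (x.getD (R a) 0)
  | add d a b => Function.update R d (R a + R b)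
  | sub d a b => Function.update R d (R a - R b)
  | mul d a b => Function.update R d (R a * R b)
  | load d a => Function.update R d (R (R a))
  | store a b => Function.update R (R a) (R b)
  | jmp _ => R
  | jlt _ _ _ => R
  | output _ _ => R
  | halt => R

/-- The index of the next instruction. -/
def newPc (pc : ℕ) (R : ℕ → ℕ) : Instr → ℕ
  | jmp l => l
  | jlt a b l => if R a < R b then l else pc + 1
  | halt => pc
  | _ => pc + 1

end Instr

namespace RAM

/-- The machine stops at a `halt` instruction and when it leaves its program. -/
def Halted (M : RAM) (c : Config) : Prop :=
  M.prog[c.pc]? = none ∨ M.prog[c.pc]? = some Instr.halt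

/-- One step of the machine; a halted configuration does not change. -/
def step (M : RAM) (x : List ℕ) (c : Config) : Config :=
  match M.prog[c.pc]? with
  | none => c
  | some i => ⟨i.newPc c.pc c.mem, i.newMem x c.mem, (i.touched c.mem).foldr max c.hi⟩

/-- The configuration of `M` on input `x` after `t` steps; all registers start at zero. -/
def cfg (M : RAM) (x : List ℕ) (t : ℕ) : Config :=
  (M.step x)^[t] ⟨0, fun _ => 0, 0⟩

/-- The cost of step number `t` (counted from `0`). -/
def stepCost (M : RAM) (x : List ℕ) (t : ℕ) : ℕ :=
  match M.prog[(M.cfg x t).pc]? with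
  | none => 1
  | some i => i.cost x.length (M.cfg x t).mem

/-- The time taken by the first `t` steps. -/
def time (M : RAM) (x : List ℕ) (t : ℕ) : ℕ := ∑ u ∈ Finset.range t, M.stepCost x u

/-- The space used after `t` steps: the sum of the sizes of the integers in the input registers
and in the registers `R 0, …, R h`, where `h` is the largest index accessed. -/
def space (M : RAM) (x : List ℕ) (t : ℕ) : ℕ :=
  (x.map intSize).sum + ∑ i ∈ Finset.range ((M.cfg x t).hi + 1), intSize ((M.cfg x t).mem i)

/-- The word (over the alphabet `{0, …, k-1}`) written by step number `t`, if that step executes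
an `output` instruction. -/
def emit (k : ℕ) (M : RAM) (x : List ℕ) (t : ℕ) : Option (List ℕ) :=
  match M.prog[(M.cfg x t).pc]? with
  | some (Instr.output a b) =>
      let R := (M.cfg x t).mem
      some ((List.range' (R a) (R b + 1 - R a)).flatMap fun r => baseRepr k (R r))
  | _ => none

/-- Step number `t` executes an `output` instruction. -/
def OutputsAt (k : ℕ) (M : RAM) (x : List ℕ) (t : ℕ) : Prop := (M.emit k x t).isSome

end RAM

/-- Words over the alphabet `Σ = {0, …, k-1}`. -/
abbrev Word (k : ℕ) : Type := List (Fin k)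

/-- The contents of the input registers for the word `x`, one letter in each register. -/
def Word.code {k : ℕ} (x : Word k) : List ℕ := x.map Fin.val

/-- An enumeration problem: `A x` is the set of solutions of the instance `x`. -/
abbrev EnumProblem (k : ℕ) : Type := Word k → Set (Word k)

namespace RAM

/-- `M(x)`, the set of outputs of `M` on `x`. -/
def outputs {k : ℕ} (M : RAM) (x : Word k) : Set (List ℕ) :=
  {y | ∃ t, M.emit k x.code t = some y}

/-- `♯M(x)`, the number of outputs of `M` on `x`. -/
noncomputable def count {k : ℕ} (M : RAM) (x : Word k) : ℕ := (M.outputs x).ncard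

/-- `T_M(x,i)`, the time taken by `M` on `x` before the `i`-th `output` instruction is executed
(for `1 ≤ i`, if there are at least `i` of them). -/
noncomputable def T {k : ℕ} (M : RAM) (x : Word k) (i : ℕ) : ℕ :=
  M.time x.code (Nat.nth (M.OutputsAt k x.code) (i - 1))

/-- `M` solves the enumeration problem `A`: on every input it halts, the set of its outputs is the
set of solutions, no solution is repeated, and it stops right after the last output. -/
structure Solves {k : ℕ} (M : RAM) (A : EnumProblem k) : Prop where
  halts : ∀ x : Word k, ∃ t, M.Halted (M.cfg x.code t)
  outputs_eq : ∀ x : Word k, M.outputs x = Word.code '' A x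
  no_repeat : ∀ (x : Word k) (t t' : ℕ), M.OutputsAt k x.code t →
    M.emit k x.code t = M.emit k x.code t' → t = t'
  no_postprocessing : ∀ (x : Word k) (t : ℕ), M.OutputsAt k x.code t →
    (∀ t', t < t' → ¬ M.OutputsAt k x.code t') → M.Halted (M.cfg x.code (t + 1))

/-- `M` works in the uniform cost model: there is a constant that bounds the cost of every
executed instruction, that is, the integers that `M` works on are polynomial in the length of
the input. -/
def UniformCost (k : ℕ) (M : RAM) : Prop :=
  ∃ c, ∀ (x : Word k) (t : ℕ), M.stepCost x.code t ≤ c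

/-- `M` has space complexity `s(n)`. -/
def HasSpace (k : ℕ) (M : RAM) (s : ℕ → ℕ) : Prop :=
  ∀ (x : Word k) (t : ℕ), M.space x.code t ≤ s x.length

/-- `M` has incremental delay `p(n)`. -/
def HasIncrementalDelay (k : ℕ) (M : RAM) (p : ℕ → ℕ) : Prop :=
  ∀ (x : Word k) (i : ℕ), 1 ≤ i → i ≤ M.count x → M.T x i ≤ i * p x.length

end RAM

/-- The solutions of `A` have size polynomial in the size of the instance. -/
def PolyBalanced {k : ℕ} (A : EnumProblem k) : Prop :=
  ∃ q : Polynomial ℕ, ∀ (x : Word k), ∀ y ∈ A x, y.length ≤ q.eval x.length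

/-- Membership in `A x` is decidable in polynomial time. The decider gets the pair `(x, y)` with
the extra letter `k` as separator and accepts by stopping with the value `1` in `R 0`. -/
def TestInP {k : ℕ} (A : EnumProblem k) : Prop :=
  ∃ (D : RAM) (q : Polynomial ℕ), ∀ x y : Word k, ∃ t,
    D.Halted (D.cfg (x.code ++ k :: y.code) t) ∧
    D.time (x.code ++ k :: y.code) t ≤ q.eval (x.length + y.length) ∧
    ((D.cfg (x.code ++ k :: y.code) t).mem 0 = 1 ↔ y ∈ A x)

/-- The class `EnumP`. -/
def EnumP {k : ℕ} (A : EnumProblem k) : Prop := PolyBalanced A ∧ TestInP A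

/-- `M` is an `IncP_a`-enumerator for `A`: `A` is in `EnumP` and `M` solves it in incremental time
`O(i^a n^b)` for some `b` (with `n + 1` for `n`, because of the empty word). -/
def IsIncEnumerator {k : ℕ} (a : ℕ) (M : RAM) (A : EnumProblem k) : Prop :=
  EnumP A ∧ M.Solves A ∧ ∃ b c : ℕ, ∀ (x : Word k) (i : ℕ), 1 ≤ i → i ≤ M.count x →
    M.T x i ≤ c * (i ^ a * (x.length + 1) ^ b)

/-- `M` is a `DelayP`-enumerator for `A`: `A` is in `EnumP` and `M` solves it with polynomial
delay, the time before the first output being polynomial as well. -/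
def IsDelayPEnumerator {k : ℕ} (M : RAM) (A : EnumProblem k) : Prop :=
  EnumP A ∧ M.Solves A ∧ ∃ q : Polynomial ℕ, ∀ x : Word k,
    (1 ≤ M.count x → M.T x 1 < q.eval x.length) ∧
    ∀ i, 1 < i → i ≤ M.count x → M.T x i < M.T x (i - 1) + q.eval x.length

/-- `f` is known to algorithms on inputs of length `n` that use space `s(n)`: some machine in the
uniform cost model stops with the value `f |x|` in `R 0` on every input `x`, in time polynomial
in `|x|` and in space `O(s |x|)`. Polynomials are of this kind. -/
def Known (k : ℕ) (s f : ℕ → ℕ) : Prop :=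
  ∃ (M : RAM) (q : Polynomial ℕ) (C : ℕ), M.UniformCost k ∧
    M.HasSpace k (fun n => C * s n) ∧
    ∀ x : Word k, ∃ t, M.Halted (M.cfg x.code t) ∧ M.time x.code t ≤ q.eval x.length ∧
      (M.cfg x.code t).mem 0 = f x.length

/-! Write N for the number of solutions. Several copies of `I` are simulated, each from the
beginning of the run and in its own block of memory. Copy m emits only the solutions whose rank in
the order of `I` lies in [2^m, 2^(m+1)) and skips all others, so nothing is repeated. Copy m+1 is
created at the moment when copy m reaches solution number 2^m; hence N need not be known, and at
most log N + 2 copies ever exist.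

Control starts at the last copy and moves downwards. The copy in turn has fuel for B = 8(p+2) units
of work. If it reaches a solution of its zone, this solution is emitted and control returns to the
last copy; if its fuel is used up, or it has nothing left to do, control passes to the next smaller
copy. Copy 0 withholds the very first solution until control comes down to it. That solution is
emitted last, and the machine stops right after it.

Delay: before the next emission, control only moves down, or up by one when the last copy creates a
new one. So there are O(log N) turns of O(p) units each (`Inv.rank`, `Inv.rank_next`).

Completeness: it must be shown that no other copy has work left when control comes to copy 0
(`Inv.finished`). Every emission by a smaller copy sends control back above copy m, which then
receives B units before a smaller copy can act again. So an unfinished copy m has done at least B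
units of work per solution emitted by smaller copies since its creation (`Fuel`). In the other
direction, the incremental delay shows that a copy which has seen c outputs and has neither halted
nor found a solution to emit has done at most (c+1)(p+2) units (`MInv.mu_le`). The second bound
implies that copy m is created early, when at most 2^m/8 solutions have been emitted (`Inv.spawn`).
If the smaller copies have no work left, they have emitted at least 2^(m-1) - 1 solutions
(`Inv.emitted_add_one_ge`). An unfinished copy m would then have done at least 3·2^m(p+2) units, but
it needs at most 2·2^m(p+2).

N may be exponential, so a copy cannot count its outputs in one register. The counter is kept in
binary, one digit per register, and one digit is changed per unit of work; the digit sum serves as a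
potential, so that increments cost O(1) on average. The digit with index m shows at once whether
copy m is before, in or past its zone.

The machine itself is a single loop around a loop-free body, and each pass performs one unit of
work. Bodies are verified by weakest preconditions (`Code.wp`, `Code.sound`), and `Setup.Rep`
relates the memory to the abstract state. The bounds s and p are first computed by simulating the
machines that witness that they are known. All numbers present at the start of a pass are
polynomial, and a bounded number of steps can only square them boundedly often, which gives the
uniform cost model. The space consists of O(log N) blocks of size O(s). -/

namespace Amortization

/-! ### The abstract schedule of copies -/

/-- The state of one of the simulated copies of the enumerator: the number `t` of simulated steps,
the phase `ph` (`0` running, `1` incrementing the output counter, `2` waiting in front of an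
output, `3` finished), the position `q` of the carry, the digits of the output counter, and the
number `mu` of units of work done so far. -/
structure Mach where
  t : ℕ
  ph : ℕ
  q : ℕ
  bits : ℕ → ℕ
  mu : ℕ

def Mach.init : Mach := ⟨0, 0, 0, fun _ => 0, 0⟩

/-- The state of the amortized enumerator: index `K` of the last copy, index `j` of the copy in
turn, its remaining fuel `f`, and the copies. The fields `v` (number of solutions that had been
output when a copy was started) and `em` (output steps emitted so far) are only used in proofs. -/
structure St where
  K : ℕ
  j : ℕ
  f : ℕ
  mach : ℕ → Mach
  v : ℕ → ℕ
  em : Set ℕ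

section
open Classical

/-- The number of outputs before step `t`. -/
noncomputable def cnt (Out : ℕ → Prop) (t : ℕ) : ℕ := Nat.count Out t

/-- The number of solutions emitted by the copies with index less than `m`. -/
noncomputable def emitted (Out : ℕ → Prop) (mach : ℕ → Mach) (m : ℕ) : ℕ :=
  -- Truncated subtraction makes the summand vanish for a copy that has not passed the first output
  -- of its zone. For a copy in front of the first output after its zone the summand is 2 ^ i, the
  -- size of the zone.
  ∑ i ∈ Finset.range m, (cnt Out (mach i).t + 1 - 2 ^ i)

def St.work (σ : St) (M : Mach) : St :=
  { σ with mach := Function.update σ.mach σ.j { M with mu := M.mu + 1 }, f := σ.f - 1 }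

/-- Subtraction is truncated: at copy 0 this refills the fuel and leaves copy 0 in turn. With at
least one solution this does not happen; with none, it is how copy 0 continues until it halts. -/
def St.down (B : ℕ) (σ : St) : St := { σ with j := σ.j - 1, f := B }

/-- Returning to the last copy is what earns every larger copy a full turn for each solution emitted
below it. -/
def St.emission (B : ℕ) (σ : St) : St :=
  { σ with
    mach := Function.update σ.mach σ.j
      { σ.mach σ.j with t := (σ.mach σ.j).t + 1, ph := 0 }
    j := σ.K, f := B, em := insert (σ.mach σ.j).t σ.em }

/-- Taken when the counter of copy j first reaches 2 ^ j. That solution belongs to zone j and is not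
emitted at once: it waits while the new copy takes its first turn. -/
noncomputable def St.spawn (Out : ℕ → Prop) (B : ℕ) (σ : St) : St :=
  let M := σ.mach σ.j
  { σ with
    mach := Function.update σ.mach σ.j
      { M with ph := 2, mu := M.mu + 1, bits := Function.update M.bits M.q (M.bits M.q + 1) }
    K := σ.K + 1, j := σ.K + 1, f := B
    v := Function.update σ.v (σ.K + 1) (emitted Out σ.mach (σ.K + 1)) }

/-- One unit of work of the amortized enumerator. -/
noncomputable def next (Out Halt : ℕ → Prop) (B : ℕ) (σ : St) : St :=
  let M := σ.mach σ.j
  if M.ph = 2 then σ.emission B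
  else if M.ph = 3 then σ.down B
  else if σ.f = 0 then σ.down B
  else if M.ph = 1 then
    if M.q < σ.j then
      if M.bits M.q = 0 then
        if M.bits σ.j = 0 then
          σ.work { M with t := M.t + 1, ph := 0, bits := Function.update M.bits M.q 1 }
        else σ.work { M with ph := 2, bits := Function.update M.bits M.q 1 }
      else σ.work { M with q := M.q + 1, bits := Function.update M.bits M.q 0 }
    else if M.bits σ.j = 0 then σ.spawn Out B
    else σ.work { M with ph := 3, bits := Function.update M.bits M.q (M.bits M.q + 1) }
  else if Halt M.t then σ.down B
  else if Out M.t then σ.work { M with ph := 1, q := 0 }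
  else σ.work { M with t := M.t + 1 }

/-- The output step of the simulated enumerator whose solution is emitted. -/
def St.emit (σ : St) : Option ℕ :=
  if (σ.mach σ.j).ph = 2 then some (σ.mach σ.j).t else none

/-- The first alternative is the final emission of the withheld first solution, the second is the
case of no solution at all. -/
def St.quit (Halt : ℕ → Prop) (σ : St) : Prop :=
  σ.j = 0 ∧ ((σ.mach 0).ph = 2 ∨ ((σ.mach 0).ph = 0 ∧ σ.f ≠ 0 ∧ Halt (σ.mach 0).t))

end

/-! ### Streams, binary counters and the invariants -/

variable {Out Halt : ℕ → Prop} {p N : ℕ}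

/-- An enumerator with incremental delay `p` and `N` outputs, reduced to its output steps and
its halting times. -/
structure Stream (Out Halt : ℕ → Prop) (p N : ℕ) : Prop where
  halt_not_out : ∀ t, Halt t → ¬ Out t
  cnt_le : ∀ t, cnt Out t ≤ N
  cnt_halt : ∀ t, Halt t → cnt Out t = N
  -- The delay hypothesis says nothing about the running time when there is no output, hence the
  -- assumption `1 ≤ N`.
  le_of_not_halt : ∀ t, ¬ Halt t → 1 ≤ N → t ≤ (cnt Out t + 1) * p
  halts : ∃ t, Halt t
  halt_mono : ∀ t t', t ≤ t' → Halt t → Halt t'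

lemma cnt_succ_of_out {t : ℕ} (h : Out t) : cnt Out (t + 1) = cnt Out t + 1 := by
  classical simp [cnt, Nat.count_succ, h]

lemma cnt_succ_of_not {t : ℕ} (h : ¬ Out t) : cnt Out (t + 1) = cnt Out t := by
  classical simp [cnt, Nat.count_succ, h]

lemma cnt_zero : cnt Out 0 = 0 := by simp [cnt]

lemma cnt_mono {a b : ℕ} (h : a ≤ b) : cnt Out a ≤ cnt Out b := by
  classical exact Nat.count_monotone _ h

/-- The value of the counter with digits `b 0, …, b m`. -/
def val (m : ℕ) (b : ℕ → ℕ) : ℕ := ∑ i ∈ Finset.range (m + 1), b i * 2 ^ i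

def digitSum (m : ℕ) (b : ℕ → ℕ) : ℕ := ∑ i ∈ Finset.range (m + 1), b i

lemma sum_low_lt {m : ℕ} {b : ℕ → ℕ} (h : ∀ i < m, b i ≤ 1) :
    ∑ i ∈ Finset.range m, b i * 2 ^ i < 2 ^ m := by
  induction m with
  | zero => simp
  | succ m ih =>
    rw [Finset.sum_range_succ]
    have h1 := ih fun i hi => h i (by omega)
    have h2 : b m * 2 ^ m ≤ 1 * 2 ^ m := Nat.mul_le_mul_right _ (h m (by omega))
    rw [pow_succ]; omega

lemma val_ge (m : ℕ) (b : ℕ → ℕ) : b m * 2 ^ m ≤ val m b := by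
  rw [val, Finset.sum_range_succ]; omega

lemma val_lt {m : ℕ} {b : ℕ → ℕ} (h : ∀ i < m, b i ≤ 1) : val m b < (b m + 1) * 2 ^ m := by
  rw [val, Finset.sum_range_succ]
  have := sum_low_lt h
  rw [add_mul]; omega

/-- The weights 2 ^ i give the value of the counter, the weights 1 its digit sum. Terms are added on
both sides to avoid subtraction. -/
lemma sum_update_add {m q : ℕ} (hq : q ≤ m) (b : ℕ → ℕ) (w : ℕ → ℕ) (y : ℕ) :
    ∑ i ∈ Finset.range (m + 1), Function.update b q y i * w i + b q * w q =
      ∑ i ∈ Finset.range (m + 1), b i * w i + y * w q := by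
  have hm : q ∈ Finset.range (m + 1) := Finset.mem_range.2 (by omega)
  rw [← Finset.add_sum_erase _ _ hm, ← Finset.add_sum_erase _ (fun i => b i * w i) hm]
  have : ∑ i ∈ (Finset.range (m + 1)).erase q, Function.update b q y i * w i =
      ∑ i ∈ (Finset.range (m + 1)).erase q, b i * w i :=
    Finset.sum_congr rfl fun i hi => by
      rw [Function.update_of_ne (Finset.ne_of_mem_erase hi)]
  rw [this]; simp; ring

lemma val_update {m q : ℕ} (hq : q ≤ m) (b : ℕ → ℕ) (y : ℕ) :
    val m (Function.update b q y) + b q * 2 ^ q = val m b + y * 2 ^ q :=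
  sum_update_add hq b (fun i => 2 ^ i) y

lemma digitSum_update {m q : ℕ} (hq : q ≤ m) (b : ℕ → ℕ) (y : ℕ) :
    digitSum m (Function.update b q y) + b q = digitSum m b + y := by
  simpa [digitSum] using sum_update_add hq b (fun _ => 1) y

/-- The invariant of the copy with index `m`. -/
structure MInv (Out : ℕ → Prop) (m : ℕ) (M : Mach) : Prop where
  low : ∀ i < m, M.bits i ≤ 1
  high : ∀ i > m, M.bits i = 0
  top : M.bits m ≤ 2
  q_le : M.q ≤ m
  ph_le : M.ph ≤ 3
  -- Potential argument for the counter: each carry step removes a digit 1 and pays for itself, so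
  -- an output costs two units more than an ordinary step. The summands 1 and 3 in `carry` and
  -- `pend` are the intermediate stages of one increment.
  run : M.ph = 0 → val m M.bits = cnt Out M.t ∧ M.bits m ≤ 1 ∧
    M.mu + digitSum m M.bits ≤ M.t + 2 * cnt Out M.t
  carry : M.ph = 1 → Out M.t ∧ val m M.bits + 2 ^ M.q = cnt Out M.t + 1 ∧
    (∀ i < M.q, M.bits i = 0) ∧ M.bits m ≤ 1 ∧ cnt Out M.t < (M.bits m + 1) * 2 ^ m ∧
    M.mu + digitSum m M.bits ≤ M.t + 2 * cnt Out M.t + 1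
  pend : M.ph = 2 → Out M.t ∧ val m M.bits = cnt Out M.t + 1 ∧ M.bits m = 1 ∧
    M.mu + digitSum m M.bits ≤ M.t + 2 * cnt Out M.t + 3
  fin : M.ph = 3 → M.bits m = 2 ∧ cnt Out M.t + 1 = 2 ^ (m + 1)

lemma MInv.init (m : ℕ) : MInv Out m Mach.init := by
  constructor <;> simp [Mach.init, val, digitSum, cnt_zero]

/-- Copy `m` emits the solutions with index in `[2 ^ m, 2 ^ (m + 1))`. -/
def Zone (Out : ℕ → Prop) (m t : ℕ) : Prop :=
  Out t ∧ 2 ^ m ≤ cnt Out t + 1 ∧ cnt Out t + 1 < 2 ^ (m + 1)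

lemma Zone.unique {m m' t : ℕ} (h : Zone Out m t) (h' : Zone Out m' t) : m = m' := by
  have h1 := (Nat.pow_lt_pow_iff_right (a := 2) (by norm_num)).1 (h.2.1.trans_lt h'.2.2)
  have h2 := (Nat.pow_lt_pow_iff_right (a := 2) (by norm_num)).1 (h'.2.1.trans_lt h.2.2)
  omega

/-- With fuel `B` for each turn, copy `m` has done at least the work that it was given fuel for,
once for each of the `S - v` solutions emitted by smaller copies since it was started. -/
structure Fuel (B S mu v j f m : ℕ) : Prop where
  before : m < j → B * S ≤ mu + B * v
  now : m = j → B * S + B ≤ mu + B * v + f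
  after : j < m → B * S + B ≤ mu + B * v

/-- By `hit` and `last` the last copy is the only existing one with leading digit 0, so only it can
create another. From the first creation on, `first` keeps copy 0 in front of its solution. By
`passed`, control has never moved below a copy with a pending solution. The condition `fuel` exempts
finished and halted copies, which leave their fuel unused. With `sound` and `complete`, the emitted
steps are exactly the zone outputs that the respective copies have passed. -/
structure Inv (Out Halt : ℕ → Prop) (p N : ℕ) (σ : St) : Prop where
  j_le : σ.j ≤ σ.K
  f_le : σ.f ≤ 8 * (p + 2)
  mach : ∀ m, MInv Out m (σ.mach m)
  hit : ∀ m < σ.K, 1 ≤ (σ.mach m).bits m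
  last : (σ.mach σ.K).bits σ.K = 0
  fresh : ∀ m > σ.K, σ.mach m = Mach.init
  first : 0 < σ.K → (σ.mach 0).ph = 2
  passed : ∀ m > σ.j, (σ.mach m).ph ≠ 2
  v_le : ∀ m ≤ σ.K, 8 * σ.v m ≤ 2 ^ m
  fuel : ∀ m ≤ σ.K, (σ.mach m).ph ≠ 3 → ¬ Halt (σ.mach m).t →
    Fuel (8 * (p + 2)) (emitted Out σ.mach m) (σ.mach m).mu (σ.v m) σ.j σ.f m
  N_ge : ∀ m < σ.K, 2 ^ m ≤ N
  sound : ∀ t ∈ σ.em, ∃ m, t < (σ.mach m).t ∧ Zone Out m t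
  complete : ∀ m t, t < (σ.mach m).t → Zone Out m t → t ∈ σ.em
end Amortization

/-! ### Preservation of the invariant by turns, work and emissions -/

namespace Amortization
variable {Out Halt : ℕ → Prop} {p N : ℕ}

lemma emitted_update {mach : ℕ → Mach} {j : ℕ} {M : Mach}
    (h : cnt Out M.t + 1 - 2 ^ j = cnt Out (mach j).t + 1 - 2 ^ j) (m : ℕ) :
    emitted Out (Function.update mach j M) m = emitted Out mach m := by
  refine Finset.sum_congr rfl fun i _ => ?_
  rcases eq_or_ne i j with rfl | hi
  · simpa using h
  · rw [Function.update_of_ne hi]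

lemma emitted_update_of_le {mach : ℕ → Mach} {j : ℕ} {M : Mach} {m : ℕ} (h : m ≤ j) :
    emitted Out (Function.update mach j M) m = emitted Out mach m := by
  refine Finset.sum_congr rfl fun i hi => ?_
  rw [Function.update_of_ne]
  have := Finset.mem_range.1 hi
  omega

lemma emitted_update_succ {mach : ℕ → Mach} {j : ℕ} {M : Mach}
    (h : cnt Out M.t + 1 - 2 ^ j = cnt Out (mach j).t + 1 - 2 ^ j + 1) {m : ℕ} (hm : j < m) :
    emitted Out (Function.update mach j M) m = emitted Out mach m + 1 := by
  have hj : j ∈ Finset.range m := Finset.mem_range.2 hm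
  rw [emitted, emitted, ← Finset.add_sum_erase _ _ hj, ← Finset.add_sum_erase _
    (fun i => cnt Out (mach i).t + 1 - 2 ^ i) hj]
  have : ∑ i ∈ (Finset.range m).erase j, (cnt Out (Function.update mach j M i).t + 1 - 2 ^ i) =
      ∑ i ∈ (Finset.range m).erase j, (cnt Out (mach i).t + 1 - 2 ^ i) :=
    Finset.sum_congr rfl fun i hi => by
      rw [Function.update_of_ne (Finset.ne_of_mem_erase hi)]
  rw [this]
  simp only [Function.update_self]
  omega

namespace Inv
variable {σ : St}

lemma emitted_zero (mach : ℕ → Mach) : emitted Out mach 0 = 0 := rfl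

/-- A copy subject to the fuel condition is left only with `σ.f = 0`, so its condition `now` becomes
`after`. For the next copy in turn, `before` and the new fuel give `now`. -/
lemma down (h : Inv Out Halt p N σ) (h2 : (σ.mach σ.j).ph ≠ 2)
    (h3 : (σ.mach σ.j).ph = 3 ∨ Halt (σ.mach σ.j).t ∨ σ.f = 0) :
    Inv Out Halt p N (σ.down (8 * (p + 2))) where
  j_le := (Nat.sub_le _ _).trans h.j_le
  f_le := le_rfl
  mach := h.mach
  hit := h.hit
  last := h.last
  fresh := h.fresh
  first := h.first
  passed m hm := by
    rcases eq_or_ne m σ.j with rfl | hne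
    · exact h2
    · exact h.passed m (by simp only [St.down] at hm; omega)
  v_le := h.v_le
  fuel m hm h3' hH := by
    obtain ⟨h4, h5, h6⟩ := h.fuel m hm h3' hH
    have : m = σ.j → σ.f = 0 := by rintro rfl; tauto
    refine ⟨fun hj => ?_, fun hj => ?_, fun hj => ?_⟩ <;> simp only [St.down] at * <;> omega
  N_ge := h.N_ge
  sound := h.sound
  complete := h.complete

/-- One unit moves from the fuel to the work counter, so their sum is unchanged. The hypotheses `hc`
and `hz` say that the unit passes no output of the copy's own zone, so that neither the number of
emitted solutions nor completeness is affected. -/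
lemma work (h : Inv Out Halt p N σ) {M : Mach} (h2 : (σ.mach σ.j).ph ≠ 2)
    (h3 : (σ.mach σ.j).ph ≠ 3) (hH : ¬ Halt (σ.mach σ.j).t) (_hf : σ.f ≠ 0)
    (hM : MInv Out σ.j { M with mu := M.mu + 1 }) (hmu : M.mu = (σ.mach σ.j).mu)
    (ht : (σ.mach σ.j).t ≤ M.t)
    (hc : cnt Out M.t + 1 - 2 ^ σ.j = cnt Out (σ.mach σ.j).t + 1 - 2 ^ σ.j)
    (hb0 : (σ.mach σ.j).bits σ.j = 0 → M.bits σ.j = 0)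
    (hb1 : 1 ≤ (σ.mach σ.j).bits σ.j → 1 ≤ M.bits σ.j)
    (hz : ∀ t, (σ.mach σ.j).t ≤ t → t < M.t → ¬ Zone Out σ.j t) :
    Inv Out Halt p N (σ.work M) := by
  have hupd : ∀ m, m ≠ σ.j → (σ.work M).mach m = σ.mach m := fun m hm => by
    simp [St.work, Function.update_of_ne hm]
  have hself : (σ.work M).mach σ.j = { M with mu := M.mu + 1 } := by simp [St.work]
  have hem : ∀ m, emitted Out (σ.work M).mach m = emitted Out σ.mach m :=
    emitted_update (by simpa using hc)
  constructor
  · exact h.j_le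
  · exact (Nat.sub_le _ _).trans h.f_le
  · intro m
    rcases eq_or_ne m σ.j with rfl | hm
    · rw [hself]; exact hM
    · rw [hupd m hm]; exact h.mach m
  · intro m hmK
    rcases eq_or_ne m σ.j with rfl | hm
    · rw [hself]; exact hb1 (h.hit _ hmK)
    · rw [hupd m hm]; exact h.hit _ hmK
  · show ((σ.work M).mach σ.K).bits σ.K = 0
    rcases eq_or_ne σ.K σ.j with e | hm
    · rw [e, hself]; exact hb0 (e ▸ h.last)
    · rw [hupd _ hm]; exact h.last
  · intro m hm
    rw [hupd m (by have := h.j_le; simp only [St.work] at hm; omega)]; exact h.fresh m hm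
  · intro hK
    have h0 := h.first hK
    rw [hupd 0 (by intro e; rw [← e] at h2; exact h2 h0)]; exact h0
  · intro m hm
    rw [hupd m (by simp only [St.work] at hm; omega)]; exact h.passed m hm
  · exact h.v_le
  · intro m hm h3' hH'
    rw [hem]
    rcases eq_or_ne m σ.j with rfl | hne
    · obtain ⟨h4, h5, h6⟩ := h.fuel σ.j h.j_le h3 hH
      have h5 := h5 rfl
      rw [hself]
      refine ⟨fun hj => absurd hj (lt_irrefl σ.j), fun _ => ?_, fun hj => absurd hj (lt_irrefl σ.j)⟩
      show _ ≤ M.mu + 1 + 8 * (p + 2) * σ.v σ.j + (σ.f - 1)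
      omega
    · rw [hupd m hne] at h3' hH' ⊢
      obtain ⟨h4, h5, h6⟩ := h.fuel m hm h3' hH'
      refine ⟨fun hj => ?_, fun hj => ?_, fun hj => ?_⟩ <;> simp only [St.work] at * <;> omega
  · exact h.N_ge
  · intro t ht'
    obtain ⟨m, hm, hz'⟩ := h.sound t ht'
    refine ⟨m, ?_, hz'⟩
    rcases eq_or_ne m σ.j with rfl | hne
    · rw [hself]; exact hm.trans_le ht
    · rwa [hupd m hne]
  · intro m t htm hz'
    rcases eq_or_ne m σ.j with rfl | hne
    · rw [hself] at htm
      by_cases hlt : t < (σ.mach σ.j).t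
      · exact h.complete _ t hlt hz'
      · exact absurd hz' (hz t (by omega) htm)
    · rw [hupd m hne] at htm; exact h.complete m t htm hz'

/-- Leading digit 1 at position m, with smaller digits at most 1, places the counter value in [2 ^
m, 2 ^ (m + 1)). -/
lemma bits_pos_of_pend {m : ℕ} {M : Mach} (h : MInv Out m M) (h2 : M.ph = 2) : Zone Out m M.t := by
  obtain ⟨h1, h3, h4, -⟩ := h.pend h2
  refine ⟨h1, ?_, ?_⟩
  · have := val_ge m M.bits
    rw [h4] at this; omega
  · have := val_lt h.low
    rw [h4] at this; rw [pow_succ]; omega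

/-- Smaller copies and the emitting copy itself see no change in the number of solutions emitted
below them; a larger copy sees one more, which the surplus of its condition `after` pays for. The
case of copy 0 is excluded, since it ends the run. -/
lemma emission (hS : Stream Out Halt p N) (h : Inv Out Halt p N σ) (h2 : (σ.mach σ.j).ph = 2) :
    0 < σ.j → Inv Out Halt p N (σ.emission (8 * (p + 2))) := by
  intro hj
  have hz := bits_pos_of_pend (h.mach σ.j) h2
  set M : Mach := { σ.mach σ.j with t := (σ.mach σ.j).t + 1, ph := 0 } with hMdef
  have hupd : ∀ m, m ≠ σ.j → (σ.emission (8 * (p + 2))).mach m = σ.mach m := fun m hm => by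
    simp [St.emission, Function.update_of_ne hm]
  have hself : (σ.emission (8 * (p + 2))).mach σ.j = M := by simp [St.emission, hMdef]
  have hcnt : cnt Out M.t = cnt Out (σ.mach σ.j).t + 1 := cnt_succ_of_out hz.1
  constructor
  · exact le_rfl
  · exact le_rfl
  · intro m
    rcases eq_or_ne m σ.j with rfl | hm
    · rw [hself]
      have hM := h.mach σ.j
      obtain ⟨h4, h5, h6, h7⟩ := hM.pend h2
      refine ⟨hM.low, hM.high, hM.top, hM.q_le, by simp [hMdef], fun _ => ⟨?_, ?_, ?_⟩, ?_, ?_, ?_⟩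
      · rw [hcnt]; exact h5
      · simp [hMdef, h6]
      · rw [hcnt]; simp only [hMdef]; omega
      all_goals intro hh; simp [hMdef] at hh
    · rw [hupd m hm]; exact h.mach m
  · intro m hmK
    rcases eq_or_ne m σ.j with rfl | hm
    · rw [hself]; exact h.hit _ hmK
    · rw [hupd m hm]; exact h.hit _ hmK
  · show ((σ.emission _).mach σ.K).bits σ.K = 0
    rcases eq_or_ne σ.K σ.j with e | hm
    · rw [e, hself]; exact (e ▸ h.last : (σ.mach σ.j).bits σ.j = 0)
    · rw [hupd _ hm]; exact h.last
  · intro m hm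
    rw [hupd m (by have := h.j_le; simp only [St.emission] at hm; omega)]; exact h.fresh m hm
  · intro hK
    rw [hupd 0 (by omega)]; exact h.first hK
  · intro m hm
    simp only [St.emission] at hm
    rw [hupd m (by have := h.j_le; omega)]; exact h.passed m (by have := h.j_le; omega)
  · exact h.v_le
  · intro m hm h3' hH'
    have hemit_le : ∀ m ≤ σ.j, emitted Out (σ.emission (8 * (p + 2))).mach m =
      emitted Out σ.mach m := fun m hm => emitted_update_of_le hm
    have hemit_gt : ∀ m, σ.j < m → emitted Out (σ.emission (8 * (p + 2))).mach m =
      emitted Out σ.mach m + 1 := fun m hm => emitted_update_succ (by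
        show cnt Out M.t + 1 - _ = _
        rw [hcnt]
        have := hz.2.1
        omega) hm
    have := h.f_le
    rcases lt_trichotomy m σ.j with hlt | rfl | hgt
    · rw [hupd m hlt.ne] at h3' hH' ⊢
      obtain ⟨h4, h5, h6⟩ := h.fuel m hm h3' hH'
      rw [hemit_le m hlt.le]
      refine ⟨fun hj => ?_, fun hj => ?_, fun hj => ?_⟩ <;> simp only [St.emission] at * <;> omega
    · obtain ⟨h4, h5, h6⟩ := h.fuel σ.j h.j_le (by omega) fun hH => hS.halt_not_out _ hH hz.1
      have h5 := h5 rfl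
      have := h.j_le
      rw [hemit_le _ le_rfl, hself]
      refine ⟨fun _ => ?_, fun _ => ?_, fun (hj : σ.K < σ.j) => by omega⟩
      · show _ ≤ (σ.mach σ.j).mu + 8 * (p + 2) * σ.v σ.j
        omega
      · show _ ≤ (σ.mach σ.j).mu + 8 * (p + 2) * σ.v σ.j + 8 * (p + 2)
        omega
    -- Here the number of emitted solutions grows by one, and the surplus of one full turn in
    -- `after` is used up.
    · rw [hupd m hgt.ne'] at h3' hH' ⊢
      obtain ⟨h4, h5, h6⟩ := h.fuel m hm h3' hH'
      rw [hemit_gt m hgt]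
      refine ⟨fun hj => ?_, fun hj => ?_, fun hj => ?_⟩ <;>
        simp only [St.emission, mul_add, mul_one] at * <;> omega
  · exact h.N_ge
  · rintro t (rfl | ht')
    · exact ⟨σ.j, by rw [hself]; simp [hMdef], hz⟩
    · obtain ⟨m, hm, hz'⟩ := h.sound t ht'
      refine ⟨m, ?_, hz'⟩
      rcases eq_or_ne m σ.j with rfl | hne
      · rw [hself]; simp only [hMdef]; omega
      · rwa [hupd m hne]
  · intro m t htm hz'
    rcases eq_or_ne m σ.j with rfl | hne
    · rw [hself] at htm
      simp only [hMdef] at htm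
      rcases Nat.lt_succ_iff_lt_or_eq.1 htm with hlt | rfl
      · exact Or.inr (h.complete _ t hlt hz')
      · exact Or.inl rfl
    · rw [hupd m hne] at htm; exact Or.inr (h.complete m t htm hz')
end Inv
end Amortization

/-! ### Work bounds, creation of copies, and the general step -/

namespace Amortization
variable {Out Halt : ℕ → Prop} {p N : ℕ}

lemma Stream.succ_le (hS : Stream Out Halt p N) {t : ℕ} (h : Out t) : cnt Out t + 1 ≤ N := by
  rw [← cnt_succ_of_out h]; exact hS.cnt_le _

/-- The work is at most t + 2c + 1 by the potential argument, where c outputs have been seen, and t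
≤ (c + 1) p by incremental delay. -/
lemma MInv.mu_le (hS : Stream Out Halt p N) (hN : 1 ≤ N) {m : ℕ} {M : Mach} (h : MInv Out m M)
    (hph : M.ph = 0 ∨ M.ph = 1) (hH : ¬ Halt M.t) : M.mu ≤ (cnt Out M.t + 1) * (p + 2) := by
  have h1 := hS.le_of_not_halt _ hH hN
  have h2 : (cnt Out M.t + 1) * (p + 2) = (cnt Out M.t + 1) * p + 2 * cnt Out M.t + 2 := by ring
  rcases hph with h0 | h0
  · have := (h.run h0).2.2; omega
  · have := (h.carry h0).2.2.2.2.2; omega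

lemma MInv.cnt_lt {m : ℕ} {M : Mach} (h : MInv Out m M) (hph : M.ph = 0 ∨ M.ph = 1) :
    cnt Out M.t < (M.bits m + 1) * 2 ^ m := by
  rcases hph with h0 | h0
  · rw [← (h.run h0).1]; exact val_lt h.low
  · exact (h.carry h0).2.2.2.2.1

lemma MInv.top_le {m : ℕ} {M : Mach} (h : MInv Out m M) (hph : M.ph = 0 ∨ M.ph = 1) :
    M.bits m ≤ 1 := by
  rcases hph with h0 | h0
  · exact (h.run h0).2.1
  · exact (h.carry h0).2.2.2.1

/-- An unfinished copy that is not in front of an output. -/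
lemma MInv.mu_le_pow (hS : Stream Out Halt p N) (hN : 1 ≤ N) {m : ℕ} {M : Mach}
    (h : MInv Out m M) (hph : M.ph = 0 ∨ M.ph = 1) (hH : ¬ Halt M.t) :
    M.mu ≤ 2 ^ (m + 1) * (p + 2) := by
  refine (h.mu_le hS hN hph hH).trans (Nat.mul_le_mul_right _ ?_)
  have h1 := h.cnt_lt hph
  have h2 := Nat.mul_le_mul_right (2 ^ m) (Nat.add_le_add_right (h.top_le hph) 1)
  rw [pow_succ]; omega

/-- A carry that reaches position m has cleared all smaller digits, so the incremented count is a
multiple of 2 ^ m. -/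
lemma MInv.carry_end {m : ℕ} {M : Mach} (h : MInv Out m M) (h1 : M.ph = 1) (hq : ¬ M.q < m) :
    M.q = m ∧ val m M.bits = M.bits m * 2 ^ m ∧
      cnt Out M.t + 1 = (M.bits m + 1) * 2 ^ m := by
  obtain ⟨-, h3, h4, -⟩ := h.carry h1
  have hqm : M.q = m := le_antisymm h.q_le (not_lt.1 hq)
  rw [hqm] at h3 h4
  have : val m M.bits = M.bits m * 2 ^ m := by
    rw [val, Finset.sum_range_succ, Finset.sum_eq_zero, zero_add]
    intro i hi
    rw [h4 i (Finset.mem_range.1 hi), zero_mul]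
  refine ⟨hqm, this, ?_⟩
  rw [← h3, this]; ring

namespace Inv
variable {σ : St}

lemma eq_last (h : Inv Out Halt p N σ) (hb : (σ.mach σ.j).bits σ.j = 0) : σ.j = σ.K := by
  by_contra hne
  have := h.hit σ.j (lt_of_le_of_ne h.j_le hne)
  omega

/-- The delicate point is that the new copy is created early. Let S be the number of solutions
emitted below copy K, its creator. The fuel condition gives 8(p+2)S ≤ mu + 8(p+2)v, where mu ≤ 2^K
(p+2) because copy K is just in front of output number 2^K, and 8v ≤ 2^K by induction. Hence 8S ≤
2^(K+1), which is the bound needed for copy K + 1. -/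
lemma spawn (hS : Stream Out Halt p N) (h : Inv Out Halt p N σ) (h1 : (σ.mach σ.j).ph = 1)
    (hq : ¬ (σ.mach σ.j).q < σ.j) (hb : (σ.mach σ.j).bits σ.j = 0) :
    Inv Out Halt p N (σ.spawn Out (8 * (p + 2))) := by
  have hM := h.mach σ.j
  obtain ⟨hqj, hval, hcnt⟩ := hM.carry_end h1 hq
  obtain ⟨hout, h3, h4, h5, h6, h7⟩ := hM.carry h1
  have hjK := h.eq_last hb
  rw [hb] at hcnt hval
  simp only [zero_add, one_mul, zero_mul] at hcnt hval
  set M : Mach := { σ.mach σ.j with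
    ph := 2
    mu := (σ.mach σ.j).mu + 1
    bits := Function.update (σ.mach σ.j).bits (σ.mach σ.j).q
      ((σ.mach σ.j).bits (σ.mach σ.j).q + 1) } with hMdef
  have hupd : ∀ m, m ≠ σ.j → (σ.spawn Out (8 * (p + 2))).mach m = σ.mach m := fun m hm => by
    simp [St.spawn, Function.update_of_ne hm]
  have hself : (σ.spawn Out (8 * (p + 2))).mach σ.j = M := by simp [St.spawn, hMdef]
  have hem : ∀ m, emitted Out (σ.spawn Out (8 * (p + 2))).mach m = emitted Out σ.mach m :=
    emitted_update (by simp)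
  have hH : ¬ Halt (σ.mach σ.j).t := fun hh => hS.halt_not_out _ hh hout
  have hN := hS.succ_le hout
  have hbits : M.bits = Function.update (σ.mach σ.j).bits σ.j 1 := by
    simp only [hMdef, hqj, hb]
  have hMinv : MInv Out σ.j M := by
    refine ⟨?_, ?_, ?_, hM.q_le, by simp [hMdef], by simp [hMdef], by simp [hMdef], fun _ => ?_,
      by simp [hMdef]⟩
    · intro i hi
      rw [hbits, Function.update_of_ne hi.ne]; exact hM.low i hi
    · intro i hi
      rw [hbits, Function.update_of_ne (ne_of_gt hi)]; exact hM.high i hi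
    · simp [hbits]
    · have e1 := val_update le_rfl (σ.mach σ.j).bits (m := σ.j) 1
      have e2 := digitSum_update le_rfl (σ.mach σ.j).bits (m := σ.j) 1
      rw [hb] at e1 e2
      refine ⟨hout, ?_, by simp [hbits], ?_⟩
      · rw [hbits]; show _ = cnt Out (σ.mach σ.j).t + 1; omega
      · rw [hbits]
        show (σ.mach σ.j).mu + 1 + _ ≤ (σ.mach σ.j).t + 2 * cnt Out (σ.mach σ.j).t + 3
        omega
  -- Copy K stands in front of the first solution of its zone and has emitted nothing itself.
  have hems : emitted Out σ.mach (σ.K + 1) = emitted Out σ.mach σ.j := by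
    rw [← hjK, emitted, Finset.sum_range_succ, hcnt]; simp [emitted]
  have hv : ∀ m ≤ σ.K, (σ.spawn Out (8 * (p + 2))).v m = σ.v m := fun m hm => by
    simp only [St.spawn]; rw [Function.update_of_ne (by omega)]
  have hvK : (σ.spawn Out (8 * (p + 2))).v (σ.K + 1) = emitted Out σ.mach σ.j := by
    simp [St.spawn, hems]
  have hfresh := h.fresh (σ.K + 1) (by omega)
  constructor
  · exact le_rfl
  · exact le_rfl
  · intro m
    rcases eq_or_ne m σ.j with rfl | hm
    · rw [hself]; exact hMinv
    · rw [hupd m hm]; exact h.mach m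
  · intro m hmK
    rcases eq_or_ne m σ.j with rfl | hm
    · rw [hself, hbits]; simp
    · rw [hupd m hm]
      refine h.hit _ ?_
      simp only [St.spawn] at hmK
      omega
  · show ((σ.spawn _ _).mach (σ.K + 1)).bits (σ.K + 1) = 0
    rw [hupd _ (by omega), hfresh]; rfl
  · intro m hm
    simp only [St.spawn] at hm
    rw [hupd m (by omega)]; exact h.fresh m (by omega)
  · intro _
    rcases eq_or_ne 0 σ.j with e | hne
    · rw [e, hself]
    · rw [hupd 0 hne]; exact h.first (by omega)
  · intro m hm
    simp only [St.spawn] at hm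
    rw [hupd m (by omega), h.fresh m (by omega)]; simp [Mach.init]
  · intro m hm
    rcases eq_or_ne m (σ.K + 1) with rfl | hne
    · rw [hvK]
      have hfu := (h.fuel σ.j h.j_le (by omega) hH).now rfl
      have hf := h.f_le
      have hmu := hM.mu_le hS (by omega) (Or.inr h1) hH
      rw [hcnt] at hmu
      have hv' := Nat.mul_le_mul_right (p + 2) (h.v_le σ.j h.j_le)
      have : (p + 2) * (8 * emitted Out σ.mach σ.j) ≤ (p + 2) * 2 ^ (σ.K + 1) := by
        rw [← hjK, pow_succ]
        nlinarith
      exact Nat.le_of_mul_le_mul_left this (by omega)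
    · simp only [St.spawn] at hm
      rw [hv m (by omega)]; exact h.v_le m (by omega)
  · intro m hm h3' hH'
    rw [hem]
    rcases eq_or_ne m (σ.K + 1) with rfl | hne
    · rw [hvK, hupd _ (by omega), hems, hfresh]
      refine ⟨fun hj => absurd hj (lt_irrefl _), fun _ => ?_, fun hj => absurd hj (lt_irrefl _)⟩
      simp [St.spawn]
    · have hm' : m ≤ σ.K := by simp only [St.spawn] at hm; omega
      rw [hv m hm']
      refine ⟨fun hj => ?_, fun (hj : m = σ.K + 1) => absurd hj hne,
        fun (hj : σ.K + 1 < m) => by omega⟩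
      have hf := h.f_le
      rcases eq_or_ne m σ.j with rfl | hmj
      · have := (h.fuel σ.j h.j_le (by omega) hH).now rfl
        rw [hself]
        simp only [hMdef]
        omega
      · rw [hupd m hmj] at h3' hH' ⊢
        exact (h.fuel m hm' h3' hH').before (by omega)
  · intro m hm
    rcases eq_or_ne m σ.K with rfl | hne
    · rw [← hjK]; omega
    · exact h.N_ge m (by simp only [St.spawn] at hm; omega)
  · intro t ht'
    obtain ⟨m, hm, hz'⟩ := h.sound t ht'
    refine ⟨m, ?_, hz'⟩
    rcases eq_or_ne m σ.j with rfl | hne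
    · rw [hself]; exact hm
    · rwa [hupd m hne]
  · intro m t htm hz'
    rcases eq_or_ne m σ.j with rfl | hne
    · rw [hself] at htm; exact h.complete _ t htm hz'
    · rw [hupd m hne] at htm; exact h.complete m t htm hz'

/-- The effect of `next`, when the enumerator does not quit. -/
lemma next (hS : Stream Out Halt p N) (h : Inv Out Halt p N σ) (hst : ¬ σ.quit Halt) :
    Inv Out Halt p N (next Out Halt (8 * (p + 2)) σ) := by
  have hM := h.mach σ.j
  unfold Amortization.next
  set M := σ.mach σ.j with hMdef
  by_cases h2 : M.ph = 2
  · simp only [h2, if_true]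
    refine h.emission hS h2 (Nat.pos_of_ne_zero fun h0 => hst ⟨h0, Or.inl ?_⟩)
    rw [← h0]; exact h2
  by_cases h3 : M.ph = 3
  · simp only [h3]
    exact h.down h2 (Or.inl h3)
  by_cases hf : σ.f = 0
  · simp only [h2, h3, hf, if_true, if_false]
    exact h.down h2 (Or.inr (Or.inr hf))
  by_cases h1 : M.ph = 1
  · simp only [h1, hf, if_true, if_false, if_neg (show ¬ (1 = 2) by omega),
      if_neg (show ¬ (1 = 3) by omega)]
    obtain ⟨hout, c2, c3, c4, c5, c6⟩ := hM.carry h1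
    have hH : ¬ Halt M.t := fun hh => hS.halt_not_out _ hh hout
    split_ifs with hq hbq hbj hbj
    · -- skipped output
      have hne : σ.j ≠ M.q := by omega
      have e1 := val_update hq.le M.bits 1
      have e2 := digitSum_update hq.le M.bits 1
      have ec := cnt_succ_of_out hout
      rw [hbj] at c5
      have hv : val σ.j (Function.update M.bits M.q 1) = cnt Out (M.t + 1) := by
        rw [ec, ← c2]; rw [hbq] at e1; omega
      have hlow : ∀ i < σ.j, Function.update M.bits M.q 1 i ≤ 1 := by
        intro i hi
        rcases eq_or_ne i M.q with rfl | hi'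
        · simp
        · rw [Function.update_of_ne hi']; exact hM.low i hi
      have hlt := val_lt hlow
      rw [hv, Function.update_of_ne hne, hbj, ec] at hlt
      refine h.work h2 h3 hH hf ?_ rfl (Nat.le_succ _) ?_ ?_ ?_ ?_
      · refine ⟨hlow, ?_, ?_, hM.q_le, by simp, fun _ => ⟨hv, ?_, ?_⟩, by simp, by simp, by simp⟩
        · intro i hi
          show Function.update M.bits M.q 1 i = 0
          rw [Function.update_of_ne (by omega)]; exact hM.high i hi
        · show Function.update M.bits M.q 1 σ.j ≤ 2
          rw [Function.update_of_ne hne]; exact hM.top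
        · show Function.update M.bits M.q 1 σ.j ≤ 1
          rw [Function.update_of_ne hne]; exact c4
        · show M.mu + 1 + digitSum σ.j (Function.update M.bits M.q 1) ≤
            M.t + 1 + 2 * cnt Out (M.t + 1)
          rw [hbq] at e2
          omega
      · show cnt Out (M.t + 1) + 1 - _ = cnt Out M.t + 1 - _
        rw [ec]; omega
      · intro _
        show Function.update M.bits M.q 1 σ.j = 0
        rw [Function.update_of_ne hne]; exact hbj
      · intro hh
        rw [← hMdef] at hh
        omega
      · rintro t ht (ht' : t < M.t + 1) hz
        rw [← hMdef] at ht
        have : t = M.t := by omega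
        subst this
        have := hz.2.1
        omega
    · -- solution found
      have hne : σ.j ≠ M.q := by omega
      have e1 := val_update hq.le M.bits 1
      have e2 := digitSum_update hq.le M.bits 1
      rw [hbq] at e1 e2
      refine h.work h2 h3 hH hf ?_ rfl le_rfl rfl ?_ ?_ (by simp [hMdef]; intros; omega)
      · refine ⟨?_, ?_, ?_, hM.q_le, by simp, by simp, by simp, fun _ => ⟨hout, ?_, ?_, ?_⟩, by simp⟩
        · intro i hi
          show Function.update M.bits M.q 1 i ≤ 1
          rcases eq_or_ne i M.q with rfl | hi'
          · simp
          · rw [Function.update_of_ne hi']; exact hM.low i hi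
        · intro i hi
          show Function.update M.bits M.q 1 i = 0
          rw [Function.update_of_ne (by omega)]; exact hM.high i hi
        · show Function.update M.bits M.q 1 σ.j ≤ 2
          rw [Function.update_of_ne hne]; exact hM.top
        · show val σ.j (Function.update M.bits M.q 1) = cnt Out M.t + 1
          omega
        · show Function.update M.bits M.q 1 σ.j = 1
          rw [Function.update_of_ne hne]; omega
        · show M.mu + 1 + digitSum σ.j (Function.update M.bits M.q 1) ≤
            M.t + 2 * cnt Out M.t + 3
          omega
      · intro hh; exact absurd hh hbj
      · intro hh
        show 1 ≤ Function.update M.bits M.q 1 σ.j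
        rw [Function.update_of_ne hne]; exact hh
    · -- carry
      have hne : σ.j ≠ M.q := by omega
      have hbq1 : M.bits M.q = 1 := by have := hM.low M.q hq; omega
      have e1 := val_update hq.le M.bits 0
      have e2 := digitSum_update hq.le M.bits 0
      rw [hbq1] at e1 e2
      refine h.work h2 h3 hH hf ?_ rfl le_rfl rfl ?_ ?_ (by simp [hMdef]; intros; omega)
      · refine ⟨?_, ?_, ?_, ?_, by simp, by simp, fun _ => ⟨hout, ?_, ?_, ?_, ?_, ?_⟩,
          by simp, by simp⟩
        · intro i hi
          show Function.update M.bits M.q 0 i ≤ 1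
          rcases eq_or_ne i M.q with rfl | hi'
          · simp
          · rw [Function.update_of_ne hi']; exact hM.low i hi
        · intro i hi
          show Function.update M.bits M.q 0 i = 0
          rw [Function.update_of_ne (by omega)]; exact hM.high i hi
        · show Function.update M.bits M.q 0 σ.j ≤ 2
          rw [Function.update_of_ne hne]; exact hM.top
        · exact hq
        · show val σ.j (Function.update M.bits M.q 0) + 2 ^ (M.q + 1) = cnt Out M.t + 1
          rw [pow_succ]; omega
        · rintro i (hi : i < M.q + 1)
          show Function.update M.bits M.q 0 i = 0
          rcases eq_or_ne i M.q with rfl | hi'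
          · simp
          · rw [Function.update_of_ne hi']; exact c3 i (by omega)
        · show Function.update M.bits M.q 0 σ.j ≤ 1
          rw [Function.update_of_ne hne]; exact c4
        · show cnt Out M.t < (Function.update M.bits M.q 0 σ.j + 1) * _
          rw [Function.update_of_ne hne]; exact c5
        · show M.mu + 1 + digitSum σ.j (Function.update M.bits M.q 0) ≤
            M.t + 2 * cnt Out M.t + 1
          omega
      · intro hh
        show Function.update M.bits M.q 0 σ.j = 0
        rw [Function.update_of_ne hne]; exact hh
      · intro hh
        show 1 ≤ Function.update M.bits M.q 0 σ.j
        rw [Function.update_of_ne hne]; exact hh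
    · exact h.spawn hS h1 hq hbj
    · -- finished
      obtain ⟨hqj, hval, hcnt⟩ := hM.carry_end h1 hq
      have hb1 : M.bits σ.j = 1 := by omega
      rw [hb1] at hcnt
      refine h.work h2 h3 hH hf ?_ rfl le_rfl rfl ?_ ?_ (by simp [hMdef]; intros; omega)
      · rw [hqj, hb1]
        refine ⟨?_, ?_, ?_, le_rfl, by simp, by simp, by simp, by simp, fun _ => ⟨?_, ?_⟩⟩
        · intro i hi
          show Function.update M.bits σ.j (1 + 1) i ≤ 1
          rw [Function.update_of_ne (by omega)]; exact hM.low i hi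
        · intro i hi
          show Function.update M.bits σ.j (1 + 1) i = 0
          rw [Function.update_of_ne (by omega)]; exact hM.high i hi
        · simp
        · simp
        · show cnt Out M.t + 1 = _
          rw [hcnt, pow_succ]; ring
      · intro hh; exact absurd hh hbj
      · intro hh
        show 1 ≤ Function.update M.bits M.q (M.bits M.q + 1) σ.j
        rw [hqj]; simp
  have h0 : M.ph = 0 := by have := hM.ph_le; omega
  obtain ⟨r1, r2, r3⟩ := hM.run h0
  simp only [h0, hf, if_false, if_neg (show ¬ (0 = 2) by omega),
      if_neg (show ¬ (0 = 3) by omega), if_neg (show ¬ (0 = 1) by omega)]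
  split_ifs with hH hout
  · exact h.down h2 (Or.inr (Or.inl hH))
  · refine h.work h2 h3 hH hf ?_ rfl le_rfl rfl (fun hh => hh) (fun hh => hh)
      (by simp [hMdef]; intros; omega)
    refine ⟨hM.low, hM.high, hM.top, Nat.zero_le _, by simp, by simp,
      fun _ => ⟨hout, ?_, ?_, r2, ?_, ?_⟩, by simp, by simp⟩
    · show val _ M.bits + 2 ^ 0 = _
      simpa using r1
    · intro i hi; exact absurd hi (Nat.not_lt_zero i)
    · rw [← r1]; exact val_lt hM.low
    · show M.mu + 1 + digitSum σ.j M.bits ≤ M.t + 2 * cnt Out M.t + 1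
      omega
  · have ec := cnt_succ_of_not hout
    refine h.work h2 h3 hH hf ?_ rfl (Nat.le_succ _) ?_ (fun hh => hh) (fun hh => hh) ?_
    · refine ⟨hM.low, hM.high, hM.top, hM.q_le, by simp,
        fun _ => ⟨r1.trans ec.symm, r2, ?_⟩, by simp, by simp, by simp⟩
      show M.mu + 1 + digitSum σ.j M.bits ≤ M.t + 1 + 2 * cnt Out (M.t + 1)
      rw [ec]
      omega
    · show cnt Out (M.t + 1) + 1 - _ = _
      rw [ec]
    · rintro t ht (ht' : t < M.t + 1) hz
      rw [← hMdef] at ht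
      have : t = M.t := by omega
      subst this
      exact hout hz.1

end Inv
end Amortization

/-! ### Delay, termination and completeness of the schedule -/

namespace Amortization
variable {Out Halt : ℕ → Prop} {p N : ℕ}

def St.init (p : ℕ) : St := ⟨0, 0, 8 * (p + 2), fun _ => Mach.init, fun _ => 0, ∅⟩

noncomputable def seq (Out Halt : ℕ → Prop) (p a : ℕ) : St :=
  (next Out Halt (8 * (p + 2)))^[a] (St.init p)

lemma seq_succ (a : ℕ) :
    seq Out Halt p (a + 1) = next Out Halt (8 * (p + 2)) (seq Out Halt p a) :=
  Function.iterate_succ_apply' _ _ _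

lemma Inv.init : Inv Out Halt p N (St.init p) where
  j_le := le_rfl
  f_le := le_rfl
  mach m := MInv.init m
  hit m hm := absurd hm (Nat.not_lt_zero m)
  last := rfl
  fresh _ _ := rfl
  first h := absurd h (Nat.not_lt_zero 0)
  passed m _ := by simp [St.init, Mach.init]
  v_le m _ := by simp [St.init]
  fuel m hm _ _ := by
    have h0 : m = 0 := Nat.le_zero.1 hm
    subst h0
    constructor <;> simp [St.init, Mach.init, emitted]
  N_ge m hm := absurd hm (Nat.not_lt_zero m)
  sound t ht := absurd ht (Set.notMem_empty t)
  complete m t ht := absurd ht (Nat.not_lt_zero t)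

namespace Inv
variable {σ : St}

/-- Copy K - 1 has found solution number 2 ^ (K - 1), so this number is at most N. -/
lemma K_le (h : Inv Out Halt p N σ) : σ.K ≤ Nat.log 2 N + 1 := by
  rcases Nat.eq_zero_or_pos σ.K with h0 | h0
  · omega
  · have := Nat.le_log_of_pow_le (by norm_num) (h.N_ge (σ.K - 1) (by omega))
    omega

lemma ph_ne_three_of_bits (h : Inv Out Halt p N σ) {m : ℕ} (hb : (σ.mach m).bits m = 0) :
    (σ.mach m).ph ≠ 3 := fun h3 => by
  have := ((h.mach m).fin h3).1; omega

/-- Once a second copy exists, copy 0 waits in front of its solution for the rest of the run. -/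
lemma K_eq_zero (h : Inv Out Halt p N σ) (hj : σ.j = 0) (h2 : (σ.mach σ.j).ph ≠ 2) : σ.K = 0 := by
  by_contra h0
  rw [hj] at h2
  exact h2 (h.first (Nat.pos_of_ne_zero h0))

/-- The other way to quit would have copy 0 halted with leading digit 0, hence with no output seen,
while a halted copy has seen all N. -/
lemma ph_eq_two_of_quit (hS : Stream Out Halt p N) (h : Inv Out Halt p N σ) (hN : 1 ≤ N)
    (hst : σ.quit Halt) : (σ.mach σ.j).ph = 2 := by
  obtain ⟨hj, h2 | ⟨h0, hf, hH⟩⟩ := hst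
  · rw [hj]; exact h2
  · exfalso
    have hK := h.K_eq_zero hj (by rw [hj, h0]; omega)
    have hl := h.last
    rw [hK] at hl
    have := (h.mach 0).cnt_lt (Or.inl h0)
    rw [hl, hS.cnt_halt _ hH] at this
    simp at this
    omega

/-- Creating a copy raises both K and j by one; the factor 2 makes the first summand drop by one all
the same. A refill of fuel is at most 8(p+2), less than the weight 8(p+2) + 2 of one turn. -/
def rank (p N : ℕ) (σ : St) : ℕ :=
  (2 * (Nat.log 2 N + 1 - σ.K) + σ.j) * (8 * (p + 2) + 2) + σ.f

lemma rank_le (h : Inv Out Halt p N σ) :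
    rank p N σ ≤ (2 * (Nat.log 2 N + 1) + 1) * (8 * (p + 2) + 2) := by
  have h1 := h.j_le
  have h2 := h.K_le
  have h3 := h.f_le
  have : (2 * (Nat.log 2 N + 1 - σ.K) + σ.j) * (8 * (p + 2) + 2) ≤
    (2 * (Nat.log 2 N + 1)) * (8 * (p + 2) + 2) := Nat.mul_le_mul_right _ (by omega)
  rw [rank, add_mul _ 1]
  omega

lemma rank_down (hj : 0 < σ.j) : rank p N (σ.down (8 * (p + 2))) < rank p N σ := by
  have e : 2 * (Nat.log 2 N + 1 - σ.K) + σ.j = 2 * (Nat.log 2 N + 1 - σ.K) + (σ.j - 1) + 1 := by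
    omega
  rw [rank, rank, e, add_mul _ 1]
  simp only [St.down]
  omega

lemma rank_work (hf : σ.f ≠ 0) (M : Mach) : rank p N (σ.work M) < rank p N σ := by
  simp only [rank, St.work]
  omega

/-- The rank could fail to drop only if control were passed down from copy 0 to itself. Without a
pending solution in copy 0 it is the only copy; it cannot be finished, and its first turn has more
fuel than it needs to reach the first solution. -/
lemma rank_next (hS : Stream Out Halt p N) (h : Inv Out Halt p N σ) (hN : 1 ≤ N)
    (hst : ¬ σ.quit Halt) (h2 : (σ.mach σ.j).ph ≠ 2) :
    rank p N (Amortization.next Out Halt (8 * (p + 2)) σ) < rank p N σ := by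
  have hM := h.mach σ.j
  have hn := h.next hS hst
  have h30 : σ.j = 0 → (σ.mach σ.j).ph ≠ 3 := fun hj =>
    h.ph_ne_three_of_bits (by rw [hj.trans (h.K_eq_zero hj h2).symm]; exact h.last)
  -- With empty fuel, copy 0 would have done 8(p+2) units of work, but before the first solution it
  -- does at most 2(p+2).
  have hf0 : (σ.mach σ.j).ph ≠ 3 → ¬ Halt (σ.mach σ.j).t → σ.j = 0 → σ.f ≠ 0 := by
    intro h3 hH hj hf
    have hK := h.K_eq_zero hj h2
    have hph : (σ.mach σ.j).ph = 0 ∨ (σ.mach σ.j).ph = 1 := by have := hM.ph_le; omega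
    have hmu := hM.mu_le_pow hS hN hph hH
    have hfu := (h.fuel σ.j h.j_le h3 hH).now rfl
    have hv := h.v_le σ.j h.j_le
    rw [hj] at hv hmu hfu
    have hv0 : σ.v 0 = 0 := by omega
    rw [hf, hv0, emitted_zero] at hfu
    simp at hfu hmu
    omega
  revert hn
  unfold Amortization.next
  simp only [h2, if_false]
  split_ifs with h3 hf h1 hq hbq hb hb hH hO <;> intro hn
  · exact rank_down (Nat.pos_of_ne_zero fun hj => h30 hj h3)
  · refine rank_down (Nat.pos_of_ne_zero fun hj => ?_)
    by_cases hH : Halt (σ.mach σ.j).t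
    · have hK := h.K_eq_zero hj h2
      have hph : (σ.mach σ.j).ph = 0 ∨ (σ.mach σ.j).ph = 1 := by have := hM.ph_le; omega
      have := hM.cnt_lt hph
      rw [show (σ.mach σ.j).bits σ.j = 0 by rw [hj.trans hK.symm]; exact h.last,
        hS.cnt_halt _ hH, hj] at this
      simp at this
      omega
    · exact hf0 h3 hH hj hf
  · exact rank_work hf _
  · exact rank_work hf _
  · exact rank_work hf _
  · have := hn.K_le
    have hj := h.eq_last hb
    simp only [St.spawn] at this
    simp only [rank, St.spawn]
    have e : 2 * (Nat.log 2 N + 1 - σ.K) + σ.j =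
      2 * (Nat.log 2 N + 1 - (σ.K + 1)) + (σ.K + 1) + 1 := by omega
    rw [e, add_mul _ 1]
    omega
  · exact rank_work hf _
  · refine rank_down (Nat.pos_of_ne_zero fun hj => hst ⟨hj, Or.inr ⟨?_, hf, ?_⟩⟩)
    · have := hM.ph_le; rw [← hj]; omega
    · rwa [hj] at hH
  · exact rank_work hf _
  · exact rank_work hf _

/-- Copies 1, …, m - 2 contribute their full zones, 2^(m-1) - 2 solutions in all, and copy m - 1 at
least one. Nothing is claimed about copy 0, which still withholds its solution, and no more about
copy m - 1, which may have halted inside its zone. -/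
lemma emitted_add_one_ge {m : ℕ} (hm : 1 ≤ m)
    (h1 : ∀ i, 1 ≤ i → i + 1 < m → 2 ^ (i + 1) ≤ cnt Out (σ.mach i).t + 1)
    (h2 : 2 ≤ m → 2 ^ (m - 1) + 1 ≤ cnt Out (σ.mach (m - 1)).t + 1) :
    2 ^ (m - 1) ≤ emitted Out σ.mach m + 1 := by
  have key : ∀ l, l + 2 ≤ m → 2 ^ (l + 1) ≤ emitted Out σ.mach (l + 1) + 2 := by
    intro l
    induction l with
    | zero => intro _; simp
    | succ l ih =>
      intro hl
      have := ih (by omega)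
      have h3 := h1 (l + 1) (by omega) (by omega)
      rw [emitted, Finset.sum_range_succ, ← emitted]
      have : 2 ^ (l + 1 + 1) = 2 ^ (l + 1) * 2 := pow_succ _ _
      omega
  obtain ⟨l, rfl⟩ : ∃ l, m = l + 1 := ⟨m - 1, by omega⟩
  rcases Nat.eq_zero_or_pos l with rfl | hl
  · simp
  · obtain ⟨r, rfl⟩ : ∃ r, l = r + 1 := ⟨l - 1, by omega⟩
    have h3 := key r (by omega)
    have h4 := h2 (by omega)
    rw [show r + 1 + 1 - 1 = r + 1 by omega] at h4 ⊢
    rw [emitted, Finset.sum_range_succ, ← emitted]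
    omega

/-- When the first copy emits its solution, all other copies have finished. -/
lemma finished (hS : Stream Out Halt p N) (h : Inv Out Halt p N σ) (hN : 1 ≤ N) (hj : σ.j = 0)
    (m : ℕ) : 1 ≤ m → m ≤ σ.K → (σ.mach m).ph = 3 ∨ Halt (σ.mach m).t := by
  induction m using Nat.strong_induction_on with
  | _ m ih =>
    intro hm hmK
    by_contra! hc
    obtain ⟨h3, hH⟩ := hc
    have hp : (σ.mach m).ph ≠ 2 := h.passed m (by omega)
    have hph : (σ.mach m).ph = 0 ∨ (σ.mach m).ph = 1 := by have := (h.mach m).ph_le; omega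
    have hmu := (h.mach m).mu_le_pow hS hN hph hH
    have hfu := (h.fuel m hmK h3 hH).after (by omega)
    have hv := h.v_le m hmK
    have hNm := h.N_ge (m - 1) (by omega)
    have hge : 2 ^ (m - 1) ≤ emitted Out σ.mach m + 1 := by
      refine emitted_add_one_ge hm (fun i hi him => ?_) (fun hm2 => ?_)
      · rcases ih i (by omega) hi (by omega) with hh | hh
        · rw [((h.mach i).fin hh).2]
        · rw [hS.cnt_halt _ hh]
          have : 2 ^ (i + 1) ≤ 2 ^ (m - 1) := Nat.pow_le_pow_right (by norm_num) (by omega)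
          omega
      · rcases ih (m - 1) (by omega) (by omega) (by omega) with hh | hh
        · rw [((h.mach _).fin hh).2, pow_succ]
          have := Nat.one_le_two_pow (n := m - 1)
          omega
        · rw [hS.cnt_halt _ hh]; omega
    have e : 2 ^ m = 2 ^ (m - 1) * 2 := by rw [← pow_succ]; congr 1; omega
    have e' : 2 ^ (m + 1) = 2 ^ m * 2 := pow_succ _ _
    -- The contradiction: 8(p+2)·2^(m-1) is four times 2^m(p+2), the solutions emitted before the
    -- creation account for at most one such share, and the work of the copy for at most two.
    have h5 : 8 * (p + 2) * 2 ^ (m - 1) ≤ 8 * (p + 2) * (emitted Out σ.mach m + 1) :=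
      Nat.mul_le_mul_left _ hge
    have h6 := Nat.mul_le_mul_left (p + 2) hv
    have h7 : 0 < (p + 2) * 2 ^ (m - 1) := by positivity
    rw [e', e] at hmu
    rw [e] at h6
    nlinarith

/-- Solution number r belongs to zone m = log r. The first solution is the one being emitted. For
the others copy m is finished or halted and hence past it. If copy m does not exist, the last copy K
must have halted with leading digit 0, so N < 2^K ≤ 2^m ≤ r, which is impossible. -/
lemma complete_of_quit (hS : Stream Out Halt p N) (h : Inv Out Halt p N σ) (hst : σ.quit Halt)
    {t : ℕ} (ht : Out t) : t ∈ σ.em ∨ σ.emit = some t := by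
  have hN1 := hS.succ_le ht
  have hN : 1 ≤ N := by omega
  have h2 := h.ph_eq_two_of_quit hS hN hst
  have hj : σ.j = 0 := hst.1
  have hz0 := bits_pos_of_pend (h.mach σ.j) h2
  rw [hj] at hz0
  set m := Nat.log 2 (cnt Out t + 1) with hm
  have hz : Zone Out m t := ⟨ht, Nat.pow_log_le_self 2 (by omega),
    Nat.lt_pow_succ_log_self (by norm_num) _⟩
  have mono : ∀ t', cnt Out t + 1 ≤ cnt Out t' → t < t' := by
    intro t' hle
    by_contra! hlt
    have := cnt_mono (Out := Out) hlt
    omega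
  rcases Nat.eq_zero_or_pos m with h0 | hpos
  · right
    rw [h0] at hz
    have hmem : ∀ t₁ t₂, Zone Out 0 t₁ → Zone Out 0 t₂ → t₁ ≤ t₂ := by
      intro t₁ t₂ z₁ z₂
      by_contra! hlt
      have h1 := cnt_mono (Out := Out) hlt
      have := cnt_succ_of_out z₂.1
      have h3 := z₁.2.2
      have h4 := z₂.2.2
      norm_num at h3 h4
      have : cnt Out (t₂ + 1) ≤ cnt Out t₁ := cnt_mono hlt
      omega
    have : t = (σ.mach 0).t := le_antisymm (hmem _ _ hz hz0) (hmem _ _ hz0 hz)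
    rw [St.emit, if_pos h2, hj, this]
  · left
    by_cases hmK : m ≤ σ.K
    · refine h.complete m t (mono _ ?_) hz
      rcases h.finished hS hN hj m hpos hmK with hh | hh
      · have := ((h.mach m).fin hh).2
        have := hz.2.2
        omega
      · rw [hS.cnt_halt _ hh]; exact hN1
    · exfalso
      have hb0 := bits_pos_of_pend (h.mach σ.j) h2
      have hK : 1 ≤ σ.K := by
        by_contra! hK0
        have hK0 : σ.K = 0 := by omega
        have h3 := ((h.mach σ.j).pend h2).2.2.1
        have h4 := h.last
        rw [hK0] at h4
        rw [hj] at h3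
        omega
      rcases h.finished hS hN hj σ.K hK le_rfl with hh | hh
      · exact h.ph_ne_three_of_bits h.last hh
      · have hph : (σ.mach σ.K).ph = 0 ∨ (σ.mach σ.K).ph = 1 := by
          have := (h.mach σ.K).ph_le
          have := h.passed σ.K (by omega)
          have := h.ph_ne_three_of_bits h.last
          omega
        have h5 := (h.mach σ.K).cnt_lt hph
        rw [h.last, hS.cnt_halt _ hh] at h5
        have h6 := hz.2.1
        have h7 : 2 ^ σ.K ≤ 2 ^ m := Nat.pow_le_pow_right (by norm_num) (by omega)
        omega

end Inv

lemma em_next (σ : St) : (next Out Halt (8 * (p + 2)) σ).em = σ.em ∪ {t | σ.emit = some t} := by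
  unfold next St.emit
  by_cases h2 : (σ.mach σ.j).ph = 2
  · simp only [h2, if_true, St.emission, Option.some.injEq]
    ext t; simp [eq_comm, or_comm]
  · simp only [h2, if_false]
    split_ifs <;> simp [St.down, St.work, St.spawn]

lemma mem_em_seq {a t : ℕ} :
    t ∈ (seq Out Halt p a).em ↔ ∃ b < a, (seq Out Halt p b).emit = some t := by
  induction a with
  | zero => simp [seq, St.init]
  | succ a ih =>
    rw [seq_succ, em_next, Set.mem_union, ih]
    constructor
    · rintro (⟨b, hb, e⟩ | e)
      · exact ⟨b, by omega, e⟩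
      · exact ⟨a, by omega, e⟩
    · rintro ⟨b, hb, e⟩
      rcases Nat.lt_succ_iff_lt_or_eq.1 hb with hb | rfl
      · exact Or.inl ⟨b, hb, e⟩
      · exact Or.inr e

lemma emit_eq_some {σ : St} {t : ℕ} :
    σ.emit = some t ↔ (σ.mach σ.j).ph = 2 ∧ (σ.mach σ.j).t = t := by
  simp [St.emit]

lemma Inv.not_mem_em {σ : St} (h : Inv Out Halt p N σ) {t : ℕ} (e : σ.emit = some t) :
    t ∉ σ.em := fun hm => by
  obtain ⟨h2, rfl⟩ := emit_eq_some.1 e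
  obtain ⟨m, hlt, hz⟩ := h.sound _ hm
  rw [hz.unique (Inv.bits_pos_of_pend (h.mach σ.j) h2)] at hlt
  omega

lemma Inv.seq (hS : Stream Out Halt p N) {a : ℕ}
    (ha : ∀ b < a, ¬ (seq Out Halt p b).quit Halt) : Inv Out Halt p N (seq Out Halt p a) := by
  induction a with
  | zero => exact Inv.init
  | succ a ih =>
    rw [seq_succ]
    exact (ih fun b hb => ha b (by omega)).next hS (ha a (by omega))

/-- Induction on the rank, which drops with every unit of work that is not an emission. -/
lemma exists_emit (hS : Stream Out Halt p N) (hN : 1 ≤ N) (r : ℕ) : ∀ a,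
    (∀ b < a, ¬ (seq Out Halt p b).quit Halt) → Inv.rank p N (seq Out Halt p a) ≤ r →
    ∃ a', a ≤ a' ∧ a' ≤ a + r ∧ (∀ b < a', ¬ (seq Out Halt p b).quit Halt) ∧
      (seq Out Halt p a').emit.isSome := by
  induction r using Nat.strong_induction_on with
  | _ r ih =>
    intro a ha hr
    have hI := Inv.seq hS ha
    by_cases h2 : ((seq Out Halt p a).mach (seq Out Halt p a).j).ph = 2
    · exact ⟨a, le_rfl, by omega, ha, by simp [St.emit, h2]⟩
    · have hst : ¬ (seq Out Halt p a).quit Halt := fun hst => h2 (hI.ph_eq_two_of_quit hS hN hst)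
      have hlt := hI.rank_next hS hN hst h2
      rw [← seq_succ] at hlt
      obtain ⟨a', h3, h4, h5, h6⟩ := ih _ (hlt.trans_le hr) (a + 1) (fun b hb => by
        rcases Nat.lt_succ_iff_lt_or_eq.1 hb with hb | rfl
        · exact ha b hb
        · exact hst) le_rfl
      exact ⟨a', by omega, by omega, h5, h6⟩

lemma emit_injective (hS : Stream Out Halt p N) {a a' t : ℕ}
    (ha : ∀ b < a', ¬ (seq Out Halt p b).quit Halt)
    (e : (seq Out Halt p a).emit = some t) (e' : (seq Out Halt p a').emit = some t) : a' ≤ a := by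
  by_contra! hlt
  exact (Inv.seq hS ha).not_mem_em e' (mem_em_seq.2 ⟨a, hlt, e⟩)

lemma Inv.out_of_emit {σ : St} (h : Inv Out Halt p N σ) {t : ℕ} (e : σ.emit = some t) : Out t := by
  obtain ⟨h2, rfl⟩ := emit_eq_some.1 e
  exact (Inv.bits_pos_of_pend (h.mach σ.j) h2).1

/-- With solutions present, a run without end would have infinitely many emissions, all of different
output steps before the halting time. Without solutions the rank is of no use, and the progress of
copy 0 towards its halting time is measured directly. -/
lemma exists_quit (hS : Stream Out Halt p N) : ∃ a, (seq Out Halt p a).quit Halt := by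
  by_contra! hns
  have hI : ∀ a, Inv Out Halt p N (seq Out Halt p a) := fun a => Inv.seq hS fun b _ => hns b
  obtain ⟨tH, hH⟩ := hS.halts
  rcases Nat.eq_zero_or_pos N with rfl | hN
  · have hout : ∀ t, ¬ Out t := fun t ht => by have := hS.succ_le ht; omega
    -- A simulated step lowers the first term by 2 and may exhaust the fuel, which adds 1; a refill
    -- of copy 0 by itself lowers the second term.
    have key : ∀ r a, 2 * (tH - ((seq Out Halt p a).mach 0).t) +
        (if (seq Out Halt p a).f = 0 then 1 else 0) ≤ r → False := by
      intro r
      induction r using Nat.strong_induction_on with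
      | _ r ih =>
        intro a hr
        have h := hI a
        have hK : (seq Out Halt p a).K = 0 := by
          by_contra h0
          have := h.N_ge 0 (Nat.pos_of_ne_zero h0)
          simp at this
        have hj : (seq Out Halt p a).j = 0 := by have := h.j_le; omega
        have hl := h.last
        rw [hK] at hl
        have h3 := h.ph_ne_three_of_bits hl
        have h0 : ((seq Out Halt p a).mach 0).ph = 0 := by
          have := (h.mach 0).ph_le
          have h1 : ((seq Out Halt p a).mach 0).ph ≠ 1 := fun h1 => hout _ ((h.mach 0).carry h1).1
          have h2 : ((seq Out Halt p a).mach 0).ph ≠ 2 := fun h2 => hout _ ((h.mach 0).pend h2).1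
          omega
        refine ih _ ?_ (a + 1) le_rfl
        refine lt_of_lt_of_le ?_ hr
        rw [seq_succ]
        by_cases hf : (seq Out Halt p a).f = 0
        · have : next Out Halt (8 * (p + 2)) (seq Out Halt p a) =
              (seq Out Halt p a).down (8 * (p + 2)) := by
            simp [next, hj, h0, hf]
          rw [this]
          simp [St.down, hf]
        · have hnH : ¬ Halt ((seq Out Halt p a).mach 0).t := fun hh =>
            hns a ⟨hj, Or.inr ⟨h0, hf, hh⟩⟩
          have hlt : ((seq Out Halt p a).mach 0).t < tH := by
            by_contra! hle
            exact hnH (hS.halt_mono _ _ hle hH)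
          have : next Out Halt (8 * (p + 2)) (seq Out Halt p a) =
              (seq Out Halt p a).work
                { (seq Out Halt p a).mach 0 with t := ((seq Out Halt p a).mach 0).t + 1 } := by
            simp [next, hj, h0, hf, hnH, hout]
          rw [this]
          simp only [St.work, hj, Function.update_self, hf, if_false]
          split_ifs <;> omega
    exact key _ 0 le_rfl
  · have hex : ∀ a, ∃ a' ≥ a, ∃ t, (seq Out Halt p a').emit = some t := fun a => by
      obtain ⟨a', h1, -, -, h2⟩ := exists_emit hS hN _ a (fun b _ => hns b) le_rfl
      obtain ⟨t, ht⟩ := Option.isSome_iff_exists.1 h2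
      exact ⟨a', h1, t, ht⟩
    have hinf : {a | ∃ t, (seq Out Halt p a).emit = some t}.Infinite :=
      Set.infinite_of_not_bddAbove fun ⟨B, hB⟩ => by
        obtain ⟨a', h1, h2⟩ := hex (B + 1)
        have := hB h2
        omega
    choose! f hf using fun a (ha : ∃ t, (seq Out Halt p a).emit = some t) => ha
    refine hinf (Set.Finite.of_finite_image (f := f) ((Set.finite_lt_nat tH).subset ?_) ?_)
    · rintro _ ⟨a, ha, rfl⟩
      by_contra hlt
      exact hS.halt_not_out _ (hS.halt_mono _ _ (not_lt.1 hlt) hH) ((hI a).out_of_emit (hf a ha))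
    · intro a ha a' ha' e
      have h1 := hf a ha
      have h2 := hf a' ha'
      rw [← e] at h2
      exact le_antisymm (emit_injective hS (fun b _ => hns b) h2 h1)
        (emit_injective hS (fun b _ => hns b) h1 h2)

/-- Correctness and delay of geometric amortization. -/
structure Trace (Out Halt : ℕ → Prop) (p N A : ℕ) : Prop where
  inv : ∀ a ≤ A, Inv Out Halt p N (seq Out Halt p a)
  quit : (seq Out Halt p A).quit Halt
  not_quit : ∀ a < A, ¬ (seq Out Halt p a).quit Halt
  sound : ∀ a ≤ A, ∀ t, (seq Out Halt p a).emit = some t → Out t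
  complete : ∀ t, Out t → ∃ a ≤ A, (seq Out Halt p a).emit = some t
  injective : ∀ a ≤ A, ∀ a' ≤ A, ∀ t, (seq Out Halt p a).emit = some t →
    (seq Out Halt p a').emit = some t → a = a'
  delay : 1 ≤ N → ∀ a ≤ A, ∃ a', a ≤ a' ∧ a' ≤ A ∧
    a' ≤ a + (2 * (Nat.log 2 N + 1) + 1) * (8 * (p + 2) + 2) ∧ (seq Out Halt p a').emit.isSome

theorem exists_trace (hS : Stream Out Halt p N) : ∃ A, Trace Out Halt p N A := by
  classical
  have hex := exists_quit hS
  have hmin : ∀ b < Nat.find hex, ¬ (seq Out Halt p b).quit Halt := fun b hb => Nat.find_min hex hb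
  have hI : ∀ a ≤ Nat.find hex, Inv Out Halt p N (seq Out Halt p a) := fun a ha =>
    Inv.seq hS fun b hb => hmin b (by omega)
  refine ⟨Nat.find hex, hI, Nat.find_spec hex, hmin, fun a ha t e => (hI a ha).out_of_emit e,
    fun t ht => ?_, fun a ha a' ha' t e e' => le_antisymm
      (emit_injective hS (fun b hb => hmin b (by omega)) e' e)
      (emit_injective hS (fun b hb => hmin b (by omega)) e e'), fun hN a ha => ?_⟩
  · rcases (hI _ le_rfl).complete_of_quit hS (Nat.find_spec hex) ht with hm | e
    · obtain ⟨b, hb, e⟩ := mem_em_seq.1 hm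
      exact ⟨b, hb.le, e⟩
    · exact ⟨_, le_rfl, e⟩
  · obtain ⟨a', h1, h2, h3, h4⟩ := exists_emit hS hN _ a (fun b hb => hmin b (by omega))
      (hI a ha).rank_le
    refine ⟨a', h1, ?_, h2, h4⟩
    by_contra! hlt
    exact h3 _ hlt (Nat.find_spec hex)

end Amortization

/-! ### Elementary facts about runs -/

namespace RAM

lemma cfg_succ (M : RAM) (x : List ℕ) (t : ℕ) : M.cfg x (t + 1) = M.step x (M.cfg x t) :=
  Function.iterate_succ_apply' _ _ _

lemma step_of_some {M : RAM} {x : List ℕ} {c : Config} {i : Instr} (h : M.prog[c.pc]? = some i) :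
    M.step x c = ⟨i.newPc c.pc c.mem, i.newMem x c.mem, (i.touched c.mem).foldr max c.hi⟩ := by
  simp [step, h]

lemma step_of_halted {M : RAM} {x : List ℕ} {c : Config} (h : M.Halted c) : M.step x c = c := by
  rcases h with h | h <;> simp [step, h, Instr.newPc, Instr.newMem, Instr.touched]

lemma cfg_add_of_halted {M : RAM} {x : List ℕ} {t : ℕ} (h : M.Halted (M.cfg x t)) (u : ℕ) :
    M.cfg x (t + u) = M.cfg x t := by
  induction u with
  | zero => rfl
  | succ u ih => rw [← add_assoc, cfg_succ, ih, step_of_halted h]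

lemma cfg_of_halted_le {M : RAM} {x : List ℕ} {t u : ℕ} (h : M.Halted (M.cfg x t)) (hu : t ≤ u) :
    M.cfg x u = M.cfg x t := by
  obtain ⟨d, rfl⟩ := Nat.exists_eq_add_of_le hu
  exact cfg_add_of_halted h d

lemma not_outputsAt_of_halted {k : ℕ} {M : RAM} {x : List ℕ} {t : ℕ}
    (h : M.Halted (M.cfg x t)) : ¬ M.OutputsAt k x t := by
  rcases h with h | h <;> simp [OutputsAt, emit, h]

lemma le_foldr_max (l : List ℕ) (h : ℕ) : h ≤ l.foldr max h := by
  induction l with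
  | nil => simp
  | cons a l ih => simp [ih]

lemma le_foldr_max_of_mem {l : List ℕ} {h a : ℕ} (ha : a ∈ l) : a ≤ l.foldr max h := by
  induction l with
  | nil => simp at ha
  | cons b l ih =>
    rcases List.mem_cons.1 ha with rfl | ha
    · simp
    · simp [ih ha]

lemma foldr_max_le {l : List ℕ} {h H : ℕ} (hh : h ≤ H) (hl : ∀ a ∈ l, a ≤ H) :
    l.foldr max h ≤ H := by
  induction l with
  | nil => simpa
  | cons b l ih =>
    simp only [List.foldr_cons, sup_le_iff]
    exact ⟨hl b (by simp), ih fun a ha => hl a (by simp [ha])⟩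

lemma hi_le_step (M : RAM) (x : List ℕ) (c : Config) : c.hi ≤ (M.step x c).hi := by
  unfold step
  cases M.prog[c.pc]? with
  | none => simp
  | some i => simpa using le_foldr_max _ _

lemma hi_mono (M : RAM) (x : List ℕ) {t u : ℕ} (h : t ≤ u) :
    (M.cfg x t).hi ≤ (M.cfg x u).hi := by
  induction u, h using Nat.le_induction with
  | base => rfl
  | succ u _ ih => rw [cfg_succ]; exact ih.trans (hi_le_step _ _ _)

end RAM

/-! ### Loop-free code: compilation and weakest preconditions -/

/-- Instructions that neither jump nor quit nor write output. -/
def Instr.Plain : Instr → Prop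
  | .jmp _ | .jlt _ _ _ | .output _ _ | .halt => False
  | _ => True

/-- Loop-free programs, to be repeated until the machine stops: after a sequence of plain
instructions and branchings, possibly write an output, and then quit or start again. -/
inductive Code where
  | leaf (o : Option (ℕ × ℕ)) (quit : Bool)
  | seq (i : Instr) (c : Code)
  | br (a b : ℕ) (c d : Code)

namespace Code

def ending (quit : Bool) : Instr := if quit then .halt else .jmp 0

/-- The program for a piece of code that is placed at `off`. -/
def compile : ℕ → Code → List Instr
  | _, leaf none st => [ending st]
  | _, leaf (some (a, b)) st => [.output a b, ending st]
  | off, seq i c => i :: compile (off + 1) c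
  | off, br a b c d =>
      .jlt a b (off + 1 + (compile (off + 1) d).length) ::
        (compile (off + 1) d ++ compile (off + 1 + (compile (off + 1) d).length) c)

/-- The largest number of instructions executed. -/
def depth : Code → ℕ
  | leaf _ _ => 2
  | seq _ c => c.depth + 1
  | br _ _ c d => max c.depth d.depth + 1

/-- If the code is executed in memory `R`, then it accesses only registers up to `H`, and its final
memory, output and decision to quit satisfy `Q`. -/
def wp (H : ℕ) (x : List ℕ) : Code → (ℕ → ℕ) → ((ℕ → ℕ) → Option (ℕ × ℕ) → Bool → Prop) → Prop
  | leaf none st, R, Q => Q R none st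
  | leaf (some (a, b)) st, R, Q =>
      (∀ r ∈ (Instr.output a b).touched R, r ≤ H) ∧ Q R (some (a, b)) st
  | seq i c, R, Q => i.Plain ∧ (∀ r ∈ i.touched R, r ≤ H) ∧ wp H x c (i.newMem x R) Q
  | br a b c d, R, Q => a ≤ H ∧ b ≤ H ∧ if R a < R b then wp H x c R Q else wp H x d R Q

/-- The program `l` is a part of `prog` that starts at `off`. -/
def At (prog : List Instr) (off : ℕ) (l : List Instr) : Prop :=
  ∀ i v, l[i]? = some v → prog[off + i]? = some v

lemma At.head {prog l : List Instr} {off : ℕ} {i : Instr} (h : At prog off (i :: l)) :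
    prog[off]? = some i := h 0 i rfl

lemma At.tail {prog l : List Instr} {off : ℕ} {i : Instr} (h : At prog off (i :: l)) :
    At prog (off + 1) l := fun j v hj => by
  have := h (j + 1) v (by simpa using hj)
  rwa [add_assoc, add_comm 1 j]

lemma At.left {prog l l' : List Instr} {off : ℕ} (h : At prog off (l ++ l')) :
    At prog off l := fun j v hj => by
  refine h j v ?_
  rw [List.getElem?_append_left (List.getElem?_eq_some_iff.1 hj).1]
  exact hj

lemma At.right {prog l l' : List Instr} {off : ℕ} (h : At prog off (l ++ l')) :
    At prog (off + l.length) l' := fun j v hj => by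
  rw [add_assoc]
  exact h (l.length + j) v (by rw [List.getElem?_append_right (by omega)]; simpa using hj)

/-- The word that is written by `output a b`. -/
def word (k : ℕ) (R : ℕ → ℕ) (a b : ℕ) : List ℕ :=
  (List.range' (R a) (R b + 1 - R a)).flatMap fun r => baseRepr k (R r)

/-- The machine runs `m` steps from step `t` on, and writes at most one output, at the end. -/
def Emits (k : ℕ) (M : RAM) (x : List ℕ) (t m : ℕ) (o : Option (List ℕ)) (quit : Bool) : Prop :=
  match o with
  | none => ∀ u < m, M.emit k x (t + u) = none
  | some w => ∃ e < m, M.emit k x (t + e) = some w ∧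
      (∀ u < m, u ≠ e → M.emit k x (t + u) = none) ∧ (quit = true → e + 1 = m)

lemma Emits.cons {k : ℕ} {M : RAM} {x : List ℕ} {t m : ℕ} {o : Option (List ℕ)} {quit : Bool}
    (h : Emits k M x (t + 1) m o quit) (h0 : M.emit k x t = none) :
    Emits k M x t (m + 1) o quit := by
  cases o with
  | none =>
    intro u hu
    cases u with
    | zero => exact h0
    | succ u => rw [add_comm u, ← add_assoc]; exact h u (by omega)
  | some w =>
    obtain ⟨e, he, h1, h2, h3⟩ := h
    refine ⟨e + 1, by omega, by rw [add_comm e, ← add_assoc]; exact h1, fun u hu hne => ?_,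
      fun hs => by rw [h3 hs]⟩
    cases u with
    | zero => exact h0
    | succ u => rw [add_comm u, ← add_assoc]; exact h2 u (by omega) (by omega)

/-- Execution of compiled code. -/
theorem sound {H k : ℕ} {M : RAM} {x : List ℕ} {Q : (ℕ → ℕ) → Option (ℕ × ℕ) → Bool → Prop}
    (c : Code) : ∀ (off t : ℕ) (R : ℕ → ℕ), At M.prog off (compile off c) →
    (M.cfg x t).pc = off → (M.cfg x t).mem = R → (M.cfg x t).hi ≤ H → wp H x c R Q →
    ∃ m R' o st, m ≤ c.depth ∧ Q R' o st ∧ (M.cfg x (t + m)).mem = R' ∧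
      (M.cfg x (t + m)).hi ≤ H ∧
      (st = true → M.Halted (M.cfg x (t + m))) ∧ (st = false → 1 ≤ m ∧ (M.cfg x (t + m)).pc = 0) ∧
      Emits k M x t m (o.map fun ab => word k R' ab.1 ab.2) st := by
  have hjmp : ∀ (t : ℕ), M.prog[(M.cfg x t).pc]? = some (ending false) →
      (M.cfg x (t + 1)).pc = 0 ∧ (M.cfg x (t + 1)).mem = (M.cfg x t).mem ∧
      (M.cfg x (t + 1)).hi = (M.cfg x t).hi ∧ M.emit k x t = none := by
    intro t h
    rw [RAM.cfg_succ, RAM.step_of_some h]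
    simp [ending, Instr.newPc, Instr.newMem, Instr.touched, RAM.emit] at h ⊢
    simp [h]
  induction c with
  | leaf o st =>
    intro off t R hat hpc hmem hhi hwp
    cases o with
    | none =>
      have h0 := At.head hat
      rw [← hpc] at h0
      cases st with
      | true => exact ⟨0, R, none, true, by simp, hwp, hmem, hhi, fun _ => Or.inr h0, by simp,
          fun u hu => absurd hu (Nat.not_lt_zero u)⟩
      | false =>
        obtain ⟨h1, h2, h3, h4⟩ := hjmp t h0
        refine ⟨1, R, none, false, by simp [depth], hwp, h2.trans hmem, h3.trans_le hhi, by simp,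
          fun _ => ⟨le_rfl, h1⟩, fun u hu => ?_⟩
        have : u = 0 := by omega
        subst this
        exact h4
    | some ab =>
      obtain ⟨a, b⟩ := ab
      have h0 := At.head hat
      have h1 := At.head (At.tail hat)
      rw [← hpc] at h0 h1
      have hs : M.cfg x (t + 1) = ⟨(M.cfg x t).pc + 1, R,
          ((Instr.output a b).touched R).foldr max (M.cfg x t).hi⟩ := by
        rw [RAM.cfg_succ, RAM.step_of_some h0]
        simp [Instr.newPc, Instr.newMem, hmem]
      have hhi1 : (M.cfg x (t + 1)).hi ≤ H := by
        rw [hs]; exact RAM.foldr_max_le hhi hwp.1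
      have hem : M.emit k x t = some (word k R a b) := by
        simp [RAM.emit, h0, hmem, word]
      have hpc1 : (M.cfg x (t + 1)).pc = (M.cfg x t).pc + 1 := by rw [hs]
      have hmem1 : (M.cfg x (t + 1)).mem = R := by rw [hs]
      rw [← hpc1] at h1
      cases st with
      | true =>
        refine ⟨1, R, some (a, b), true, by simp [depth], hwp.2, hmem1, hhi1, fun _ => Or.inr h1,
          by simp, 0, by simp, hem, fun u hu hne => absurd hu (by omega), fun _ => rfl⟩
      | false =>
        obtain ⟨h5, h2, h3, h4⟩ := hjmp (t + 1) h1
        refine ⟨2, R, some (a, b), false, by simp [depth], hwp.2, h2.trans hmem1,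
          h3.trans_le hhi1, by simp, fun _ => ⟨by simp, h5⟩, 0, by simp, hem, fun u hu hne => ?_,
          by simp⟩
        have : u = 1 := by omega
        subst this
        exact h4
  | seq i c ih =>
    intro off t R hat hpc hmem hhi ⟨hp, htouch, hwp⟩
    have h0 := At.head hat
    rw [← hpc] at h0
    have hs : M.cfg x (t + 1) = ⟨i.newPc (M.cfg x t).pc R, i.newMem x R,
        (i.touched R).foldr max (M.cfg x t).hi⟩ := by
      rw [RAM.cfg_succ, RAM.step_of_some h0, hmem]
    have hpc1 : i.newPc (M.cfg x t).pc R = off + 1 := by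
      rw [hpc]; cases i <;> first | rfl | exact absurd hp id
    have hem : M.emit k x t = none := by
      simp only [RAM.emit, h0]; cases i <;> first | rfl | exact absurd hp id
    obtain ⟨m, R', o, st, h1, h2, h3, h4, h5, h6, h7⟩ := ih (off + 1) (t + 1) _ (At.tail hat)
      (by rw [hs]; exact hpc1) (by rw [hs]) (by rw [hs]; exact RAM.foldr_max_le hhi htouch) hwp
    rw [add_assoc, add_comm 1 m] at h3 h4 h5 h6
    exact ⟨m + 1, R', o, st, by simpa [depth] using h1, h2, h3, h4, h5,
      fun hst => ⟨by omega, (h6 hst).2⟩, h7.cons hem⟩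
  | br a b c d ihc ihd =>
    intro off t R hat hpc hmem hhi ⟨ha, hb, hwp⟩
    have h0 := At.head hat
    rw [← hpc] at h0
    have hs := RAM.cfg_succ M x t
    rw [RAM.step_of_some h0, hmem, hpc] at hs
    have hem : M.emit k x t = none := by simp [RAM.emit, h0]
    have hhi1 : (M.cfg x (t + 1)).hi ≤ H := by
      rw [hs]; exact RAM.foldr_max_le hhi (by simp [Instr.touched, ha, hb])
    split_ifs at hwp with hlt
    · obtain ⟨m, R', o, st, h1, h2, h3, h4, h5, h6, h7⟩ := ihc _ (t + 1) R (At.right (At.tail hat))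
        (by rw [hs]; simp [Instr.newPc, hlt]) (by rw [hs]; rfl) hhi1 hwp
      rw [add_assoc, add_comm 1 m] at h3 h4 h5 h6
      exact ⟨m + 1, R', o, st, by simp [depth, h1], h2, h3, h4, h5,
        fun hst => ⟨by omega, (h6 hst).2⟩, h7.cons hem⟩
    · obtain ⟨m, R', o, st, h1, h2, h3, h4, h5, h6, h7⟩ := ihd _ (t + 1) R (At.left (At.tail hat))
        (by rw [hs]; simp [Instr.newPc, hlt]) (by rw [hs]; rfl) hhi1 hwp
      rw [add_assoc, add_comm 1 m] at h3 h4 h5 h6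
      exact ⟨m + 1, R', o, st, by simp [depth, h1], h2, h3, h4, h5,
        fun hst => ⟨by omega, (h6 hst).2⟩, h7.cons hem⟩

end Code

/-! ### Control registers and simulation of single instructions -/

/-- A memory with control registers `C 0, …, C 23` and the array `h` behind them. -/
def glue (C h : ℕ → ℕ) : ℕ → ℕ := fun r => if r < 24 then C r else h (r - 24)

lemma glue_low {C h : ℕ → ℕ} {r : ℕ} (hr : r < 24) : glue C h r = C r := if_pos hr

lemma glue_high {C h : ℕ → ℕ} {r : ℕ} : glue C h (24 + r) = h r := by simp [glue]

lemma glue_update_low {C h : ℕ → ℕ} {d v : ℕ} (hd : d < 24) :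
    Function.update (glue C h) d v = glue (Function.update C d v) h := by
  funext r
  rcases eq_or_ne r d with rfl | hr
  · simp [glue, hd]
  · simp [glue, Function.update_of_ne hr]

lemma glue_update_high {C h : ℕ → ℕ} {o v : ℕ} :
    Function.update (glue C h) (24 + o) v = glue C (Function.update h o v) := by
  funext r
  rcases eq_or_ne r (24 + o) with rfl | hr
  · simp [glue]
  · rw [Function.update_of_ne hr]
    simp only [glue]
    split_ifs with h1
    · rfl
    · rw [Function.update_of_ne (by omega)]

namespace Code

variable {H : ℕ} {x : List ℕ} {Q : (ℕ → ℕ) → Option (ℕ × ℕ) → Bool → Prop} {C h : ℕ → ℕ}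
  {c c' : Code} {a b d : ℕ}

lemma wp_const {v : ℕ} (hH : 24 ≤ H) (hd : d < 24)
    (hw : wp H x c (glue (Function.update C d v) h) Q) : wp H x (seq (.const d v) c) (glue C h) Q :=
  ⟨trivial, by simp [Instr.touched]; omega, by simpa [Instr.newMem, glue_update_low hd] using hw⟩

lemma wp_len (hH : 24 ≤ H) (hd : d < 24)
    (hw : wp H x c (glue (Function.update C d x.length) h) Q) :
    wp H x (seq (.len d) c) (glue C h) Q :=
  ⟨trivial, by simp [Instr.touched]; omega, by simpa [Instr.newMem, glue_update_low hd] using hw⟩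

lemma wp_read (hH : 24 ≤ H) (hd : d < 24) (ha : a < 24)
    (hw : wp H x c (glue (Function.update C d (x.getD (C a) 0)) h) Q) :
    wp H x (seq (.read d a) c) (glue C h) Q :=
  ⟨trivial, by simp [Instr.touched]; omega, by
    simpa only [Instr.newMem, glue_update_low hd, glue_low ha] using hw⟩

lemma wp_add (hH : 24 ≤ H) (hd : d < 24) (ha : a < 24) (hb : b < 24)
    (hw : wp H x c (glue (Function.update C d (C a + C b)) h) Q) :
    wp H x (seq (.add d a b) c) (glue C h) Q :=
  ⟨trivial, by simp [Instr.touched]; omega, by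
    simpa only [Instr.newMem, glue_update_low hd, glue_low ha, glue_low hb] using hw⟩

lemma wp_sub (hH : 24 ≤ H) (hd : d < 24) (ha : a < 24) (hb : b < 24)
    (hw : wp H x c (glue (Function.update C d (C a - C b)) h) Q) :
    wp H x (seq (.sub d a b) c) (glue C h) Q :=
  ⟨trivial, by simp [Instr.touched]; omega, by
    simpa only [Instr.newMem, glue_update_low hd, glue_low ha, glue_low hb] using hw⟩

lemma wp_mul (hH : 24 ≤ H) (hd : d < 24) (ha : a < 24) (hb : b < 24)
    (hw : wp H x c (glue (Function.update C d (C a * C b)) h) Q) :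
    wp H x (seq (.mul d a b) c) (glue C h) Q :=
  ⟨trivial, by simp [Instr.touched]; omega, by
    simpa only [Instr.newMem, glue_update_low hd, glue_low ha, glue_low hb] using hw⟩

lemma wp_load {o : ℕ} (hH : 24 ≤ H) (hd : d < 24) (ha : a < 24) (ho : C a = 24 + o)
    (hoH : 24 + o ≤ H) (hw : wp H x c (glue (Function.update C d (h o)) h) Q) :
    wp H x (seq (.load d a) c) (glue C h) Q :=
  ⟨trivial, by simp [Instr.touched, glue_low ha, ho]; omega, by
    simpa only [Instr.newMem, glue_update_low hd, glue_low ha, ho, glue_high] using hw⟩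

lemma wp_store {o : ℕ} (hH : 24 ≤ H) (ha : a < 24) (hb : b < 24) (ho : C a = 24 + o)
    (hoH : 24 + o ≤ H) (hw : wp H x c (glue C (Function.update h o (C b))) Q) :
    wp H x (seq (.store a b) c) (glue C h) Q :=
  ⟨trivial, by simp [Instr.touched, glue_low ha, ho]; omega, by
    simpa only [Instr.newMem, glue_low ha, glue_low hb, ho, glue_update_high] using hw⟩

lemma wp_br (hH : 24 ≤ H) (ha : a < 24) (hb : b < 24)
    (h1 : C a < C b → wp H x c (glue C h) Q) (h2 : ¬ C a < C b → wp H x c' (glue C h) Q) :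
    wp H x (br a b c c') (glue C h) Q := by
  refine ⟨by omega, by omega, ?_⟩
  rw [glue_low ha, glue_low hb]
  split_ifs with hlt
  · exact h1 hlt
  · exact h2 hlt

/-- Set the registers `0, …, n - 1` to zero. -/
def clearRegs : ℕ → Code → Code
  | 0, c => c
  | n + 1, c => seq (.const n 0) (clearRegs n c)

lemma wp_clearRegs (hH : 24 ≤ H) (n : ℕ) (hn : n ≤ 24) : ∀ {C : ℕ → ℕ},
    wp H x c (glue (fun r => if r < n then 0 else C r) h) Q →
    wp H x (clearRegs n c) (glue C h) Q := by
  induction n with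
  | zero => intro C hw; simpa [clearRegs] using hw
  | succ n ih =>
    intro C hw
    refine wp_const hH (by omega) (ih (by omega) ?_)
    convert hw using 3 with r
    rcases lt_trichotomy r n with hr | rfl | hr
    · simp [hr, Nat.lt_succ_of_lt hr]
    · simp
    · rw [if_neg (by omega), if_neg (by omega), Function.update_of_ne (by omega)]

/-! The registers of the amortized enumerator: `0`, `1`, `2` for intermediate results; in register
`3` the program counter of the simulated machine, `4` the address of its block, `5` the address of
its memory, `6` the phase, `7` the position of the carry, `8` the digit at this position and `10`
its address, `9` the leading digit; `11`, `12`, `13` hold `1`, `2` and `0`. The registers up to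
`13` are cleared after each unit of work. Register `14` holds the stage (`0` and `1` for the
computation of the bounds, `2` for the enumeration), `15` the space bound, `16` the fuel for one
turn, `17` the remaining fuel, `18` the copy in turn, `19` the last copy, `20` the offset of
the first block, `21` the length of a block, and `22`, `23` the ends of an output. -/

/-- Clearing precedes the output, so every pass ends in a memory without leftover intermediate
results; only registers 22 and 23, which delimit the output, must survive. -/
def finish (o : Option (ℕ × ℕ)) (quit : Bool) : Code := clearRegs 14 (leaf o quit)

/-- `R d := ` simulated register `a`. -/
def fetch (d a : ℕ) (c : Code) : Code :=
  seq (.const 0 a) (seq (.add 0 5 0) (seq (.load d 0) c))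

/-- simulated register `d` `:= R 1`. -/
def put (d : ℕ) (c : Code) : Code :=
  seq (.const 0 d) (seq (.add 0 5 0) (seq (.store 0 1) c))

def incPc (c : Code) : Code := seq (.add 3 3 11) c

/-- Simulation of one instruction. -/
def sim (fin hlt : Code) (out : ℕ → ℕ → Code) : Instr → Code
  | .const d v => seq (.const 1 v) (put d (incPc fin))
  | .len d => seq (.len 1) (put d (incPc fin))
  | .read d a => fetch 1 a (seq (.read 1 1) (put d (incPc fin)))
  | .add d a b => fetch 1 a (fetch 2 b (seq (.add 1 1 2) (put d (incPc fin))))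
  | .sub d a b => fetch 1 a (fetch 2 b (seq (.sub 1 1 2) (put d (incPc fin))))
  | .mul d a b => fetch 1 a (fetch 2 b (seq (.mul 1 1 2) (put d (incPc fin))))
  | .load d a => fetch 1 a (seq (.add 1 5 1) (seq (.load 1 1) (put d (incPc fin))))
  | .store a b => fetch 1 a (fetch 2 b (seq (.add 1 5 1) (seq (.store 1 2) (incPc fin))))
  | .jmp l => seq (.const 3 l) fin
  | .jlt a b l => fetch 1 a (fetch 2 b (br 1 2 (seq (.const 3 l) fin) (incPc fin)))
  | .output a b => out a b
  | .halt => hlt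

/-- Selection of the instruction to be simulated. -/
def dispatch (f : Instr → Code) (e : Code) : List Instr → ℕ → Code
  | [], _ => e
  | i :: l, q => seq (.const 0 (q + 1)) (br 3 0 (f i) (dispatch f e l (q + 1)))

/-- The chain of comparisons leaves in register 0 a value that depends on the place where it stops,
hence the quantifier over `v`. -/
lemma wp_dispatch (hH : 24 ≤ H) (f : Instr → Code) (e : Code) (l : List Instr) : ∀ (q : ℕ)
    {C : ℕ → ℕ}, q ≤ C 3 →
    (∀ v, wp H x (match l[C 3 - q]? with | some i => f i | none => e)
      (glue (Function.update C 0 v) h) Q) → wp H x (dispatch f e l q) (glue C h) Q := by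
  induction l with
  | nil => intro q C _ hw; simpa [dispatch] using hw (C 0)
  | cons i l ih =>
    intro q C hq hw
    refine wp_const hH (by norm_num) (wp_br hH (by norm_num) (by norm_num) (fun hlt => ?_)
      fun hlt => ?_)
    · simp at hlt
      have hq0 : C 3 - q = 0 := by omega
      rw [hq0] at hw
      simpa using hw (q + 1)
    · simp at hlt
      refine ih (q + 1) (by simpa using hlt) fun v => ?_
      have hq0 : C 3 - q = (C 3 - (q + 1)) + 1 := by omega
      rw [hq0] at hw
      simpa using hw v

/-- The register that an instruction changes, and its new value. -/
def target (x : List ℕ) (R : ℕ → ℕ) : Instr → Option (ℕ × ℕ)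
  | .const d c => some (d, c)
  | .len d => some (d, x.length)
  | .read d a => some (d, x.getD (R a) 0)
  | .add d a b => some (d, R a + R b)
  | .sub d a b => some (d, R a - R b)
  | .mul d a b => some (d, R a * R b)
  | .load d a => some (d, R (R a))
  | .store a b => some (R a, R b)
  | _ => none

/-- Write to the simulated memory at `β`. -/
def write (β : ℕ) (h : ℕ → ℕ) : Option (ℕ × ℕ) → (ℕ → ℕ)
  | none => h
  | some (d, v) => Function.update h (β + d) v

lemma newMem_eq (x : List ℕ) (R : ℕ → ℕ) (i : Instr) :
    i.newMem x R = match target x R i with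
      | none => R
      | some (d, v) => Function.update R d v := by
  cases i <;> rfl

section Sim
variable {β S : ℕ} {m : ℕ → ℕ}

lemma wp_fetch (hH : 24 ≤ H) (hd : d < 24) (hC5 : C 5 = 24 + β)
    (hm : h (β + a) = m a) (haH : 24 + (β + a) ≤ H)
    (hw : ∀ v, wp H x c (glue (Function.update (Function.update C 0 v) d (m a)) h) Q) :
    wp H x (fetch d a c) (glue C h) Q := by
  refine wp_const hH (by norm_num) (wp_add hH (by norm_num) (by norm_num) (by norm_num)
    (wp_load (o := β + a) hH hd (by norm_num) ?_ haH ?_))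
  · simp [hC5, add_assoc]
  · simpa [hm] using hw _

lemma wp_put (hH : 24 ≤ H) (hC5 : C 5 = 24 + β) (haH : 24 + (β + d) ≤ H)
    (hw : ∀ v, wp H x c (glue (Function.update C 0 v) (Function.update h (β + d) (C 1))) Q) :
    wp H x (put d c) (glue C h) Q := by
  refine wp_const hH (by norm_num) (wp_add hH (by norm_num) (by norm_num) (by norm_num)
    (wp_store (o := β + d) hH (by norm_num) (by norm_num) ?_ haH ?_))
  · simp [hC5, add_assoc]
  · simpa using hw _

/-- Correctness of the simulation of one instruction. -/
lemma wp_sim {fin hlt : Code} {out : ℕ → ℕ → Code} (hH : 24 ≤ H) (hC5 : C 5 = 24 + β)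
    (hC11 : C 11 = 1) (hm : ∀ a < S, h (β + a) = m a) (hβH : 24 + (β + S) ≤ H) {i : Instr}
    (hi : ∀ r ∈ i.touched m, r < S) (hhalt : i ≠ .halt) (hout : ∀ a b, i ≠ .output a b)
    (hw : ∀ C', (∀ r, 4 ≤ r → C' r = C r) → C' 3 = i.newPc (C 3) m →
      wp H x fin (glue C' (write β h (target x m i))) Q) :
    wp H x (sim fin hlt out i) (glue C h) Q := by
  have n24 : ∀ {r : ℕ}, r < S → 24 + (β + r) ≤ H := fun hr => by omega
  -- The common end of the instructions whose target register is a constant of the program: the new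
  -- value is in register 1 and has to be stored.
  have hput : ∀ {C' : ℕ → ℕ} {d v : ℕ}, d < S → C' 1 = v → (∀ r, 3 ≤ r → C' r = C r) →
      target x m i = some (d, v) → i.newPc (C 3) m = C 3 + 1 →
      wp H x (put d (incPc fin)) (glue C' h) Q := by
    intro C' d v hd h1 hC' ht hpc
    refine wp_put hH (by rw [hC' 5 (by norm_num), hC5]) (n24 hd) fun w => ?_
    refine wp_add hH (by norm_num) (by norm_num) (by norm_num) ?_
    rw [ht] at hw
    simp only [write] at hw
    rw [h1]
    refine hw _ (fun r hr => ?_) ?_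
    · rw [Function.update_of_ne (by omega), Function.update_of_ne (by omega), hC' r (by omega)]
    · simp [hpc, hC', hC11]
  cases i with
  | const d v =>
    simp only [Instr.touched, List.forall_mem_cons] at hi
    refine wp_const hH (by norm_num) (hput hi.1 (by simp) (fun r hr => ?_) rfl rfl)
    rw [Function.update_of_ne (by omega)]
  | len d =>
    simp only [Instr.touched, List.forall_mem_cons] at hi
    refine wp_len hH (by norm_num) (hput hi.1 (by simp) (fun r hr => ?_) rfl rfl)
    rw [Function.update_of_ne (by omega)]
  | read d a =>
    simp only [Instr.touched, List.forall_mem_cons] at hi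
    refine wp_fetch hH (by norm_num) hC5 (hm a hi.2.1) (n24 hi.2.1) fun v => ?_
    refine wp_read hH (by norm_num) (by norm_num) (hput hi.1 (by simp) (fun r hr => ?_) rfl rfl)
    simp [Function.update_of_ne (show r ≠ 0 by omega), Function.update_of_ne (show r ≠ 1 by omega)]
  | add d a b =>
    simp only [Instr.touched, List.forall_mem_cons] at hi
    refine wp_fetch hH (by norm_num) hC5 (hm a hi.2.1) (n24 hi.2.1) fun v => ?_
    refine wp_fetch hH (by norm_num) (by simpa using hC5) (hm b hi.2.2.1) (n24 hi.2.2.1) fun w => ?_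
    refine wp_add hH (by norm_num) (by norm_num) (by norm_num)
      (hput hi.1 (by simp) (fun r hr => ?_) rfl rfl)
    simp [Function.update_of_ne (show r ≠ 0 by omega), Function.update_of_ne (show r ≠ 1 by omega),
      Function.update_of_ne (show r ≠ 2 by omega)]
  | sub d a b =>
    simp only [Instr.touched, List.forall_mem_cons] at hi
    refine wp_fetch hH (by norm_num) hC5 (hm a hi.2.1) (n24 hi.2.1) fun v => ?_
    refine wp_fetch hH (by norm_num) (by simpa using hC5) (hm b hi.2.2.1) (n24 hi.2.2.1) fun w => ?_
    refine wp_sub hH (by norm_num) (by norm_num) (by norm_num)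
      (hput hi.1 (by simp) (fun r hr => ?_) rfl rfl)
    simp [Function.update_of_ne (show r ≠ 0 by omega), Function.update_of_ne (show r ≠ 1 by omega),
      Function.update_of_ne (show r ≠ 2 by omega)]
  | mul d a b =>
    simp only [Instr.touched, List.forall_mem_cons] at hi
    refine wp_fetch hH (by norm_num) hC5 (hm a hi.2.1) (n24 hi.2.1) fun v => ?_
    refine wp_fetch hH (by norm_num) (by simpa using hC5) (hm b hi.2.2.1) (n24 hi.2.2.1) fun w => ?_
    refine wp_mul hH (by norm_num) (by norm_num) (by norm_num)
      (hput hi.1 (by simp) (fun r hr => ?_) rfl rfl)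
    simp [Function.update_of_ne (show r ≠ 0 by omega), Function.update_of_ne (show r ≠ 1 by omega),
      Function.update_of_ne (show r ≠ 2 by omega)]
  | load d a =>
    simp only [Instr.touched, List.forall_mem_cons] at hi
    refine wp_fetch hH (by norm_num) hC5 (hm a hi.2.1) (n24 hi.2.1) fun v => ?_
    refine wp_add hH (by norm_num) (by norm_num) (by norm_num) ?_
    refine wp_load (o := β + m a) hH (by norm_num) (by norm_num) (by simp [hC5, add_assoc])
      (n24 hi.2.2.1) ?_
    refine hput hi.1 (by simp [hm _ hi.2.2.1]) (fun r hr => ?_) rfl rfl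
    simp [Function.update_of_ne (show r ≠ 0 by omega), Function.update_of_ne (show r ≠ 1 by omega)]
  | store a b =>
    simp only [Instr.touched, List.forall_mem_cons] at hi
    refine wp_fetch hH (by norm_num) hC5 (hm a hi.1) (n24 hi.1) fun v => ?_
    refine wp_fetch hH (by norm_num) (by simpa using hC5) (hm b hi.2.1) (n24 hi.2.1) fun w => ?_
    refine wp_add hH (by norm_num) (by norm_num) (by norm_num) ?_
    refine wp_store (o := β + m a) hH (by norm_num) (by norm_num) (by simp [hC5, add_assoc])
      (n24 hi.2.2.1) ?_
    refine wp_add hH (by norm_num) (by norm_num) (by norm_num) ?_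
    simp only [target, write] at hw
    convert hw _ (fun r hr => ?_) ?_ using 3
    · simp
    · simp [Function.update_of_ne (show r ≠ 0 by omega), Function.update_of_ne (show r ≠ 1 by omega),
        Function.update_of_ne (show r ≠ 2 by omega), Function.update_of_ne (show r ≠ 3 by omega)]
    · simp [hC11, Instr.newPc]
  | jmp l =>
    refine wp_const hH (by norm_num) (hw _ (fun r hr => ?_) (by simp [Instr.newPc]))
    rw [Function.update_of_ne (by omega)]
  | jlt a b l =>
    simp only [Instr.touched, List.forall_mem_cons] at hi
    refine wp_fetch hH (by norm_num) hC5 (hm a hi.1) (n24 hi.1) fun v => ?_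
    refine wp_fetch hH (by norm_num) (by simpa using hC5) (hm b hi.2.1) (n24 hi.2.1) fun w => ?_
    refine wp_br hH (by norm_num) (by norm_num) (fun hlt => ?_) fun hlt => ?_
    · simp at hlt
      refine wp_const hH (by norm_num) (hw _ (fun r hr => ?_) (by simp [Instr.newPc, hlt]))
      simp [Function.update_of_ne (show r ≠ 0 by omega), Function.update_of_ne (show r ≠ 1 by omega),
        Function.update_of_ne (show r ≠ 2 by omega), Function.update_of_ne (show r ≠ 3 by omega)]
    · have hlt' : ¬ m a < m b := by simpa using hlt
      refine wp_add hH (by norm_num) (by norm_num) (by norm_num)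
        (hw _ (fun r hr => ?_) (by simp [Instr.newPc, hlt', hC11]))
      simp [Function.update_of_ne (show r ≠ 0 by omega), Function.update_of_ne (show r ≠ 1 by omega),
        Function.update_of_ne (show r ≠ 2 by omega), Function.update_of_ne (show r ≠ 3 by omega)]
  | output a b => exact absurd rfl (hout a b)
  | halt => exact absurd rfl hhalt

end Sim
end Code

/-! ### Blocks of simulated machines in memory -/

namespace Code

/-- The contents of the block of a simulated machine `M` after `t` steps: program counter, phase,
position of the carry, `S` registers, and the digits of the counter. -/
def cell (M : RAM) (x : List ℕ) (S t ph q : ℕ) (bits : ℕ → ℕ) (o : ℕ) : ℕ :=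
  if o = 0 then (M.cfg x t).pc else if o = 1 then ph else if o = 2 then q
  else if o < 3 + S then (M.cfg x t).mem (o - 3) else bits (o - (3 + S))

section Cell
variable {M : RAM} {x : List ℕ} {S t ph q : ℕ} {bits : ℕ → ℕ}

@[simp] lemma cell_zero : cell M x S t ph q bits 0 = (M.cfg x t).pc := rfl
@[simp] lemma cell_one : cell M x S t ph q bits 1 = ph := rfl
@[simp] lemma cell_two : cell M x S t ph q bits 2 = q := rfl

lemma cell_mem {a : ℕ} (ha : a < S) : cell M x S t ph q bits (3 + a) = (M.cfg x t).mem a := by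
  rw [cell, if_neg (by omega), if_neg (by omega), if_neg (by omega), if_pos (by omega),
    Nat.add_sub_cancel_left]

lemma cell_bits (i : ℕ) : cell M x S t ph q bits (3 + S + i) = bits i := by
  rw [cell, if_neg (by omega), if_neg (by omega), if_neg (by omega), if_neg (by omega),
    Nat.add_sub_cancel_left]

lemma cell_ext {c : ℕ → ℕ} (h0 : c 0 = (M.cfg x t).pc) (h1 : c 1 = ph) (h2 : c 2 = q)
    (h3 : ∀ a < S, c (3 + a) = (M.cfg x t).mem a) (h4 : ∀ i, c (3 + S + i) = bits i) :
    c = cell M x S t ph q bits := by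
  funext o
  rcases lt_or_ge o 3 with h | h
  · interval_cases o
    · exact h0
    · exact h1
    · exact h2
  · obtain ⟨a, rfl⟩ := Nat.exists_eq_add_of_le h
    rcases lt_or_ge a S with ha | ha
    · rw [h3 a ha, cell_mem ha]
    · obtain ⟨i, rfl⟩ := Nat.exists_eq_add_of_le ha
      rw [← add_assoc, h4, cell_bits]

end Cell

/-- The arrangement of blocks in the memory: one of length `l₁`, one of length `l₂`, and then
blocks of length `L`. -/
def blocks (l₁ l₂ L : ℕ) (c₁ c₂ : ℕ → ℕ) (c₃ : ℕ → ℕ → ℕ) (r : ℕ) : ℕ :=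
  if r < l₁ then c₁ r else if r < l₁ + l₂ then c₂ (r - l₁)
  else c₃ ((r - (l₁ + l₂)) / L) ((r - (l₁ + l₂)) % L)

section Blocks
variable {l₁ l₂ L : ℕ} {c₁ c₂ : ℕ → ℕ} {c₃ : ℕ → ℕ → ℕ} {o v j : ℕ}

lemma blocks_fst (ho : o < l₁) : blocks l₁ l₂ L c₁ c₂ c₃ o = c₁ o := if_pos ho

lemma blocks_snd (ho : o < l₂) : blocks l₁ l₂ L c₁ c₂ c₃ (l₁ + o) = c₂ o := by
  rw [blocks, if_neg (by omega), if_pos (by omega), Nat.add_sub_cancel_left]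

lemma blocks_thd (ho : o < L) : blocks l₁ l₂ L c₁ c₂ c₃ (l₁ + l₂ + j * L + o) = c₃ j o := by
  rw [blocks, if_neg (by omega), if_neg (by omega), add_assoc, Nat.add_sub_cancel_left,
    add_comm (j * L), Nat.add_mul_div_right _ _ (by omega), Nat.add_mul_mod_self_right,
    Nat.div_eq_of_lt ho, Nat.mod_eq_of_lt ho, zero_add]

lemma blocks_update_fst (ho : o < l₁) : Function.update (blocks l₁ l₂ L c₁ c₂ c₃) o v =
    blocks l₁ l₂ L (Function.update c₁ o v) c₂ c₃ := by
  funext r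
  rcases eq_or_ne r o with rfl | hr
  · simp [blocks, ho]
  · rw [Function.update_of_ne hr, blocks, blocks, Function.update_of_ne hr]

lemma blocks_update_snd (ho : o < l₂) : Function.update (blocks l₁ l₂ L c₁ c₂ c₃) (l₁ + o) v =
    blocks l₁ l₂ L c₁ (Function.update c₂ o v) c₃ := by
  funext r
  rcases eq_or_ne r (l₁ + o) with rfl | hr
  · simp [blocks, ho]
  · rw [Function.update_of_ne hr, blocks, blocks]
    split_ifs with h1 h2
    · rfl
    · rw [Function.update_of_ne (by omega)]
    · rfl

lemma blocks_update_thd (ho : o < L) :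
    Function.update (blocks l₁ l₂ L c₁ c₂ c₃) (l₁ + l₂ + j * L + o) v =
    blocks l₁ l₂ L c₁ c₂ (Function.update c₃ j (Function.update (c₃ j) o v)) := by
  funext r
  rcases eq_or_ne r (l₁ + l₂ + j * L + o) with rfl | hr
  · rw [blocks_thd ho]; simp
  · rw [Function.update_of_ne hr, blocks, blocks]
    split_ifs with h1 h2
    · rfl
    · rfl
    · rcases eq_or_ne ((r - (l₁ + l₂)) / L) j with hj | hj
      · rw [hj, Function.update_self, Function.update_of_ne]
        rintro hm
        have := Nat.div_add_mod (r - (l₁ + l₂)) L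
        rw [hj, hm, mul_comm] at this
        omega
      · rw [Function.update_of_ne hj]

variable {w : Option (ℕ × ℕ)}

lemma write_blocks_fst (hw : ∀ d v, w = some (d, v) → 3 + d < l₁) :
    write 3 (blocks l₁ l₂ L c₁ c₂ c₃) w = blocks l₁ l₂ L (write 3 c₁ w) c₂ c₃ := by
  cases w with
  | none => rfl
  | some dv => exact blocks_update_fst (hw _ _ rfl)

lemma write_blocks_snd (hw : ∀ d v, w = some (d, v) → 3 + d < l₂) :
    write (l₁ + 3) (blocks l₁ l₂ L c₁ c₂ c₃) w = blocks l₁ l₂ L c₁ (write 3 c₂ w) c₃ := by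
  cases w with
  | none => rfl
  | some dv =>
    simp only [write]
    rw [add_assoc]
    exact blocks_update_snd (hw _ _ rfl)

lemma write_blocks_thd (hw : ∀ d v, w = some (d, v) → 3 + d < L) :
    write (l₁ + l₂ + j * L + 3) (blocks l₁ l₂ L c₁ c₂ c₃) w =
      blocks l₁ l₂ L c₁ c₂ (Function.update c₃ j (write 3 (c₃ j) w)) := by
  cases w with
  | none => simp [write]
  | some dv =>
    simp only [write]
    rw [add_assoc]
    exact blocks_update_thd (hw _ _ rfl)

end Blocks

variable {H : ℕ} {x : List ℕ} {Q : (ℕ → ℕ) → Option (ℕ × ℕ) → Bool → Prop} {C h : ℕ → ℕ}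
  {c c' : Code} {a b d : ℕ}

/-- The control registers with the first ones cleared. -/
def cleared (C : ℕ → ℕ) (r : ℕ) : ℕ := if r < 14 then 0 else C r

lemma wp_finish_none (hH : 24 ≤ H) {quit : Bool} (hw : Q (glue (cleared C) h) none quit) :
    wp H x (finish none quit) (glue C h) Q :=
  wp_clearRegs hH 14 (by norm_num) hw

lemma wp_finish_some (hH : 24 ≤ H) {quit : Bool} (h23 : C 22 ≤ C 23 → C 23 ≤ H)
    (hw : Q (glue (cleared C) h) (some (22, 23)) quit) :
    wp H x (finish (some (22, 23)) quit) (glue C h) Q := by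
  refine wp_clearRegs hH 14 (by norm_num) ⟨?_, hw⟩
  simp only [Instr.touched]
  split_ifs with h
  · have := h23 (by simpa [glue] using h)
    simp [glue]; omega
  · simp; omega

/-- Computation of a bound: one step of the machine `M`, and the code `e` when it has stopped. -/
def bound (M : RAM) (e : Code) : Code :=
  dispatch (sim (seq (.store 4 3) (finish none false)) e
    fun _ _ => incPc (seq (.store 4 3) (finish none false))) e M.prog 0

lemma touched_le_hi {M : RAM} {t : ℕ} {i : Instr} (hi : M.prog[(M.cfg x t).pc]? = some i) {r : ℕ}
    (hr : r ∈ i.touched (M.cfg x t).mem) : r ≤ (M.cfg x (t + 1)).hi := by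
  rw [RAM.cfg_succ, RAM.step_of_some hi]
  exact RAM.le_foldr_max_of_mem hr

lemma target_mem_touched {R : ℕ → ℕ} {i : Instr} {d v : ℕ} (h : target x R i = some (d, v)) :
    d ∈ i.touched R := by
  cases i <;> simp_all [target, Instr.touched]

/-- The simulated memory after one step. -/
lemma write_cell_step {M : RAM} {S t ph q : ℕ} {bits : ℕ → ℕ} {i : Instr}
    (hi : M.prog[(M.cfg x t).pc]? = some i) (hS : ∀ r ∈ i.touched (M.cfg x t).mem, r < S) :
    Function.update (write 3 (cell M x S t ph q bits) (target x (M.cfg x t).mem i)) 0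
      (i.newPc (M.cfg x t).pc (M.cfg x t).mem) = cell M x S (t + 1) ph q bits := by
  have hs : M.cfg x (t + 1) = _ := (RAM.cfg_succ M x t).trans (RAM.step_of_some hi)
  have hw : ∀ o, o < 3 → write 3 (cell M x S t ph q bits) (target x (M.cfg x t).mem i) o =
      cell M x S t ph q bits o := by
    intro o ho
    cases ht : target x (M.cfg x t).mem i with
    | none => rfl
    | some dv => rw [write, Function.update_of_ne (by omega)]
  refine cell_ext ?_ ?_ ?_ (fun a ha => ?_) fun j => ?_
  · simp [hs]
  · rw [Function.update_of_ne (by norm_num), hw 1 (by norm_num), cell_one]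
  · rw [Function.update_of_ne (by norm_num), hw 2 (by norm_num), cell_two]
  · rw [Function.update_of_ne (by omega), hs, newMem_eq]
    cases ht : target x (M.cfg x t).mem i with
    | none => rw [write, cell_mem ha]
    | some dv =>
      obtain ⟨d, v⟩ := dv
      simp only [write]
      rcases eq_or_ne a d with rfl | hne
      · simp
      · rw [Function.update_of_ne (by omega), Function.update_of_ne hne, cell_mem ha]
  · rw [Function.update_of_ne (by omega)]
    cases ht : target x (M.cfg x t).mem i with
    | none => rw [write, cell_bits]
    | some dv =>
      obtain ⟨d, v⟩ := dv
      have := hS d (target_mem_touched ht)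
      rw [write, Function.update_of_ne (by omega), cell_bits]

/-- The block at `β` starts with three cells for program counter, phase and carry, so the simulated
registers begin at `β + 3`. Outputs of the auxiliary machine are skipped, as only its final register
0 matters. -/
lemma wp_bound {M : RAM} {e : Code} {S t β : ℕ} (hH : 24 ≤ H) (hβ : 24 + (β + (3 + S)) ≤ H)
    (hS : (M.cfg x (t + 1)).hi < S) (hC4 : C 4 = 24 + β) (hC5 : C 5 = 24 + (β + 3))
    (hC11 : C 11 = 1) (hC3 : C 3 = (M.cfg x t).pc)
    (hm : ∀ a < S, h (β + 3 + a) = (M.cfg x t).mem a)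
    (he : M.Halted (M.cfg x t) → ∀ v, wp H x e (glue (Function.update C 0 v) h) Q)
    (hw : ∀ i, M.prog[(M.cfg x t).pc]? = some i → i ≠ .halt → ∀ C', (∀ r, 14 ≤ r → C' r = C r) →
      (∀ r < 14, C' r = 0) → Q (glue C' (Function.update (write (β + 3) h
        (target x (M.cfg x t).mem i)) β (i.newPc (M.cfg x t).pc (M.cfg x t).mem))) none false) :
    wp H x (bound M e) (glue C h) Q := by
  have hfin : ∀ i, M.prog[(M.cfg x t).pc]? = some i → i ≠ .halt → ∀ C', (∀ r, 4 ≤ r → C' r = C r) →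
      C' 3 = i.newPc (C 3) (M.cfg x t).mem → wp H x (seq (.store 4 3) (finish none false))
        (glue C' (write (β + 3) h (target x (M.cfg x t).mem i))) Q := by
    intro i hi hne C' hC' h3
    refine wp_store (o := β) hH (by norm_num) (by norm_num) (by rw [hC' 4 le_rfl, hC4]) (by omega)
      (wp_finish_none hH ?_)
    rw [h3, hC3]
    refine hw i hi hne _ (fun r hr => ?_) fun r hr => by simp [cleared, hr]
    rw [cleared, if_neg (by omega), hC' r (by omega)]
  refine wp_dispatch hH _ _ _ 0 (Nat.zero_le _) fun v => ?_
  rw [hC3, Nat.sub_zero]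
  cases hi : M.prog[(M.cfg x t).pc]? with
  | none => exact he (Or.inl hi) v
  | some i =>
    have hfin := hfin i hi
    show wp H x (sim _ e _ i) _ Q
    by_cases hhalt : i = .halt
    · subst hhalt
      exact he (Or.inr hi) v
    by_cases hout : ∃ a b, i = .output a b
    · obtain ⟨a, b, rfl⟩ := hout
      refine wp_add hH (by norm_num) (by norm_num) (by norm_num) (hfin hhalt _ (fun r hr => ?_) ?_)
      · rw [Function.update_of_ne (by omega), Function.update_of_ne (by omega)]
      · simp [hC11, Instr.newPc]
    · push Not at hout
      refine wp_sim hH (β := β + 3) (S := S) (by simpa using hC5) (by simpa using hC11) hm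
        (by omega) (fun r hr => (touched_le_hi hi hr).trans_lt hS) hhalt hout
        fun C' h4 h3 => hfin hhalt C' (fun r hr => ?_) (by simpa using h3)
      rw [h4 r hr, Function.update_of_ne (by omega)]

end Code

/-! ### The program of the amortized enumerator and its first two stages -/

/-- The machines from which the amortized enumerator is built: machines that compute the space
bound `s` and the delay `p`, the given enumerator, and bounds (as multiples of `s`) for the space
used by the first two and for the number of digits of the counters. -/
structure Setup where
  Ms : RAM
  Mp : RAM
  I : RAM
  cs : ℕ
  cp : ℕ
  ck : ℕ

namespace Setup
open Code Amortization

variable (E : Setup)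

def l₁ (s : ℕ) : ℕ := 3 + E.cs * s
def l₂ (s : ℕ) : ℕ := 3 + E.cp * s
def len (s : ℕ) : ℕ := 3 + (E.ck + 1) * s

/-- The first block comes first because its address does not depend on s, which is still unknown
while it is in use. Its length is computed here, as the address of the second block. -/
def endSpace : Code :=
  seq (.load 15 5) <| seq (.const 0 E.cs) <| seq (.mul 0 0 15) <| seq (.const 1 3) <|
    seq (.add 20 1 0) <| seq (.const 14 1) <| finish none false

def endDelay : Code :=
  seq (.load 1 5) <| seq (.add 1 1 12) <| seq (.const 0 8) <| seq (.mul 16 0 1) <|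
    seq (.add 17 16 13) <| seq (.const 0 E.cp) <| seq (.mul 0 0 15) <| seq (.const 1 3) <|
    seq (.add 0 1 0) <| seq (.add 20 20 0) <| seq (.const 0 (E.ck + 1)) <| seq (.mul 0 0 15) <|
    seq (.const 1 3) <| seq (.add 21 1 0) <| seq (.const 14 2) <| finish none false

/-- Store the state of the copy in turn. -/
def suffix (o : Option (ℕ × ℕ)) (quit : Bool) : Code :=
  seq (.store 4 3) <| seq (.add 0 4 11) <| seq (.store 0 6) <| seq (.add 0 4 12) <|
    seq (.store 0 7) <| seq (.store 10 8) <| finish o quit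

def workCode : Code := seq (.sub 17 17 11) (suffix none false)

def downCode : Code := seq (.sub 18 18 11) <| seq (.add 17 16 13) <| finish none false

/-- The comparison of register 18 with 1 tests whether copy 0 is in turn. -/
def haltCode : Code := br 18 11 (finish none true) downCode

def runCode : Code :=
  dispatch (sim workCode haltCode fun _ _ => seq (.add 6 11 13) <| seq (.add 7 13 13) workCode)
    haltCode E.I.prog 0

def emitCode : Instr → Code
  | .output a b => fetch 1 a <| fetch 2 b <| seq (.add 22 5 1) <| seq (.add 23 5 2) <|
      seq (.add 3 3 11) <| seq (.add 6 13 13) <| br 18 11 (suffix (some (22, 23)) true)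
        (seq (.add 18 19 13) <| seq (.add 17 16 13) <| suffix (some (22, 23)) false)
  | _ => downCode

/-- Addition of register 13, which holds 0, serves as a move. The address of the digit in register
10 was computed before the carry position in register 7 is advanced, so the changed digit is stored
at its old position. -/
def carryCode : Code :=
  br 7 18
    (br 13 8 (seq (.add 8 13 13) <| seq (.add 7 7 11) workCode)
      (seq (.add 8 11 13) <| br 13 9 (seq (.add 6 12 13) workCode)
        (seq (.add 3 3 11) <| seq (.add 6 13 13) workCode)))
    (br 13 9 (seq (.add 8 8 11) <| seq (.const 6 3) workCode)
      (seq (.add 8 8 11) <| seq (.add 6 12 13) <| seq (.add 19 19 11) <| seq (.add 18 19 13) <|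
        seq (.add 17 16 13) <| suffix none false))

/-- The leading digit is loaded next to the digit at the carry position, because a single unit of
work may depend on both. -/
def enumCode : Code :=
  seq (.add 0 4 11) <| seq (.load 6 0) <| seq (.add 0 4 12) <| seq (.load 7 0) <|
    seq (.add 10 5 15) <| seq (.add 0 10 18) <| seq (.load 9 0) <| seq (.add 10 10 7) <|
    seq (.load 8 10) <|
    br 6 12 (br 13 17 (br 13 6 carryCode E.runCode) downCode)
      (br 12 6 downCode (dispatch emitCode downCode E.I.prog 0))

def body : Code :=
  seq (.const 11 1) <| seq (.const 12 2) <| seq (.const 4 24) <| seq (.add 4 4 20) <|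
    seq (.mul 0 18 21) <| seq (.add 4 4 0) <| seq (.const 0 3) <| seq (.add 5 4 0) <|
    seq (.load 3 4) <|
    br 14 11 (bound E.Ms E.endSpace) (br 14 12 (bound E.Mp E.endDelay) E.enumCode)

/-- The amortized enumerator. -/
def machine : RAM := ⟨compile 0 E.body⟩

/-- The contents of the memory behind the control registers. -/
def layout (x : List ℕ) (s ts tp : ℕ) (mach : ℕ → Mach) : ℕ → ℕ :=
  blocks (E.l₁ s) (E.l₂ s) (E.len s) (cell E.Ms x (E.cs * s) ts 0 0 fun _ => 0)
    (cell E.Mp x (E.cp * s) tp 0 0 fun _ => 0)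
    fun m => cell E.I x s (mach m).t (mach m).ph (mach m).q (mach m).bits

/-- The memory at the start of a unit of work. -/
structure Rep (x : List ℕ) (s p V g ts tp : ℕ) (σ : St) (C h : ℕ → ℕ) : Prop where
  heap : h = E.layout x s ts tp σ.mach
  low : ∀ r < 14, C r = 0
  stage : C 14 = g
  zero : g = 0 → ∀ r, 15 ≤ r → r < 22 → C r = 0
  one : g = 1 → C 15 = s ∧ C 16 = 0 ∧ C 17 = 0 ∧ C 18 = 0 ∧ C 19 = 0 ∧ C 20 = E.l₁ s ∧ C 21 = 0
  two : g = 2 → C 15 = s ∧ C 16 = 8 * (p + 2) ∧ C 17 = σ.f ∧ C 18 = σ.j ∧ C 19 = σ.K ∧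
    C 20 = E.l₁ s + E.l₂ s ∧ C 21 = E.len s
  out₁ : C 22 ≤ V
  out₂ : C 23 ≤ V

variable {E} {x : List ℕ} {s p H V g ts tp : ℕ} {σ : St} {C h : ℕ → ℕ}
  {Q : (ℕ → ℕ) → Option (ℕ × ℕ) → Bool → Prop}

lemma cleared_update {C : ℕ → ℕ} {r v : ℕ} (hr : r < 14) :
    cleared (Function.update C r v) = cleared C := by
  funext i
  simp only [cleared]
  split_ifs with h
  · rfl
  · rw [Function.update_of_ne (by omega)]

/-- The part of the program before the distinction of the stages. -/
lemma wp_body {β : ℕ} (hH : 24 + (β + 3) ≤ H) (hlow : ∀ r < 14, C r = 0)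
    (hβ : C 20 + C 18 * C 21 = β)
    (hw : ∀ C', (∀ r, 14 ≤ r → C' r = C r) → C' 3 = h β → C' 4 = 24 + β → C' 5 = 24 + (β + 3) →
      C' 11 = 1 → C' 12 = 2 → C' 13 = 0 →
      wp H x (br 14 11 (bound E.Ms E.endSpace) (br 14 12 (bound E.Mp E.endDelay) E.enumCode))
        (glue C' h) Q) : wp H x E.body (glue C h) Q := by
  have h24 : 24 ≤ H := by omega
  refine wp_const h24 (by norm_num) <| wp_const h24 (by norm_num) <| wp_const h24 (by norm_num) <|
    wp_add h24 (by norm_num) (by norm_num) (by norm_num) <|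
    wp_mul h24 (by norm_num) (by norm_num) (by norm_num) <|
    wp_add h24 (by norm_num) (by norm_num) (by norm_num) <| wp_const h24 (by norm_num) <|
    wp_add h24 (by norm_num) (by norm_num) (by norm_num) <|
    wp_load (o := β) h24 (by norm_num) (by norm_num) ?_ (by omega) <| hw _ (fun r hr => ?_) ?_ ?_ ?_
      ?_ ?_ ?_
  · simp [add_assoc, hβ]
  · simp only [Function.update_apply]
    repeat rw [if_neg (by omega)]
  · simp
  · simp [add_assoc, hβ]
  · simp [add_assoc]; omega
  · simp
  · simp
  · simp [hlow 13]

/-- The first stage: computation of the space bound. -/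
lemma wp_stage_zero (hrep : E.Rep x s p V 0 ts 0 σ C h) (hH : 24 + (3 + E.cs * s) ≤ H)
    (hS : (E.Ms.cfg x (ts + 1)).hi < E.cs * s)
    (hs : E.Ms.Halted (E.Ms.cfg x ts) → (E.Ms.cfg x ts).mem 0 = s) :
    wp H x E.body (glue C h) fun R o st => st = false ∧ o = none ∧ ∃ C' h', R = glue C' h' ∧
      (E.Ms.Halted (E.Ms.cfg x ts) → E.Rep x s p V 1 ts 0 σ C' h') ∧
      (¬ E.Ms.Halted (E.Ms.cfg x ts) → E.Rep x s p V 0 (ts + 1) 0 σ C' h') := by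
  have hz := hrep.zero rfl
  have h24 : 24 ≤ H := by omega
  have hcell : ∀ o < E.l₁ s, h o = cell E.Ms x (E.cs * s) ts 0 0 (fun _ => 0) o := fun o ho => by
    rw [hrep.heap, layout, blocks_fst ho]
  refine wp_body (β := 0) (by omega) hrep.low (by simp [hz]) fun C' hC' h3 h4 h5 h11 h12 h13 => ?_
  refine wp_br h24 (by norm_num) (by norm_num) (fun _ => ?_) fun hlt =>
    absurd (by rw [hC' 14 le_rfl, hrep.stage, h11]; norm_num) hlt
  refine wp_bound (β := 0) (t := ts) (S := E.cs * s) h24 (by omega) hS h4 h5 h11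
    (by rw [h3, hcell 0 (by simp [l₁])]; rfl) (fun a ha => ?_) (fun hh v => ?_)
    fun i hi hne C'' hC'' hlow => ?_
  · rw [zero_add, hcell (3 + a) (by simp [l₁, ha]), cell_mem ha]
  · have h0 : h 3 = s := by
      have h3 := cell_mem (M := E.Ms) (x := x) (t := ts) (ph := 0) (q := 0) (bits := fun _ => 0)
        (show 0 < E.cs * s by omega)
      rw [hcell 3 (by unfold l₁; omega)]
      exact h3.trans (hs hh)
    refine wp_load (o := 3) h24 (by norm_num) (by norm_num) (by simp [h5]) (by omega) <|
      wp_const h24 (by norm_num) <| wp_mul h24 (by norm_num) (by norm_num) (by norm_num) <|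
      wp_const h24 (by norm_num) <| wp_add h24 (by norm_num) (by norm_num) (by norm_num) <|
      wp_const h24 (by norm_num) <| wp_finish_none h24 ⟨rfl, rfl, _, _, rfl, fun _ => ?_,
        fun hn => absurd hh hn⟩
    constructor
    · exact hrep.heap
    · intro r hr; simp [cleared, hr]
    · simp [cleared]
    · simp
    · intro _; simp [cleared, h0, l₁, hC', hz]
    · simp
    · simpa [cleared, hC'] using hrep.out₁
    · simpa [cleared, hC'] using hrep.out₂
  · refine ⟨rfl, rfl, _, _, rfl, fun hh => ?_, fun _ => ?_⟩
    · rcases hh with hh | hh <;> rw [hi] at hh <;> simp_all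
    · have ht : ∀ r ∈ i.touched (E.Ms.cfg x ts).mem, r < E.cs * s := fun r hr =>
        (touched_le_hi hi hr).trans_lt hS
      constructor
      · rw [hrep.heap, layout, zero_add, write_blocks_fst fun d v hd => by
          have := ht d (target_mem_touched hd); unfold l₁; omega, blocks_update_fst (by simp [l₁]),
          write_cell_step hi ht, layout]
      · exact hlow
      · rw [hC'' 14 le_rfl, hC' 14 le_rfl, hrep.stage]
      · intro _ r hr hr'
        rw [hC'' r (by omega), hC' r (by omega), hz r hr hr']
      · simp
      · simp
      · rw [hC'' 22 (by omega), hC' 22 (by omega)]; exact hrep.out₁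
      · rw [hC'' 23 (by omega), hC' 23 (by omega)]; exact hrep.out₂

/-- The second stage: computation of the delay. -/
lemma wp_stage_one (hrep : E.Rep x s p V 1 ts tp (St.init p) C h)
    (hH : 24 + (E.l₁ s + (3 + E.cp * s)) ≤ H) (hS : (E.Mp.cfg x (tp + 1)).hi < E.cp * s)
    (hs : E.Mp.Halted (E.Mp.cfg x tp) → (E.Mp.cfg x tp).mem 0 = p) :
    wp H x E.body (glue C h) fun R o st => st = false ∧ o = none ∧ ∃ C' h', R = glue C' h' ∧
      (E.Mp.Halted (E.Mp.cfg x tp) → E.Rep x s p V 2 ts tp (St.init p) C' h') ∧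
      (¬ E.Mp.Halted (E.Mp.cfg x tp) → E.Rep x s p V 1 ts (tp + 1) (St.init p) C' h') := by
  obtain ⟨z15, z16, z17, z18, z19, z20, z21⟩ := hrep.one rfl
  have h24 : 24 ≤ H := by omega
  have hcell : ∀ o < E.l₂ s, h (E.l₁ s + o) = cell E.Mp x (E.cp * s) tp 0 0 (fun _ => 0) o :=
    fun o ho => by rw [hrep.heap, layout, blocks_snd ho]
  refine wp_body (β := E.l₁ s) (by omega) hrep.low (by simp [z18, z20])
    fun C' hC' h3 h4 h5 h11 h12 h13 => ?_
  refine wp_br h24 (by norm_num) (by norm_num)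
    (fun hlt => by rw [hC' 14 le_rfl, hrep.stage, h11] at hlt; omega) fun _ => ?_
  refine wp_br h24 (by norm_num) (by norm_num) (fun _ => ?_) fun hlt =>
    absurd (by rw [hC' 14 le_rfl, hrep.stage, h12]; norm_num) hlt
  refine wp_bound (β := E.l₁ s) (t := tp) (S := E.cp * s) h24 (by omega) hS h4 h5 h11
    (by rw [h3]; exact hcell 0 (by simp [l₂])) (fun a ha => ?_) (fun hh v => ?_)
    fun i hi hne C'' hC'' hlow => ?_
  · rw [add_assoc, hcell (3 + a) (by simp [l₂, ha]), cell_mem ha]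
  · have h0 : h (E.l₁ s + 3) = p := by
      have h3 := cell_mem (M := E.Mp) (x := x) (t := tp) (ph := 0) (q := 0) (bits := fun _ => 0)
        (show 0 < E.cp * s by omega)
      rw [hcell 3 (by unfold l₂; omega)]
      exact h3.trans (hs hh)
    refine wp_load (o := E.l₁ s + 3) h24 (by norm_num) (by norm_num) (by simp [h5]) (by omega) <|
      wp_add h24 (by norm_num) (by norm_num) (by norm_num) <| wp_const h24 (by norm_num) <|
      wp_mul h24 (by norm_num) (by norm_num) (by norm_num) <|
      wp_add h24 (by norm_num) (by norm_num) (by norm_num) <| wp_const h24 (by norm_num) <|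
      wp_mul h24 (by norm_num) (by norm_num) (by norm_num) <| wp_const h24 (by norm_num) <|
      wp_add h24 (by norm_num) (by norm_num) (by norm_num) <|
      wp_add h24 (by norm_num) (by norm_num) (by norm_num) <| wp_const h24 (by norm_num) <|
      wp_mul h24 (by norm_num) (by norm_num) (by norm_num) <| wp_const h24 (by norm_num) <|
      wp_add h24 (by norm_num) (by norm_num) (by norm_num) <| wp_const h24 (by norm_num) <|
      wp_finish_none h24 ⟨rfl, rfl, _, _, rfl, fun _ => ?_, fun hn => absurd hh hn⟩
    constructor
    · exact hrep.heap
    · intro r hr; simp [cleared, hr]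
    · simp [cleared]
    · simp
    · simp
    · intro _; simp [cleared, h0, l₂, len, hC', h12, h13, z15, z18, z19, z20, St.init]
    · simpa [cleared, hC'] using hrep.out₁
    · simpa [cleared, hC'] using hrep.out₂
  · refine ⟨rfl, rfl, _, _, rfl, fun hh => ?_, fun _ => ?_⟩
    · rcases hh with hh | hh <;> rw [hi] at hh <;> simp_all
    · have ht : ∀ r ∈ i.touched (E.Mp.cfg x tp).mem, r < E.cp * s := fun r hr =>
        (touched_le_hi hi hr).trans_lt hS
      constructor
      · rw [hrep.heap, layout, write_blocks_snd fun d v hd => by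
          have := ht d (target_mem_touched hd); unfold l₂; omega]
        have := blocks_update_snd (l₁ := E.l₁ s) (l₂ := E.l₂ s) (L := E.len s)
          (c₁ := cell E.Ms x (E.cs * s) ts 0 0 fun _ => 0)
          (c₂ := write 3 (cell E.Mp x (E.cp * s) tp 0 0 fun _ => 0)
            (target x (E.Mp.cfg x tp).mem i))
          (c₃ := fun m => cell E.I x s ((St.init p).mach m).t ((St.init p).mach m).ph
            ((St.init p).mach m).q ((St.init p).mach m).bits)
          (v := i.newPc (E.Mp.cfg x tp).pc (E.Mp.cfg x tp).mem) (show 0 < E.l₂ s by simp [l₂])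
        rw [add_zero] at this
        rw [this, write_cell_step hi ht, layout]
      · exact hlow
      · rw [hC'' 14 le_rfl, hC' 14 le_rfl, hrep.stage]
      · simp
      · intro _
        simp [hC'', hC', z15, z16, z17, z18, z19, z20, z21]
      · simp
      · rw [hC'' 22 (by omega), hC' 22 (by omega)]; exact hrep.out₁
      · rw [hC'' 23 (by omega), hC' 23 (by omega)]; exact hrep.out₂

end Setup

/-! ### The enumeration stage -/

namespace Setup
open Code Amortization

variable {E : Setup} {x : List ℕ} {k s p H V ts tp : ℕ} {σ : St} {C h : ℕ → ℕ}
  {Q : (ℕ → ℕ) → Option (ℕ × ℕ) → Bool → Prop} {β q₀ : ℕ}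

/-- The registers that are set at the start of a unit of work, and not changed afterwards. -/
structure Loaded (s β q₀ : ℕ) (C : ℕ → ℕ) : Prop where
  base : C 4 = 24 + β
  mem : C 5 = 24 + (β + 3)
  digit : C 10 = 24 + (β + (3 + s + q₀))
  one : C 11 = 1
  two : C 12 = 2
  zero : C 13 = 0

lemma wp_suffix {o : Option (ℕ × ℕ)} {quit : Bool} (hC : Loaded s β q₀ C)
    (hH : 24 + (β + (3 + s + q₀)) ≤ H) (ho : o = none ∨ o = some (22, 23) ∧ (C 22 ≤ C 23 → C 23 ≤ H))
    (hw : Q (glue (cleared C) (Function.update (Function.update (Function.update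
      (Function.update h β (C 3)) (β + 1) (C 6)) (β + 2) (C 7)) (β + (3 + s + q₀)) (C 8)))
      o quit) : wp H x (suffix o quit) (glue C h) Q := by
  have h24 : 24 ≤ H := by omega
  refine wp_store (o := β) h24 (by norm_num) (by norm_num) hC.base (by omega) <|
    wp_add h24 (by norm_num) (by norm_num) (by norm_num) <|
    wp_store (o := β + 1) h24 (by norm_num) (by norm_num)
      (by simp [hC.base, hC.one, add_assoc]) (by omega) <|
    wp_add h24 (by norm_num) (by norm_num) (by norm_num) <|
    wp_store (o := β + 2) h24 (by norm_num) (by norm_num)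
      (by simp [hC.base, hC.two, add_assoc]) (by omega) <|
    wp_store (o := β + (3 + s + q₀)) h24 (by norm_num) (by norm_num)
      (by simp [hC.digit]) (by omega) ?_
  rcases ho with rfl | ⟨rfl, h23⟩
  · refine wp_finish_none h24 ?_
    rw [cleared_update (by norm_num), cleared_update (by norm_num)]
    simpa using hw
  · refine wp_finish_some h24 (by simpa using h23) ?_
    rw [cleared_update (by norm_num), cleared_update (by norm_num)]
    simpa using hw

lemma _root_.Amortization.St.spawn_mach (Out : ℕ → Prop) (B : ℕ) (σ : St) :
    (σ.spawn Out B).mach = Function.update σ.mach σ.j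
      { σ.mach σ.j with
        ph := 2
        mu := (σ.mach σ.j).mu + 1
        bits := Function.update (σ.mach σ.j).bits (σ.mach σ.j).q
          ((σ.mach σ.j).bits (σ.mach σ.j).q + 1) } := rfl

/-- The memory, where `c` is the contents of the block of copy `j`. -/
def layoutWith (E : Setup) (x : List ℕ) (s ts tp : ℕ) (mach : ℕ → Mach) (j : ℕ) (c : ℕ → ℕ) :
    ℕ → ℕ :=
  blocks (E.l₁ s) (E.l₂ s) (E.len s) (cell E.Ms x (E.cs * s) ts 0 0 fun _ => 0)
    (cell E.Mp x (E.cp * s) tp 0 0 fun _ => 0)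
    (Function.update
      (fun m => cell E.I x s (mach m).t (mach m).ph (mach m).q (mach m).bits) j c)

lemma layoutWith_self (mach : ℕ → Mach) (j : ℕ) : E.layoutWith x s ts tp mach j
    (cell E.I x s (mach j).t (mach j).ph (mach j).q (mach j).bits) =
    E.layout x s ts tp mach := by
  simp [layoutWith, layout]

lemma layoutWith_update {mach : ℕ → Mach} {j : ℕ} {c : ℕ → ℕ} {o v : ℕ} (ho : o < E.len s) :
    Function.update (E.layoutWith x s ts tp mach j c) (E.l₁ s + E.l₂ s + j * E.len s + o) v =
      E.layoutWith x s ts tp mach j (Function.update c o v) := by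
  rw [layoutWith, blocks_update_thd ho, layoutWith]
  simp

lemma layoutWith_write {mach : ℕ → Mach} {j : ℕ} {c : ℕ → ℕ} {w : Option (ℕ × ℕ)}
    (ho : ∀ d v, w = some (d, v) → 3 + d < E.len s) :
    write (E.l₁ s + E.l₂ s + j * E.len s + 3) (E.layoutWith x s ts tp mach j c) w =
      E.layoutWith x s ts tp mach j (write 3 c w) := by
  rw [layoutWith, write_blocks_thd ho, layoutWith]
  simp

lemma layoutWith_eq {mach : ℕ → Mach} {j : ℕ} {M : Mach} : E.layoutWith x s ts tp mach j
    (cell E.I x s M.t M.ph M.q M.bits) = E.layout x s ts tp (Function.update mach j M) := by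
  rw [layoutWith, layout]
  congr 1
  funext m
  rcases eq_or_ne m j with rfl | hm
  · simp
  · simp [Function.update_of_ne hm]

/-- Registers `14, …, 23` agree with the state `σ`. -/
structure Ctl (E : Setup) (s p V : ℕ) (σ : St) (C : ℕ → ℕ) : Prop where
  stage : C 14 = 2
  space : C 15 = s
  turn : C 16 = 8 * (p + 2)
  fuel : C 17 = σ.f
  j : C 18 = σ.j
  K : C 19 = σ.K
  off : C 20 = E.l₁ s + E.l₂ s
  len : C 21 = E.len s
  out₁ : C 22 ≤ V
  out₂ : C 23 ≤ V

lemma Ctl.rep (hC : Ctl E s p V σ C) :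
    E.Rep x s p V 2 ts tp σ (cleared C) (E.layout x s ts tp σ.mach) where
  heap := rfl
  low r hr := by simp [cleared, hr]
  stage := by simp [cleared, hC.stage]
  zero hg := absurd hg (by norm_num)
  one hg := absurd hg (by norm_num)
  two _ := by simp [cleared, hC.space, hC.turn, hC.fuel, hC.j, hC.K, hC.off, hC.len]
  out₁ := hC.out₁
  out₂ := hC.out₂

lemma Rep.ctl (h : E.Rep x s p V 2 ts tp σ C h') : Ctl E s p V σ C := by
  obtain ⟨h1, h2, h3, h4, h5, h6, h7⟩ := h.two rfl
  exact ⟨h.stage, h1, h2, h3, h4, h5, h6, h7, h.out₁, h.out₂⟩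

lemma Ctl.congr (hC : Ctl E s p V σ C) {C' : ℕ → ℕ} (h : ∀ r, 14 ≤ r → C' r = C r) :
    Ctl E s p V σ C' := by
  obtain ⟨h1, h2, h3, h4, h5, h6, h7, h8, h9, h10⟩ := hC
  constructor <;> rw [h _ (by norm_num)] <;> assumption

/-- The state of the copy in turn is stored. -/
lemma wp_suffix_rep {o : Option (ℕ × ℕ)} {quit : Bool} {σ' : St} {M' : Mach} {c bits : ℕ → ℕ}
    (hβ : β = E.l₁ s + E.l₂ s + σ.j * E.len s) (hC : Loaded s β q₀ C) (hctl : Ctl E s p V σ' C)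
    (hq : 3 + s + q₀ < E.len s) (hH : 24 + (β + E.len s) ≤ H)
    (ho : o = none ∨ o = some (22, 23) ∧ (C 22 ≤ C 23 → C 23 ≤ H)) (hh : h = E.layoutWith x s ts tp σ.mach σ.j c)
    (h3 : C 3 = (E.I.cfg x M'.t).pc) (h6 : C 6 = M'.ph) (h7 : C 7 = M'.q)
    (hmem : ∀ a < s, c (3 + a) = (E.I.cfg x M'.t).mem a)
    (hbits : ∀ i, c (3 + s + i) = bits i) (h8 : Function.update bits q₀ (C 8) = M'.bits)
    (hσ' : σ'.mach = Function.update σ.mach σ.j M')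
    (hw : ∀ C' h', E.Rep x s p V 2 ts tp σ' C' h' → C' 22 = C 22 → C' 23 = C 23 →
      Q (glue C' h') o quit) : wp H x (suffix o quit) (glue C h) Q := by
  refine wp_suffix hC (by omega) ho ?_
  convert hw _ _ (Ctl.rep hctl) rfl rfl using 2
  rw [hh, hσ', ← layoutWith_eq]
  have e0 := layoutWith_update (E := E) (x := x) (s := s) (ts := ts) (tp := tp) (mach := σ.mach)
    (j := σ.j) (c := c) (o := 0) (v := C 3) (by omega)
  rw [add_zero, ← hβ] at e0
  rw [e0, hβ, layoutWith_update (by omega), layoutWith_update (by omega), layoutWith_update hq]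
  congr 1
  refine cell_ext ?_ ?_ ?_ (fun a ha => ?_) fun i => ?_
  · simp [Function.update_of_ne (show 0 ≠ 3 + s + q₀ by omega), h3]
  · simp [Function.update_of_ne (show 1 ≠ 3 + s + q₀ by omega), h6]
  · simp [Function.update_of_ne (show 2 ≠ 3 + s + q₀ by omega), h7]
  · rw [Function.update_of_ne (by omega), Function.update_of_ne (by omega),
      Function.update_of_ne (by omega), Function.update_of_ne (by omega), hmem a ha]
  · rw [← h8]
    rcases eq_or_ne i q₀ with rfl | hi
    · simp
    · rw [Function.update_of_ne (by omega), Function.update_of_ne (by omega),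
        Function.update_of_ne (by omega), Function.update_of_ne (by omega),
        Function.update_of_ne hi, hbits]

/-- The unit of work has been carried out. -/
def Post (E : Setup) (k : ℕ) (x : List ℕ) (s p V ts tp : ℕ) (σ : St) (R : ℕ → ℕ)
    (o : Option (ℕ × ℕ)) (quit : Bool) : Prop :=
  (quit = true ↔ σ.quit fun t => E.I.Halted (E.I.cfg x t)) ∧
  (o.map fun ab => word k R ab.1 ab.2) = σ.emit.bind (E.I.emit k x) ∧
  (quit = false → ∃ C' h', R = glue C' h' ∧ E.Rep x s p V 2 ts tp
    (next (E.I.OutputsAt k x) (fun t => E.I.Halted (E.I.cfg x t)) (8 * (p + 2)) σ) C' h')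

lemma quit_iff {Halt : ℕ → Prop} : σ.quit Halt ↔ σ.j = 0 ∧ ((σ.mach σ.j).ph = 2 ∨
    ((σ.mach σ.j).ph = 0 ∧ σ.f ≠ 0 ∧ Halt (σ.mach σ.j).t)) := by
  constructor
  · rintro ⟨hj, h2⟩
    rw [hj]; exact ⟨rfl, h2⟩
  · rintro ⟨hj, h2⟩
    rw [hj] at h2; exact ⟨hj, h2⟩

/-- The contents `c` of the block need not be the state before the unit of work: when an instruction
is simulated, the simulated registers have already been changed at this point. -/
lemma wp_workCode {M' : Mach} {c bits : ℕ → ℕ}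
    (hβ : β = E.l₁ s + E.l₂ s + σ.j * E.len s) (hC : Loaded s β q₀ C) (hctl : Ctl E s p V σ C)
    (hq : 3 + s + q₀ < E.len s) (hH : 24 + (β + E.len s) ≤ H)
    (hh : h = E.layoutWith x s ts tp σ.mach σ.j c)
    (h3 : C 3 = (E.I.cfg x M'.t).pc) (h6 : C 6 = M'.ph) (h7 : C 7 = M'.q)
    (hmem : ∀ a < s, c (3 + a) = (E.I.cfg x M'.t).mem a)
    (hbits : ∀ i, c (3 + s + i) = bits i) (h8 : Function.update bits q₀ (C 8) = M'.bits)
    (hst : ¬ σ.quit fun t => E.I.Halted (E.I.cfg x t)) (hph : (σ.mach σ.j).ph ≠ 2)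
    (hnext : next (E.I.OutputsAt k x) (fun t => E.I.Halted (E.I.cfg x t)) (8 * (p + 2)) σ =
      σ.work M') : wp H x workCode (glue C h) (E.Post k x s p V ts tp σ) := by
  refine wp_sub (by omega) (by norm_num) (by norm_num) (by norm_num) ?_
  refine wp_suffix_rep (σ' := σ.work M') (M' := { M' with mu := M'.mu + 1 }) (c := c) (bits := bits)
    hβ ⟨?_, ?_, ?_, ?_, ?_, ?_⟩ ⟨?_, ?_, ?_, ?_, ?_, ?_, ?_, ?_, ?_, ?_⟩ hq hH (Or.inl rfl) hh
    (by simpa using h3) (by simpa using h6) (by simpa using h7) hmem hbits (by simpa using h8) rfl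
    fun C' h' hrep _ _ => ⟨by simp [hst], by simp [St.emit, hph], fun _ => ⟨C', h', rfl, hnext ▸ hrep⟩⟩
  · simpa using hC.base
  · simpa using hC.mem
  · simpa using hC.digit
  · simpa using hC.one
  · simpa using hC.two
  · simpa using hC.zero
  · simpa using hctl.stage
  · simpa using hctl.space
  · simpa using hctl.turn
  · simp [hctl.fuel, hC.one, St.work]
  · simpa [St.work] using hctl.j
  · simpa [St.work] using hctl.K
  · simpa using hctl.off
  · simpa using hctl.len
  · simpa using hctl.out₁
  · simpa using hctl.out₂

lemma wp_downCode (hH : 24 ≤ H) (h11 : C 11 = 1) (h13 : C 13 = 0) (hctl : Ctl E s p V σ C)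
    (hh : h = E.layout x s ts tp σ.mach)
    (hst : ¬ σ.quit fun t => E.I.Halted (E.I.cfg x t)) (hph : (σ.mach σ.j).ph ≠ 2)
    (hnext : next (E.I.OutputsAt k x) (fun t => E.I.Halted (E.I.cfg x t)) (8 * (p + 2)) σ =
      σ.down (8 * (p + 2))) : wp H x downCode (glue C h) (E.Post k x s p V ts tp σ) := by
  refine wp_sub hH (by norm_num) (by norm_num) (by norm_num) <|
    wp_add hH (by norm_num) (by norm_num) (by norm_num) <| wp_finish_none hH ⟨by simp [hst],
      by simp [St.emit, hph], fun _ => ⟨_, _, rfl, ?_⟩⟩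
  rw [hnext, hh]
  refine Ctl.rep (σ := σ.down (8 * (p + 2))) ⟨?_, ?_, ?_, ?_, ?_, ?_, ?_, ?_, ?_, ?_⟩
  · simpa using hctl.stage
  · simpa using hctl.space
  · simpa using hctl.turn
  · simp [hctl.turn, h13, St.down]
  · simp [hctl.j, h11, St.down]
  · simpa [St.down] using hctl.K
  · simpa using hctl.off
  · simpa using hctl.len
  · simpa using hctl.out₁
  · simpa using hctl.out₂

end Setup

namespace Setup
open Code Amortization

variable {E : Setup} {x : List ℕ} {k s p H V ts tp : ℕ} {σ : St} {C h : ℕ → ℕ}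
  {Q : (ℕ → ℕ) → Option (ℕ × ℕ) → Bool → Prop} {β q₀ : ℕ}

/-- The situation in the stage of enumeration, after the state of the copy `M` in turn has been
loaded. -/
structure Sit (E : Setup) (x : List ℕ) (s p H V ts tp : ℕ) (σ : St) (β : ℕ) (C h : ℕ → ℕ) :
    Prop where
  base : β = E.l₁ s + E.l₂ s + σ.j * E.len s
  bound : 24 + (β + E.len s) ≤ H
  loaded : Loaded s β (σ.mach σ.j).q C
  ctl : Ctl E s p V σ C
  pos : 3 + s + (σ.mach σ.j).q < E.len s
  heap : h = E.layout x s ts tp σ.mach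
  pc : C 3 = (E.I.cfg x (σ.mach σ.j).t).pc
  ph : C 6 = (σ.mach σ.j).ph
  q : C 7 = (σ.mach σ.j).q
  digit : C 8 = (σ.mach σ.j).bits (σ.mach σ.j).q
  top : C 9 = (σ.mach σ.j).bits σ.j

namespace Sit

lemma h24 (hS : E.Sit x s p H V ts tp σ β C h) : 24 ≤ H := by have := hS.bound; omega

lemma down (hS : E.Sit x s p H V ts tp σ β C h)
    (hst : ¬ σ.quit fun t => E.I.Halted (E.I.cfg x t)) (hph : (σ.mach σ.j).ph ≠ 2)
    (hnext : next (E.I.OutputsAt k x) (fun t => E.I.Halted (E.I.cfg x t)) (8 * (p + 2)) σ =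
      σ.down (8 * (p + 2))) (v : ℕ) :
    wp H x downCode (glue (Function.update C 0 v) h) (E.Post k x s p V ts tp σ) :=
  wp_downCode hS.h24 (by simpa using hS.loaded.one) (by simpa using hS.loaded.zero)
    (hS.ctl.congr fun r hr => Function.update_of_ne (by omega) _ _) hS.heap hst hph hnext

/-- A unit of work that does not change the simulated memory. -/
lemma work (hS : E.Sit x s p H V ts tp σ β C h) {M' : Mach} {C' : ℕ → ℕ}
    (hC : ∀ r, 14 ≤ r → C' r = C r) (h4 : C' 4 = C 4) (h5 : C' 5 = C 5) (h10 : C' 10 = C 10)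
    (h11 : C' 11 = C 11) (h12 : C' 12 = C 12) (h13 : C' 13 = C 13)
    (h3 : C' 3 = (E.I.cfg x M'.t).pc) (h6 : C' 6 = M'.ph) (h7 : C' 7 = M'.q)
    (hmem : (E.I.cfg x M'.t).mem = (E.I.cfg x (σ.mach σ.j).t).mem)
    (h8 : Function.update (σ.mach σ.j).bits (σ.mach σ.j).q (C' 8) = M'.bits)
    (hst : ¬ σ.quit fun t => E.I.Halted (E.I.cfg x t)) (hph : (σ.mach σ.j).ph ≠ 2)
    (hnext : next (E.I.OutputsAt k x) (fun t => E.I.Halted (E.I.cfg x t)) (8 * (p + 2)) σ =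
      σ.work M') : wp H x workCode (glue C' h) (E.Post k x s p V ts tp σ) := by
  obtain ⟨l1, l2, l3, l4, l5, l6⟩ := hS.loaded
  refine wp_workCode hS.base (q₀ := (σ.mach σ.j).q) ⟨?_, ?_, ?_, ?_, ?_, ?_⟩ (hS.ctl.congr hC)
    hS.pos hS.bound (hS.heap.trans (layoutWith_self _ σ.j).symm) h3 h6 h7 (fun a ha => ?_)
    (fun i => cell_bits i) h8 hst hph hnext
  · rw [h4, l1]
  · rw [h5, l2]
  · rw [h10, l3]
  · rw [h11, l4]
  · rw [h12, l5]
  · rw [h13, l6]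
  · rw [hmem, cell_mem ha]

/-- An output changes no register, so skipping or emitting it only advances the simulated program
counter. -/
lemma mem_eq_of_out {t : ℕ} (h : E.I.OutputsAt k x t) :
    (∃ a b, E.I.prog[(E.I.cfg x t).pc]? = some (.output a b)) ∧
    (E.I.cfg x (t + 1)).pc = (E.I.cfg x t).pc + 1 ∧
    (E.I.cfg x (t + 1)).mem = (E.I.cfg x t).mem := by
  simp only [RAM.OutputsAt, RAM.emit] at h
  split at h
  · rename_i a b heq
    refine ⟨⟨a, b, heq⟩, ?_⟩
    rw [RAM.cfg_succ, RAM.step_of_some heq]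
    exact ⟨rfl, rfl⟩
  · simp at h

lemma carry (hS : E.Sit x s p H V ts tp σ β C h) {N : ℕ} {Halt : ℕ → Prop}
    (hI : Inv (E.I.OutputsAt k x) Halt p N σ) (h1 : (σ.mach σ.j).ph = 1) (hf : σ.f ≠ 0) :
    wp H x carryCode (glue C h) (E.Post k x s p V ts tp σ) := by
  have hM := hI.mach σ.j
  have hout := (hM.carry h1).1
  obtain ⟨-, hop, hom⟩ := mem_eq_of_out hout
  have hst : ¬ σ.quit fun t => E.I.Halted (E.I.cfg x t) := by
    rw [quit_iff]; simp [h1]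
  have hph : (σ.mach σ.j).ph ≠ 2 := by omega
  have h24 := hS.h24
  have f13 := hS.loaded.zero
  have f11 := hS.loaded.one
  have f12 := hS.loaded.two
  refine wp_br h24 (by norm_num) (by norm_num) (fun hq => ?_) fun hq => ?_
  · rw [hS.q, hS.ctl.j] at hq
    refine wp_br h24 (by norm_num) (by norm_num) (fun hb => ?_) fun hb => ?_
    · rw [f13, hS.digit] at hb
      refine wp_add h24 (by norm_num) (by norm_num) (by norm_num) <|
        wp_add h24 (by norm_num) (by norm_num) (by norm_num) <|
        hS.work (M' := { σ.mach σ.j with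
          q := (σ.mach σ.j).q + 1
          bits := Function.update (σ.mach σ.j).bits (σ.mach σ.j).q 0 })
          (fun r hr => ?_) ?_ ?_ ?_ ?_ ?_ ?_ ?_ ?_ ?_ ?_ ?_ hst hph ?_
      · rw [Function.update_of_ne (by omega), Function.update_of_ne (by omega)]
      all_goals try simp [f13, f11, hS.q, hS.pc, hS.ph]
      simp [next, h1, hf, hq, hb.ne']
    · rw [f13, hS.digit] at hb
      refine wp_add h24 (by norm_num) (by norm_num) (by norm_num) <|
        wp_br h24 (by norm_num) (by norm_num) (fun hw => ?_) fun hw => ?_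
      · have hw : 0 < (σ.mach σ.j).bits σ.j := by simpa [f13, hS.top] using hw
        refine wp_add h24 (by norm_num) (by norm_num) (by norm_num) <|
          hS.work (M' := { σ.mach σ.j with
            ph := 2
            bits := Function.update (σ.mach σ.j).bits (σ.mach σ.j).q 1 })
            (fun r hr => ?_) ?_ ?_ ?_ ?_ ?_ ?_ ?_ ?_ ?_ ?_ ?_ hst hph ?_
        · rw [Function.update_of_ne (by omega), Function.update_of_ne (by omega)]
        all_goals try simp [f13, f11, f12, hS.q, hS.pc]
        simp [next, h1, hf, hq, hw.ne']
        intro hb'; omega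
      · have hw : (σ.mach σ.j).bits σ.j = 0 := by simpa [f13, hS.top] using hw
        refine wp_add h24 (by norm_num) (by norm_num) (by norm_num) <|
          wp_add h24 (by norm_num) (by norm_num) (by norm_num) <|
          hS.work (M' := { σ.mach σ.j with
            t := (σ.mach σ.j).t + 1
            ph := 0
            bits := Function.update (σ.mach σ.j).bits (σ.mach σ.j).q 1 })
            (fun r hr => ?_) ?_ ?_ ?_ ?_ ?_ ?_ ?_ ?_ ?_ ?_ ?_ hst hph ?_
        · rw [Function.update_of_ne (by omega), Function.update_of_ne (by omega),
            Function.update_of_ne (by omega)]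
        all_goals try simp [f13, f11, hS.q, hS.pc, hop, hom]
        simp [next, h1, hf, hq, hw]
        intro hb'; omega
  · rw [hS.q, hS.ctl.j] at hq
    obtain ⟨hqj, -, -⟩ := hM.carry_end h1 hq
    refine wp_br h24 (by norm_num) (by norm_num) (fun hw => ?_) fun hw => ?_
    · have hw : 0 < (σ.mach σ.j).bits σ.j := by simpa [f13, hS.top] using hw
      refine wp_add h24 (by norm_num) (by norm_num) (by norm_num) <|
        wp_const h24 (by norm_num) <|
        hS.work (M' := { σ.mach σ.j with
          ph := 3
          bits := Function.update (σ.mach σ.j).bits (σ.mach σ.j).q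
            ((σ.mach σ.j).bits (σ.mach σ.j).q + 1) })
          (fun r hr => ?_) ?_ ?_ ?_ ?_ ?_ ?_ ?_ ?_ ?_ ?_ ?_ hst hph ?_
      · rw [Function.update_of_ne (by omega), Function.update_of_ne (by omega)]
      all_goals try simp [f13, f11, f12, hS.q, hS.pc, hS.digit]
      simp [next, h1, hf, hq, hw.ne']
    · have hw : (σ.mach σ.j).bits σ.j = 0 := by simpa [f13, hS.top] using hw
      obtain ⟨l1, l2, l3, l4, l5, l6⟩ := hS.loaded
      refine wp_add h24 (by norm_num) (by norm_num) (by norm_num) <|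
        wp_add h24 (by norm_num) (by norm_num) (by norm_num) <|
        wp_add h24 (by norm_num) (by norm_num) (by norm_num) <|
        wp_add h24 (by norm_num) (by norm_num) (by norm_num) <|
        wp_add h24 (by norm_num) (by norm_num) (by norm_num) <|
        wp_suffix_rep (p := p) (V := V) (σ' := σ.spawn (E.I.OutputsAt k x) (8 * (p + 2))) hS.base
          (q₀ := (σ.mach σ.j).q) ⟨?_, ?_, ?_, ?_, ?_, ?_⟩ ⟨?_, ?_, ?_, ?_, ?_, ?_, ?_, ?_, ?_, ?_⟩
          hS.pos hS.bound (Or.inl rfl) (hS.heap.trans (layoutWith_self _ σ.j).symm) ?_ ?_ ?_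
          (fun a ha => ?_) (fun i => cell_bits i) ?_ (St.spawn_mach _ _ _)
          fun C' h' hrep _ _ => ⟨by simp [hst], by simp [St.emit, hph],
            fun _ => ⟨C', h', rfl, ?_⟩⟩
      · simpa using l1
      · simpa using l2
      · simpa using l3
      · simpa using l4
      · simpa using l5
      · simpa using l6
      · simpa using hS.ctl.stage
      · simpa using hS.ctl.space
      · simpa using hS.ctl.turn
      · simp [hS.ctl.turn, f13, St.spawn]
      · simp [hS.ctl.K, f13, f11, St.spawn]
      · simp [hS.ctl.K, f11, St.spawn]
      · simpa using hS.ctl.off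
      · simpa using hS.ctl.len
      · simpa using hS.ctl.out₁
      · simpa using hS.ctl.out₂
      · simp [hS.pc]
      · simp [f12, f13]
      · simp [hS.q]
      · rw [cell_mem ha]
      · simp [hS.digit, f11]
      -- The block of the new copy needs no initialization: a block of zeros already represents a
      -- fresh copy.
      · have : next (E.I.OutputsAt k x) (fun t => E.I.Halted (E.I.cfg x t)) (8 * (p + 2)) σ =
            σ.spawn (E.I.OutputsAt k x) (8 * (p + 2)) := by
          simp [next, h1, hf, hq, hw]
        rw [this]; exact hrep

lemma run (hS : E.Sit x s p H V ts tp σ β C h) (hi : ∀ t, (E.I.cfg x t).hi < s)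
    (h0 : (σ.mach σ.j).ph = 0) (hf : σ.f ≠ 0) :
    wp H x E.runCode (glue C h) (E.Post k x s p V ts tp σ) := by
  have hph : (σ.mach σ.j).ph ≠ 2 := by omega
  have h24 := hS.h24
  have f13 := hS.loaded.zero
  have f11 := hS.loaded.one
  obtain ⟨l1, l2, l3, l4, l5, l6⟩ := hS.loaded
  have hlen : 3 + s ≤ E.len s := by have := hS.pos; omega
  have hb := hS.bound
  have hhalt : E.I.Halted (E.I.cfg x (σ.mach σ.j).t) → ∀ v,
      wp H x haltCode (glue (Function.update C 0 v) h) (E.Post k x s p V ts tp σ) := by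
    intro hh v
    refine wp_br h24 (by norm_num) (by norm_num) (fun hj => ?_) fun hj => ?_
    · have hj : σ.j = 0 := by simpa [hS.ctl.j, f11] using hj
      have hst : σ.quit fun t => E.I.Halted (E.I.cfg x t) :=
        quit_iff.2 ⟨hj, Or.inr ⟨h0, hf, hh⟩⟩
      exact wp_finish_none h24 ⟨by simp [hst], by simp [St.emit, hph], by simp⟩
    · have hj : σ.j ≠ 0 := by simpa [hS.ctl.j, f11] using hj
      exact hS.down (by rw [quit_iff]; simp [hj]) hph (by simp [next, h0, hf, hh]) v
  refine wp_dispatch h24 _ _ _ 0 (Nat.zero_le _) fun v => ?_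
  rw [hS.pc, Nat.sub_zero]
  cases hi' : E.I.prog[(E.I.cfg x (σ.mach σ.j).t).pc]? with
  | none => exact hhalt (Or.inl hi') v
  | some i =>
    show wp H x (sim _ _ _ i) _ _
    by_cases hne : i = .halt
    · subst hne
      exact hhalt (Or.inr hi') v
    have hnh : ¬ E.I.Halted (E.I.cfg x (σ.mach σ.j).t) := by
      rintro (hh | hh) <;> rw [hi'] at hh <;> simp_all
    have hst : ¬ σ.quit fun t => E.I.Halted (E.I.cfg x t) := by
      rw [quit_iff]; simp [h0, hnh]
    by_cases hout : ∃ a b, i = .output a b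
    · obtain ⟨a, b, rfl⟩ := hout
      have ho : E.I.OutputsAt k x (σ.mach σ.j).t := by simp [RAM.OutputsAt, RAM.emit, hi']
      refine wp_add h24 (by norm_num) (by norm_num) (by norm_num) <|
        wp_add h24 (by norm_num) (by norm_num) (by norm_num) <|
        hS.work (M' := { σ.mach σ.j with ph := 1, q := 0 })
          (fun r hr => ?_) ?_ ?_ ?_ ?_ ?_ ?_ ?_ ?_ ?_ ?_ ?_ hst hph ?_
      · rw [Function.update_of_ne (by omega), Function.update_of_ne (by omega),
          Function.update_of_ne (by omega)]
      all_goals try simp [f13, f11, hS.pc, hS.digit]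
      simp [next, h0, hf, hnh, ho]
    · push Not at hout
      have ho : ¬ E.I.OutputsAt k x (σ.mach σ.j).t := by
        simp only [RAM.OutputsAt, RAM.emit, hi']
        cases i <;> simp_all
      have ht : ∀ r ∈ i.touched (E.I.cfg x (σ.mach σ.j).t).mem, r < s := fun r hr =>
        (touched_le_hi hi' hr).trans_lt (hi _)
      have hwr := write_cell_step (ph := (σ.mach σ.j).ph) (q := (σ.mach σ.j).q)
        (bits := (σ.mach σ.j).bits) hi' ht
      refine wp_sim h24 (β := β + 3) (S := s) (by simpa using l2) (by simpa using l4)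
        (m := (E.I.cfg x (σ.mach σ.j).t).mem) (fun a ha => ?_) (by omega) ht hne hout
        fun C' h4 h3 => ?_
      · rw [hS.heap, hS.base, layout, add_assoc, blocks_thd (by omega), cell_mem ha]
      · have g : ∀ r, 4 ≤ r → C' r = C r := fun r hr => by
          rw [h4 r hr, Function.update_of_ne (by omega)]
        refine wp_workCode (M' := { σ.mach σ.j with t := (σ.mach σ.j).t + 1 })
          (q₀ := (σ.mach σ.j).q) (c := write 3 (cell E.I x s (σ.mach σ.j).t (σ.mach σ.j).ph
            (σ.mach σ.j).q (σ.mach σ.j).bits) (target x (E.I.cfg x (σ.mach σ.j).t).mem i))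
          (bits := (σ.mach σ.j).bits) hS.base ⟨?_, ?_, ?_, ?_, ?_, ?_⟩
          (hS.ctl.congr fun r hr => g r (by omega)) hS.pos hS.bound ?_ ?_ ?_ ?_ (fun a ha => ?_)
          (fun j => ?_) ?_ hst hph (by simp [next, h0, hf, hnh, ho])
        · rw [g 4 (by norm_num), l1]
        · rw [g 5 (by norm_num), l2]
        · rw [g 10 (by norm_num), l3]
        · rw [g 11 (by norm_num), l4]
        · rw [g 12 (by norm_num), l5]
        · rw [g 13 (by norm_num), l6]
        · rw [hS.heap, ← layoutWith_self _ σ.j, hS.base, layoutWith_write]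
          intro d v hd
          have := ht d (target_mem_touched hd)
          omega
        · rw [h3]
          simp [RAM.cfg_succ, RAM.step_of_some hi', hS.pc]
        · rw [g 6 (by norm_num), hS.ph]
        · rw [g 7 (by norm_num), hS.q]
        · have := congrFun hwr (3 + a)
          rw [cell_mem ha, Function.update_of_ne (by omega)] at this
          exact this
        · have := congrFun hwr (3 + s + j)
          rw [cell_bits, Function.update_of_ne (by omega)] at this
          exact this
        · rw [g 8 (by norm_num), hS.digit, Function.update_eq_self]

/-- The words written by the simulated and the simulating machine. -/
lemma word_shift {R R' : ℕ → ℕ} {a b d e δ : ℕ} (hd : R' d = δ + R a) (he : R' e = δ + R b)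
    (hR : ∀ r, r ≤ R b → R a ≤ R b → R' (δ + r) = R r) : word k R' d e = word k R a b := by
  rw [word, word, hd, he, show δ + R b + 1 - (δ + R a) = R b + 1 - R a by omega,
    ← List.map_add_range', List.flatMap_map]
  refine List.flatMap_congr fun r hr => ?_
  rw [List.mem_range'_1] at hr
  rw [hR r (by omega) (by omega)]

lemma emission (hS : E.Sit x s p H V ts tp σ β C h) (hi : ∀ t, (E.I.cfg x t).hi < s)
    (hV : ∀ t a, H + (E.I.cfg x t).mem a ≤ V) (h2 : (σ.mach σ.j).ph = 2) (ho : E.I.OutputsAt k x (σ.mach σ.j).t) :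
    wp H x (dispatch emitCode downCode E.I.prog 0) (glue C h) (E.Post k x s p V ts tp σ) := by
  have h24 := hS.h24
  have f13 := hS.loaded.zero
  have f11 := hS.loaded.one
  obtain ⟨l1, l2, l3, l4, l5, l6⟩ := hS.loaded
  have hlen : 3 + s ≤ E.len s := by have := hS.pos; omega
  have hb := hS.bound
  obtain ⟨⟨a, b, hi'⟩, hop, hom⟩ := mem_eq_of_out ho
  set m := (E.I.cfg x (σ.mach σ.j).t).mem with hm
  have ht : ∀ r ∈ (Instr.output a b).touched m, r < s := fun r hr =>
    (touched_le_hi hi' hr).trans_lt (hi _)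
  have ha : a < s := ht a (by simp only [Instr.touched]; split_ifs <;> simp)
  have hb' : b < s := ht b (by simp only [Instr.touched]; split_ifs <;> simp)
  have hmb : m a ≤ m b → m b < s := fun hab => ht (m b) (by simp [Instr.touched, hab])
  have hmem : ∀ a < s, h (β + 3 + a) = m a := fun a ha => by
    rw [hS.heap, hS.base, layout, add_assoc, blocks_thd (by omega), cell_mem ha]
  have hemit : σ.emit = some (σ.mach σ.j).t := by simp [St.emit, h2]
  have hIemit : E.I.emit k x (σ.mach σ.j).t = some (word k m a b) := by
    simp [RAM.emit, hi', word, hm]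
  refine wp_dispatch h24 _ _ _ 0 (Nat.zero_le _) fun v => ?_
  rw [hS.pc, Nat.sub_zero, hi']
  show wp H x (emitCode (.output a b)) _ _
  have hva := hV (σ.mach σ.j).t a
  have hvb := hV (σ.mach σ.j).t b
  rw [← hm] at hva hvb
  -- The word is written after the state of the copy has been stored, thus read from the simulated
  -- memory one step later, which is the same memory.
  have hword : ∀ {σ' : St} {C' h' : ℕ → ℕ},
      σ'.mach = Function.update σ.mach σ.j { σ.mach σ.j with t := (σ.mach σ.j).t + 1, ph := 0 } →
      E.Rep x s p V 2 ts tp σ' C' h' → C' 22 = 24 + (β + 3) + m a → C' 23 = 24 + (β + 3) + m b →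
      word k (glue C' h') 22 23 = word k m a b := by
    intro σ' C' h' hσ' hrep e22 e23
    refine word_shift (δ := 24 + (β + 3)) (by rw [glue_low (by norm_num), e22])
      (by rw [glue_low (by norm_num), e23]) fun r hr hab => ?_
    have hr : r < s := hr.trans_lt (hmb hab)
    rw [add_assoc, glue_high, hrep.heap, hS.base, layout, add_assoc, add_assoc, ← add_assoc,
      blocks_thd (by omega), cell_mem hr, hσ']
    simp [hom]
  have key : ∀ C', (∀ r, 14 ≤ r → r < 22 → C' r = C r) → C' 3 = (E.I.cfg x (σ.mach σ.j).t).pc + 1 →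
      C' 4 = C 4 → C' 5 = C 5 → C' 6 = 0 → C' 7 = C 7 → C' 8 = C 8 → C' 10 = C 10 → C' 11 = C 11 →
      C' 12 = C 12 → C' 13 = C 13 → C' 22 = C 5 + m a → C' 23 = C 5 + m b →
      wp H x (br 18 11 (suffix (some (22, 23)) true)
        (seq (.add 18 19 13) <| seq (.add 17 16 13) <| suffix (some (22, 23)) false))
        (glue C' h) (E.Post k x s p V ts tp σ) := by
    intro C' g c3 c4 c5 c6 c7 c8 c10 c11 c12 c13 c22 c23
    rw [l2] at c22 c23
    -- If the simulated bounds of the output are in the wrong order, the word is empty and the two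
    -- addresses may lie outside the used memory. Hence registers 22 and 23 are bounded by `V` only.
    have hout : C' 22 ≤ C' 23 → C' 23 ≤ H := fun hle => by
      have := hmb (by omega)
      omega
    refine wp_br h24 (by norm_num) (by norm_num) (fun hj => ?_) fun hj => ?_
    · have hj : σ.j = 0 := by
        rw [g 18 (by norm_num) (by norm_num), hS.ctl.j, c11, l4] at hj
        omega
      have hst : σ.quit fun t => E.I.Halted (E.I.cfg x t) := quit_iff.2 ⟨hj, Or.inl h2⟩
      refine wp_suffix_rep (p := p) (V := V)
        (M' := { σ.mach σ.j with t := (σ.mach σ.j).t + 1, ph := 0 })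
        (σ' := { σ with
          mach := Function.update σ.mach σ.j
            { (σ.mach σ.j) with t := (σ.mach σ.j).t + 1, ph := 0 } })
        hS.base (q₀ := (σ.mach σ.j).q) ⟨by rw [c4, l1], by rw [c5, l2], by rw [c10, l3],
          by rw [c11, l4], by rw [c12, l5], by rw [c13, l6]⟩
        ⟨?_, ?_, ?_, ?_, ?_, ?_, ?_, ?_, ?_, ?_⟩ hS.pos hS.bound (Or.inr ⟨rfl, hout⟩)
        (hS.heap.trans (layoutWith_self _ σ.j).symm) (by rw [c3, hop]) c6 (by rw [c7, hS.q])
        (fun a ha => by rw [cell_mem ha, hom]) (fun i => cell_bits i)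
        (by rw [c8, hS.digit, Function.update_eq_self]) rfl
        fun C'' h' hrep e22 e23 => ⟨by simp [hst], ?_, by simp⟩
      · rw [g 14 (by norm_num) (by norm_num), hS.ctl.stage]
      · rw [g 15 (by norm_num) (by norm_num), hS.ctl.space]
      · rw [g 16 (by norm_num) (by norm_num), hS.ctl.turn]
      · rw [g 17 (by norm_num) (by norm_num), hS.ctl.fuel]
      · rw [g 18 (by norm_num) (by norm_num), hS.ctl.j]
      · rw [g 19 (by norm_num) (by norm_num), hS.ctl.K]
      · rw [g 20 (by norm_num) (by norm_num), hS.ctl.off]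
      · rw [g 21 (by norm_num) (by norm_num), hS.ctl.len]
      · omega
      · omega
      · rw [hemit, Option.bind_some, hIemit]
        exact congrArg some (hword rfl hrep (by rw [e22, c22]) (by rw [e23, c23]))
    · have hj : σ.j ≠ 0 := by
        rw [g 18 (by norm_num) (by norm_num), hS.ctl.j, c11, l4] at hj
        omega
      have hst : ¬ σ.quit fun t => E.I.Halted (E.I.cfg x t) := by rw [quit_iff]; simp [hj]
      have hnext : next (E.I.OutputsAt k x) (fun t => E.I.Halted (E.I.cfg x t)) (8 * (p + 2)) σ =
          σ.emission (8 * (p + 2)) := by simp [next, h2]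
      refine wp_add h24 (by norm_num) (by norm_num) (by norm_num) <|
        wp_add h24 (by norm_num) (by norm_num) (by norm_num) <|
        wp_suffix_rep (p := p) (V := V)
        (M' := { (σ.mach σ.j) with t := (σ.mach σ.j).t + 1, ph := 0 })
        (σ' := σ.emission (8 * (p + 2)))
        hS.base (q₀ := (σ.mach σ.j).q) ⟨by simp [c4, l1], by simp [c5, l2], by simp [c10, l3],
          by simp [c11, l4], by simp [c12, l5], by simp [c13, l6]⟩
        ⟨?_, ?_, ?_, ?_, ?_, ?_, ?_, ?_, ?_, ?_⟩ hS.pos hS.bound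
        (Or.inr ⟨rfl, by simpa using hout⟩)
        (hS.heap.trans (layoutWith_self _ σ.j).symm) (by simp [c3, hop]) (by simpa using c6)
        (by simp [c7, hS.q])
        (fun a ha => by rw [cell_mem ha, hom]) (fun i => cell_bits i)
        (by simp [c8, hS.digit]) rfl
        fun C'' h' hrep e22 e23 => ⟨by simp [hst], ?_, fun _ => ⟨C'', h', rfl, hnext ▸ hrep⟩⟩
      · simp [g, hS.ctl.stage]
      · simp [g, hS.ctl.space]
      · simp [g, hS.ctl.turn]
      · simp [g, hS.ctl.turn, c13, l6, St.emission]
      · simp [g, hS.ctl.K, c13, l6, St.emission]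
      · simp [g, hS.ctl.K, St.emission]
      · simp [g, hS.ctl.off]
      · simp [g, hS.ctl.len]
      · simp; omega
      · simp; omega
      · rw [hemit, Option.bind_some, hIemit]
        refine congrArg some (hword rfl hrep ?_ ?_)
        · simpa [c22] using e22
        · simpa [c23] using e23
  refine wp_fetch h24 (β := β + 3) (by norm_num) (by simpa using l2) (hmem a ha) (by omega)
    fun w₁ => wp_fetch h24 (β := β + 3) (by norm_num) (by simpa using l2) (hmem b hb') (by omega)
    fun w₂ => wp_add h24 (by norm_num) (by norm_num) (by norm_num) <|
    wp_add h24 (by norm_num) (by norm_num) (by norm_num) <|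
    wp_add h24 (by norm_num) (by norm_num) (by norm_num) <|
    wp_add h24 (by norm_num) (by norm_num) (by norm_num) <|
    key _ (fun r hr hr' => ?_) ?_ ?_ ?_ ?_ ?_ ?_ ?_ ?_ ?_ ?_ ?_ ?_
  · simp only [Function.update_apply]
    repeat rw [if_neg (by omega)]
  all_goals simp [hS.pc, f11, f13]

end Sit
end Setup

namespace Setup
open Code Amortization

variable {E : Setup} {x : List ℕ} {k s p H V ts tp : ℕ} {σ : St} {C h : ℕ → ℕ}

/-- The third stage: one unit of work of the amortized enumerator. -/
lemma wp_stage_two {N : ℕ} (hrep : E.Rep x s p V 2 ts tp σ C h)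
    (hI : Inv (E.I.OutputsAt k x) (fun t => E.I.Halted (E.I.cfg x t)) p N σ)
    (hi : ∀ t, (E.I.cfg x t).hi < s) (hV : ∀ t a, H + (E.I.cfg x t).mem a ≤ V)
    (hK : σ.K < E.ck * s) (hH : 24 + (E.l₁ s + E.l₂ s + (σ.K + 1) * E.len s) ≤ H) :
    wp H x E.body (glue C h) (E.Post k x s p V ts tp σ) := by
  have hj := hI.j_le
  have hM := hI.mach σ.j
  have hq := hM.q_le
  have hctl := hrep.ctl
  have hlen : E.len s = 3 + s + E.ck * s := by simp only [len]; ring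
  have hb : 24 + (E.l₁ s + E.l₂ s + σ.j * E.len s + E.len s) ≤ H := by
    have := Nat.mul_le_mul_right (E.len s) (Nat.succ_le_succ hj)
    rw [Nat.succ_mul] at this
    simp only [Nat.succ_eq_add_one] at this
    omega
  set β := E.l₁ s + E.l₂ s + σ.j * E.len s with hβ
  have h24 : 24 ≤ H := by omega
  have hcell : ∀ o < E.len s, h (β + o) =
      cell E.I x s (σ.mach σ.j).t (σ.mach σ.j).ph (σ.mach σ.j).q (σ.mach σ.j).bits o := fun o ho => by
    rw [hrep.heap, layout, hβ, blocks_thd ho]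
  refine wp_body (β := β) (by omega) hrep.low (by rw [hctl.off, hctl.j, hctl.len])
    fun C' g c3 c4 c5 c11 c12 c13 => ?_
  have hctl := hctl.congr g
  refine wp_br h24 (by norm_num) (by norm_num)
    (fun hlt => by rw [hctl.stage, c11] at hlt; omega) fun _ => ?_
  refine wp_br h24 (by norm_num) (by norm_num)
    (fun hlt => by rw [hctl.stage, c12] at hlt; omega) fun _ => ?_
  have key : ∀ C'', E.Sit x s p H V ts tp σ β C'' h → wp H x
      (br 6 12 (br 13 17 (br 13 6 carryCode E.runCode) downCode)
        (br 12 6 downCode (dispatch emitCode downCode E.I.prog 0))) (glue C'' h)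
      (E.Post k x s p V ts tp σ) := by
    intro C'' hS
    have f13 := hS.loaded.zero
    have f12 := hS.loaded.two
    have hdown : (σ.mach σ.j).ph = 3 ∨ (σ.mach σ.j).ph < 2 ∧ σ.f = 0 →
        wp H x downCode (glue C'' h) (E.Post k x s p V ts tp σ) := by
      intro hd
      have := hS.down (k := k) (by rw [quit_iff]; omega) (by omega) (by
        rcases hd with hd | ⟨hd, hf⟩
        · simp [next, hd]
        · simp [next, hf, show (σ.mach σ.j).ph ≠ 2 by omega]) (C'' 0)
      rwa [Function.update_eq_self] at this
    refine wp_br h24 (by norm_num) (by norm_num) (fun h2 => ?_) fun h2 => ?_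
    · rw [hS.ph, f12] at h2
      refine wp_br h24 (by norm_num) (by norm_num) (fun hf => ?_) fun hf => ?_
      · rw [f13, hS.ctl.fuel] at hf
        refine wp_br h24 (by norm_num) (by norm_num) (fun h1 => ?_) fun h1 => ?_
        · rw [f13, hS.ph] at h1
          exact hS.carry hI (by omega) hf.ne'
        · rw [f13, hS.ph] at h1
          exact hS.run hi (by omega) hf.ne'
      · rw [f13, hS.ctl.fuel] at hf
        exact hdown (Or.inr ⟨h2, by omega⟩)
    · rw [hS.ph, f12] at h2
      refine wp_br h24 (by norm_num) (by norm_num) (fun h3 => ?_) fun h3 => ?_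
      · rw [hS.ph, f12] at h3
        have := hM.ph_le
        exact hdown (Or.inl (by omega))
      · rw [hS.ph, f12] at h3
        have h2 : (σ.mach σ.j).ph = 2 := by omega
        exact hS.emission hi hV h2 (hM.pend h2).1
  refine wp_add h24 (by norm_num) (by norm_num) (by norm_num) <|
    wp_load (o := β + 1) h24 (by norm_num) (by norm_num) (by simp [c4, c11, add_assoc])
      (by omega) <|
    wp_add h24 (by norm_num) (by norm_num) (by norm_num) <|
    wp_load (o := β + 2) h24 (by norm_num) (by norm_num) (by simp [c4, c12, add_assoc])
      (by omega) <|
    wp_add h24 (by norm_num) (by norm_num) (by norm_num) <|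
    wp_add h24 (by norm_num) (by norm_num) (by norm_num) <|
    wp_load (o := β + (3 + s + σ.j)) h24 (by norm_num) (by norm_num)
      (by simp [c5, hctl.space, hctl.j]; omega) (by omega) <|
    wp_add h24 (by norm_num) (by norm_num) (by norm_num) <|
    wp_load (o := β + (3 + s + (σ.mach σ.j).q)) h24 (by norm_num) (by norm_num)
      (by simp [c5, hctl.space, hcell 2 (by omega)]; omega) (by omega) <| key _ ?_
  refine ⟨hβ, hb, ⟨?_, ?_, ?_, ?_, ?_, ?_⟩, hctl.congr fun r hr => ?_, by omega, hrep.heap,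
    ?_, ?_, ?_, ?_, ?_⟩
  · simp [c4]
  · simp [c5]
  · simp [c5, hctl.space, hcell 2 (by omega)]; omega
  · simp [c11]
  · simp [c12]
  · simp [c13]
  · simp only [Function.update_apply]
    repeat rw [if_neg (by omega)]
  · have := hcell 0 (by omega)
    simpa [c3] using this
  · simp [hcell 1 (by omega)]
  · simp [hcell 2 (by omega)]
  · simp [hcell (3 + s + (σ.mach σ.j).q) (by omega), cell_bits]
  · simp [hcell (3 + s + σ.j) (by omega), cell_bits]

end Setup

/-! ### Polynomial bounds, sizes of integers, time and space -/

/-- Functions that are bounded by a polynomial. -/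
def PolyBdd (f : ℕ → ℕ) : Prop := ∃ c, ∀ n, f n ≤ (n + 2) ^ c

namespace PolyBdd
variable {f g : ℕ → ℕ}

lemma mono (hg : PolyBdd g) (h : ∀ n, f n ≤ g n) : PolyBdd f :=
  hg.imp fun _ hc n => (h n).trans (hc n)

lemma const (a : ℕ) : PolyBdd fun _ => a :=
  ⟨a, fun n => Nat.lt_two_pow_self.le.trans (Nat.pow_le_pow_left (by omega) a)⟩

lemma id : PolyBdd fun n => n := ⟨1, fun n => by simp⟩

lemma add (hf : PolyBdd f) (hg : PolyBdd g) : PolyBdd fun n => f n + g n := by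
  obtain ⟨c, hc⟩ := hf
  obtain ⟨d, hd⟩ := hg
  refine ⟨c + d + 1, fun n => ?_⟩
  have h1 : (n + 2) ^ c ≤ (n + 2) ^ (c + d) := Nat.pow_le_pow_right (by omega) (by omega)
  have h2 : (n + 2) ^ d ≤ (n + 2) ^ (c + d) := Nat.pow_le_pow_right (by omega) (by omega)
  have := hc n
  have := hd n
  calc f n + g n ≤ (n + 2) ^ (c + d) * 2 := by omega
    _ ≤ (n + 2) ^ (c + d) * (n + 2) := Nat.mul_le_mul_left _ (by omega)
    _ = _ := (pow_succ _ _).symm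

lemma mul (hf : PolyBdd f) (hg : PolyBdd g) : PolyBdd fun n => f n * g n := by
  obtain ⟨c, hc⟩ := hf
  obtain ⟨d, hd⟩ := hg
  exact ⟨c + d, fun n => by rw [pow_add]; exact Nat.mul_le_mul (hc n) (hd n)⟩

lemma pow (hf : PolyBdd f) (a : ℕ) : PolyBdd fun n => f n ^ a := by
  obtain ⟨c, hc⟩ := hf
  exact ⟨c * a, fun n => by rw [pow_mul]; exact Nat.pow_le_pow_left (hc n) a⟩

lemma eval (q : Polynomial ℕ) : PolyBdd fun n => q.eval n := by
  induction q using Polynomial.induction_on' with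
  | add p q hp hq => simpa using hp.add hq
  | monomial a b => simpa using (const b).mul (id.pow a)

lemma exists_polynomial (hf : PolyBdd f) : ∃ q : Polynomial ℕ, ∀ n, f n < q.eval n := by
  obtain ⟨c, hc⟩ := hf
  exact ⟨(Polynomial.X + 2) ^ c + 1, fun n => by simpa [Nat.lt_succ_iff] using hc n⟩

end PolyBdd

lemma one_le_intSize (v : ℕ) : 1 ≤ intSize v := le_max_left _ _

lemma intSize_mono {v w : ℕ} (h : v ≤ w) : intSize v ≤ intSize w :=
  max_le_max le_rfl (Nat.size_le_size h)

lemma intSize_le {v m : ℕ} (hm : 1 ≤ m) (h : v < 2 ^ m) : intSize v ≤ m :=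
  max_le hm (Nat.size_le.2 h)

lemma lt_two_pow_intSize (v : ℕ) : v < 2 ^ intSize v :=
  (Nat.lt_size_self v).trans_le (Nat.pow_le_pow_right (by norm_num) (le_max_right _ _))

/-- Based on n + 2 ≤ 2 ^ (log n + 2): a polynomial number has O(log n) digits, with log n + 1 in
place of log n so that small inputs are covered. -/
lemma intSize_le_log {n c v : ℕ} (h : v ≤ (n + 2) ^ c) :
    intSize v ≤ (2 * c + 1) * (Nat.log 2 n + 1) := by
  refine intSize_le (Nat.mul_pos (by omega) (by omega)) (h.trans_lt ?_)
  have h1 : n + 2 ≤ 2 ^ (Nat.log 2 n + 2) := by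
    have := Nat.lt_pow_succ_log_self (b := 2) (by norm_num) n
    have h2 : 1 ≤ 2 ^ Nat.log 2 n := Nat.one_le_two_pow
    simp only [Nat.succ_eq_add_one, pow_succ] at this ⊢
    omega
  calc (n + 2) ^ c ≤ (2 ^ (Nat.log 2 n + 2)) ^ c := Nat.pow_le_pow_left h1 c
    _ = 2 ^ ((Nat.log 2 n + 2) * c) := (pow_mul _ _ _).symm
    _ < 2 ^ ((2 * c + 1) * (Nat.log 2 n + 1)) := by
      refine Nat.pow_lt_pow_right (by norm_num) ?_
      nlinarith [Nat.zero_le (Nat.log 2 n * c)]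

/-- The constant or jump target that an instruction copies to a register or to the program
counter. -/
def Instr.num : Instr → ℕ
  | .const _ v => v
  | .jmp l => l
  | .jlt _ _ l => l
  | _ => 0

namespace RAM

def maxNum (M : RAM) : ℕ := (M.prog.map Instr.num).sum

lemma num_le_maxNum {M : RAM} {i : Instr} (h : i ∈ M.prog) : i.num ≤ M.maxNum :=
  List.le_sum_of_mem (List.mem_map_of_mem h)

lemma pc_le (M : RAM) (x : List ℕ) (t : ℕ) : (M.cfg x t).pc ≤ M.prog.length + M.maxNum := by
  induction t with
  | zero => simp [cfg]
  | succ t ih =>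
    rw [cfg_succ]
    cases h : M.prog[(M.cfg x t).pc]? with
    | none => simpa [step, h] using ih
    | some i =>
      rw [step_of_some h]
      have h1 := num_le_maxNum (List.mem_of_getElem? h)
      have h2 := (List.getElem?_eq_some_iff.1 h).1
      cases i <;> simp only [Instr.newPc, Instr.num] at h1 ⊢ <;> (try split_ifs) <;> omega

/-- An untouched register keeps its initial value, and every register written to counts as touched.
-/
lemma mem_of_hi_lt (M : RAM) (x : List ℕ) (t : ℕ) :
    ∀ a, (M.cfg x t).hi < a → (M.cfg x t).mem a = 0 := by
  induction t with
  | zero => intro a _; rfl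
  | succ t ih =>
    intro a ha
    have hmono := hi_mono M x (Nat.le_succ t)
    cases h : M.prog[(M.cfg x t).pc]? with
    | none =>
      rw [cfg_succ, step_of_halted (Or.inl h)] at ha ⊢
      exact ih a ha
    | some i =>
      have h1 : ∀ r ∈ i.touched (M.cfg x t).mem, r < a := fun r hr =>
        (Code.touched_le_hi h hr).trans_lt ha
      rw [cfg_succ, step_of_some h, Code.newMem_eq]
      have h2 := ih a (hmono.trans_lt ha)
      cases ht : Code.target x (M.cfg x t).mem i with
      | none => exact h2
      | some dv =>
        have := h1 _ (Code.target_mem_touched ht)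
        simp only
        rw [Function.update_of_ne (by omega), h2]

/-- Register contents grow slowly: a new value is a constant of the program, the length of the
input, a letter, or obtained from two old values. -/
lemma target_le {x : List ℕ} {k V : ℕ} {R : ℕ → ℕ} {i : Instr} {d v : ℕ}
    (hx : ∀ a, x.getD a 0 ≤ k) (hV : ∀ a ∈ i.args x.length R, a ≤ V)
    (h : Code.target x R i = some (d, v)) : v ≤ max k (max (2 * V) (V * V)) := by
  have h2 : V ≤ 2 * V := by omega
  have h3 : 2 * V ≤ max (2 * V) (V * V) := le_max_left _ _
  have h4 : V * V ≤ max (2 * V) (V * V) := le_max_right _ _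
  have h1 : max (2 * V) (V * V) ≤ max k (max (2 * V) (V * V)) := le_max_right _ _
  cases i <;> simp only [Code.target, Option.some.injEq, Prod.mk.injEq, reduceCtorEq] at h <;>
    simp only [Instr.args, List.forall_mem_cons] at hV <;> obtain ⟨rfl, rfl⟩ := h
  · omega
  · omega
  · exact (hx _).trans (le_max_left _ _)
  · omega
  · omega
  · exact (Nat.mul_le_mul hV.1 hV.2.1).trans (h4.trans h1)
  · omega
  · omega

lemma arg_lt_of_cost_le {n c : ℕ} {R : ℕ → ℕ} {i : Instr} (h : i.cost n R ≤ c) {v : ℕ}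
    (hv : v ∈ i.args n R) : v ≤ (2 * (n + 1)) ^ c := by
  have h1 : intSize v ≤ ((i.args n R).map intSize).sum :=
    List.le_sum_of_mem (List.mem_map_of_mem hv)
  have h2 : ((i.args n R).map intSize).sum < (Nat.log 2 n + 1) * c := by
    rw [Instr.cost] at h
    rw [mul_comm]
    exact (Nat.div_lt_iff_lt_mul (by omega)).1 (by omega)
  have h3 : 2 ^ (Nat.log 2 n + 1) ≤ 2 * (n + 1) := by
    rw [pow_succ, mul_comm]
    rcases eq_or_ne n 0 with rfl | hn
    · simp
    · have := Nat.pow_log_le_self 2 hn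
      omega
  calc v ≤ 2 ^ intSize v := (lt_two_pow_intSize v).le
    _ ≤ 2 ^ ((Nat.log 2 n + 1) * c) := Nat.pow_le_pow_right (by norm_num) (by omega)
    _ = (2 ^ (Nat.log 2 n + 1)) ^ c := pow_mul _ _ _
    _ ≤ _ := Nat.pow_le_pow_left h3 c

/-- The bound does not accumulate over time: each value was written by one instruction, whose
arguments are polynomial because its cost is bounded, and the result is at most a letter, the double
or the square of the bound for the arguments. -/
lemma mem_le_of_stepCost_le {M : RAM} {x : List ℕ} {k c : ℕ} (hx : ∀ a, x.getD a 0 ≤ k)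
    (hc : ∀ t, M.stepCost x t ≤ c) (t a : ℕ) :
    (M.cfg x t).mem a ≤ k + (2 * (x.length + 1)) ^ (2 * c + 1) := by
  induction t generalizing a with
  | zero => simp [cfg]
  | succ t ih =>
    rw [cfg_succ]
    cases h : M.prog[(M.cfg x t).pc]? with
    | none => simpa [step, h] using ih a
    | some i =>
      rw [step_of_some h, Code.newMem_eq]
      cases ht : Code.target x (M.cfg x t).mem i with
      | none => exact ih a
      | some dv =>
        rcases eq_or_ne a dv.1 with rfl | hne
        · simp only [Function.update_self]
          have hct := hc t
          simp only [stepCost, h] at hct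
          refine (target_le hx (fun v hv => arg_lt_of_cost_le hct hv) ht).trans ?_
          have h1 : 2 ≤ 2 * (x.length + 1) := by omega
          set b := 2 * (x.length + 1)
          have h2 : b ^ c * b ^ c ≤ b ^ (2 * c + 1) := by
            rw [← pow_add]; exact Nat.pow_le_pow_right (by omega) (by omega)
          have h3 : 2 * b ^ c ≤ b ^ (2 * c + 1) := by
            calc 2 * b ^ c ≤ b * b ^ c := Nat.mul_le_mul_right _ h1
              _ = b ^ (c + 1) := by rw [pow_succ, mul_comm]
              _ ≤ _ := Nat.pow_le_pow_right (by omega) (by omega)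
          omega
        · simp only
          rw [Function.update_of_ne hne]
          exact ih a

lemma polyBdd_mem (k c : ℕ) : PolyBdd fun n => k + (2 * (n + 1)) ^ (2 * c + 1) :=
  (PolyBdd.const k).add (((PolyBdd.const 2).mul (PolyBdd.id.add (.const 1))).pow _)

/-- The number of steps is at most the time. -/
lemma le_time (M : RAM) (x : List ℕ) (t : ℕ) : t ≤ M.time x t := by
  rw [time]
  calc t = ∑ u ∈ Finset.range t, 1 := by simp
    _ ≤ _ := Finset.sum_le_sum fun u _ => by
      unfold stepCost
      split
      · rfl
      · simp [Instr.cost]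

lemma time_add_le {M : RAM} {x : List ℕ} {c : ℕ} (hc : ∀ t, M.stepCost x t ≤ c) (t u : ℕ) :
    M.time x (t + u) ≤ M.time x t + u * c := by
  rw [time, time, Finset.sum_range_add]
  gcongr
  exact (Finset.sum_le_sum fun v _ => hc (t + v)).trans (by simp)

/-- Every integer has size at least 1, including those in the input registers. -/
lemma hi_lt_of_space_le {M : RAM} {x : List ℕ} {t S : ℕ} (h : M.space x t ≤ S) :
    x.length + (M.cfg x t).hi < S := by
  have h1 : x.length ≤ (x.map intSize).sum := by
    clear h
    induction x with
    | nil => simp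
    | cons a x ih => have := one_le_intSize a; simp; omega
  have h2 : (M.cfg x t).hi + 1 ≤
      ∑ i ∈ Finset.range ((M.cfg x t).hi + 1), intSize ((M.cfg x t).mem i) := by
    calc _ = ∑ i ∈ Finset.range ((M.cfg x t).hi + 1), 1 := by simp
      _ ≤ _ := Finset.sum_le_sum fun i _ => one_le_intSize _
  rw [space] at h
  omega

/-- The size of the contents of an initial part of the memory. -/
lemma sum_intSize_mem_le {M : RAM} {x : List ℕ} {t S : ℕ} (h : M.space x t ≤ S) (m : ℕ) :
    ∑ a ∈ Finset.range m, intSize ((M.cfg x t).mem a) ≤ S + m := by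
  calc ∑ a ∈ Finset.range m, intSize ((M.cfg x t).mem a)
      ≤ ∑ a ∈ Finset.range ((M.cfg x t).hi + 1 + m), intSize ((M.cfg x t).mem a) :=
        Finset.sum_le_sum_of_subset (Finset.range_mono (by omega))
    _ = ∑ a ∈ Finset.range ((M.cfg x t).hi + 1), intSize ((M.cfg x t).mem a) + m := by
        rw [Finset.sum_range_add]
        congr 1
        calc _ = ∑ a ∈ Finset.range m, 1 := Finset.sum_congr rfl fun a _ => by
              rw [mem_of_hi_lt _ _ _ _ (by omega)]; rfl
          _ = m := by simp
    _ ≤ S + m := by rw [space] at h; omega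

/-- In `u` steps, a bound for the register contents is squared `u` times. -/
lemma mem_le_pow {M : RAM} {x : List ℕ} {k V t : ℕ} (hx : ∀ a, x.getD a 0 ≤ k)
    (hn : x.length ≤ V) (hk : k ≤ V) (hM : M.maxNum ≤ V) (h2 : 2 ≤ V)
    (hV : ∀ a, (M.cfg x t).mem a ≤ V) (u : ℕ) : ∀ a, (M.cfg x (t + u)).mem a ≤ V ^ 2 ^ u := by
  induction u with
  | zero => simpa using hV
  | succ u ih =>
    intro a
    have hle : V ≤ V ^ 2 ^ u := Nat.le_self_pow (by positivity) V
    have hsq : V ^ 2 ^ (u + 1) = V ^ 2 ^ u * V ^ 2 ^ u := by rw [pow_succ, pow_mul, sq]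
    have h4 : 2 * V ^ 2 ^ u ≤ V ^ 2 ^ u * V ^ 2 ^ u := Nat.mul_le_mul_right _ (by omega)
    rw [← add_assoc, cfg_succ, hsq]
    cases h : M.prog[(M.cfg x (t + u)).pc]? with
    | none => rw [step_of_halted (Or.inl h)]; exact (ih a).trans (by omega)
    | some i =>
      have h1 := num_le_maxNum (List.mem_of_getElem? h)
      rw [step_of_some h, Code.newMem_eq]
      cases ht : Code.target x (M.cfg x (t + u)).mem i with
      | none => exact (ih a).trans (by omega)
      | some dv =>
        rcases eq_or_ne a dv.1 with rfl | hne
        · simp only [Function.update_self]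
          refine (target_le (V := V ^ 2 ^ u) hx (fun v hv => ?_) ht).trans (by omega)
          have ih' := ih
          cases i <;> simp only [Instr.args, Instr.num, List.mem_cons, List.not_mem_nil, or_false]
            at hv h1 <;> (try rcases hv with rfl | rfl) <;>
            first | exact ih _ | omega
        · simp only
          rw [Function.update_of_ne hne]
          exact (ih a).trans (by omega)

lemma args_le {x : List ℕ} {V : ℕ} {R : ℕ → ℕ} {i : Instr} (hn : x.length ≤ V)
    (hi : i.num ≤ V) (hV : ∀ a, R a ≤ V) : ∀ v ∈ i.args x.length R, v ≤ V := by
  intro v hv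
  cases i <;> simp only [Instr.args, Instr.num, List.mem_cons, List.not_mem_nil, or_false]
    at hv hi <;> (try rcases hv with rfl | rfl) <;> first | exact hV _ | omega

lemma stepCost_le {M : RAM} {x : List ℕ} {V c t : ℕ} (hn : x.length ≤ V)
    (hM : M.maxNum ≤ V) (hV : ∀ a, (M.cfg x t).mem a ≤ V) (hc : V ≤ (x.length + 2) ^ c) :
    M.stepCost x t ≤ 1 + 2 * (2 * c + 1) := by
  unfold stepCost
  cases h : M.prog[(M.cfg x t).pc]? with
  | none => simp
  | some i =>
    have h1 := args_le hn ((num_le_maxNum (List.mem_of_getElem? h)).trans hM) hV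
    simp only [Instr.cost, add_le_add_iff_left]
    have h2 : ((i.args x.length (M.cfg x t).mem).map intSize).sum ≤
        (i.args x.length (M.cfg x t).mem).length * ((2 * c + 1) * (Nat.log 2 x.length + 1)) := by
      have := List.sum_le_card_nsmul ((i.args x.length (M.cfg x t).mem).map intSize)
        ((2 * c + 1) * (Nat.log 2 x.length + 1)) (fun v hv => by
          obtain ⟨w, hw, rfl⟩ := List.mem_map.1 hv
          exact intSize_le_log ((h1 w hw).trans hc))
      simpa using this
    have h3 : (i.args x.length (M.cfg x t).mem).length ≤ 2 := by cases i <;> simp [Instr.args]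
    refine Nat.div_le_of_le_mul (h2.trans ?_)
    calc _ ≤ 2 * ((2 * c + 1) * (Nat.log 2 x.length + 1)) := Nat.mul_le_mul_right _ h3
      _ = _ := by ring

/-- The size of the memory contents grows by at most the size of one value in each step. -/
lemma sum_intSize_add_le {M : RAM} {x : List ℕ} {V t H : ℕ} (u : ℕ)
    (hV : ∀ v ≤ u, ∀ a, (M.cfg x (t + v)).mem a ≤ V) :
    ∑ a ∈ Finset.range H, intSize ((M.cfg x (t + u)).mem a) ≤
      ∑ a ∈ Finset.range H, intSize ((M.cfg x t).mem a) + u * intSize V := by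
  induction u with
  | zero => simp
  | succ u ih =>
    have ih := ih fun v hv => hV v (by omega)
    have hu := hV (u + 1) le_rfl
    rw [← add_assoc] at hu ⊢
    suffices h : ∑ a ∈ Finset.range H, intSize ((M.cfg x (t + u + 1)).mem a) ≤
        ∑ a ∈ Finset.range H, intSize ((M.cfg x (t + u)).mem a) + intSize V by
      rw [Nat.succ_mul]; omega
    have hval : ∃ d, ∀ a, a ≠ d → (M.cfg x (t + u + 1)).mem a = (M.cfg x (t + u)).mem a := by
      rw [cfg_succ]
      cases h : M.prog[(M.cfg x (t + u)).pc]? with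
      | none => exact ⟨0, fun a _ => by rw [step_of_halted (Or.inl h)]⟩
      | some i =>
        rw [step_of_some h, Code.newMem_eq]
        cases ht : Code.target x (M.cfg x (t + u)).mem i with
        | none => exact ⟨0, fun a _ => rfl⟩
        | some dv => exact ⟨dv.1, fun a ha => Function.update_of_ne ha _ _⟩
    obtain ⟨d, hd⟩ := hval
    calc ∑ a ∈ Finset.range H, intSize ((M.cfg x (t + u + 1)).mem a)
        ≤ ∑ a ∈ Finset.range H, (intSize ((M.cfg x (t + u)).mem a) +
            if a = d then intSize V else 0) := Finset.sum_le_sum fun a _ => by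
          split_ifs with h
          · exact (intSize_mono (hu a)).trans (Nat.le_add_left _ _)
          · rw [hd a h]; simp
      _ ≤ _ := by
          rw [Finset.sum_add_distrib, Finset.sum_ite_eq']
          split_ifs <;> omega

end RAM

/-! ### Outputs of an enumerator and their number -/

open Amortization

namespace RAM

variable {k : ℕ} {M : RAM} {x : Word k} {A : EnumProblem k} {t : ℕ}

lemma Halted.not_out {M : RAM} {x : List ℕ} {t u : ℕ} (h : M.Halted (M.cfg x t)) (hu : t ≤ u) :
    ¬ M.OutputsAt k x u :=
  not_outputsAt_of_halted (by rwa [cfg_of_halted_le h hu])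

lemma Halted.lt_of_out {M : RAM} {x : List ℕ} {t u : ℕ} (h : M.Halted (M.cfg x t))
    (hu : M.OutputsAt k x u) : u < t := not_le.1 fun hle => h.not_out hle hu

/-- The number of solutions is the number of output steps. -/
lemma Solves.cnt_eq (hM : M.Solves A) (h : M.Halted (M.cfg x.code t)) :
    cnt (M.OutputsAt k x.code) t = M.count x := by
  classical
  have h1 : M.outputs x = (fun u => (M.emit k x.code u).getD []) ''
      {u | u < t ∧ M.OutputsAt k x.code u} := by
    ext y
    constructor
    · rintro ⟨u, hu⟩
      have ho : M.OutputsAt k x.code u := by simp [OutputsAt, hu]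
      exact ⟨u, ⟨h.lt_of_out ho, ho⟩, by simp [hu]⟩
    · rintro ⟨u, ⟨-, hu⟩, rfl⟩
      obtain ⟨y, hy⟩ := Option.isSome_iff_exists.1 hu
      exact ⟨u, by simp [hy]⟩
  rw [count, h1, Set.InjOn.ncard_image, cnt, Nat.count_eq_card_filter_range,
    ← Set.ncard_coe_finset]
  · congr 1
    ext u
    simp
  · rintro u ⟨-, hu⟩ v ⟨-, hv⟩ e
    obtain ⟨y, hy⟩ := Option.isSome_iff_exists.1 hu
    obtain ⟨z, hz⟩ := Option.isSome_iff_exists.1 hv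
    refine hM.no_repeat x u v hu ?_
    simp only [hy, hz, Option.getD_some] at e
    rw [hy, hz, e]

lemma Solves.cnt_le (hM : M.Solves A) (t : ℕ) : cnt (M.OutputsAt k x.code) t ≤ M.count x := by
  obtain ⟨u, hu⟩ := hM.halts x
  have h1 : M.Halted (M.cfg x.code (u + t)) := by rwa [cfg_add_of_halted hu]
  rw [← hM.cnt_eq h1]
  exact cnt_mono (by omega)

section
open Classical

lemma Solves.nth_mem (hM : M.Solves A) {i : ℕ} (hi : i < M.count x) :
    M.OutputsAt k x.code (Nat.nth (M.OutputsAt k x.code) i) ∧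
      cnt (M.OutputsAt k x.code) (Nat.nth (M.OutputsAt k x.code) i) = i := by
  obtain ⟨u, hu⟩ := hM.halts x
  have hcard : ∀ hf : (Set.ofPred (M.OutputsAt k x.code)).Finite, i < hf.toFinset.card := fun hf => by
    rw [← hM.cnt_eq hu, cnt, Nat.count_eq_card_filter_range] at hi
    refine hi.trans_le (Finset.card_le_card fun v hv => ?_)
    exact hf.mem_toFinset.2 (Finset.mem_filter.1 hv).2
  exact ⟨Nat.nth_mem i hcard, Nat.count_nth hcard⟩

/-- If there are at most `i` outputs before time `t`, then the next one comes at `t` or later. -/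
lemma Solves.le_nth (hM : M.Solves A) {i : ℕ} (hi : i < M.count x)
    (h : cnt (M.OutputsAt k x.code) t ≤ i) : t ≤ Nat.nth (M.OutputsAt k x.code) i := by
  by_contra! hlt
  have h1 := cnt_succ_of_out (hM.nth_mem hi).1
  rw [(hM.nth_mem hi).2] at h1
  have := cnt_mono (Out := M.OutputsAt k x.code) (Nat.succ_le_of_lt hlt)
  simp only [Nat.succ_eq_add_one] at this
  omega

lemma Solves.nth_le (hM : M.Solves A) {i : ℕ} (h : M.OutputsAt k x.code t)
    (hi : i ≤ cnt (M.OutputsAt k x.code) t) : Nat.nth (M.OutputsAt k x.code) i ≤ t := by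
  have h2 : Nat.nth (M.OutputsAt k x.code) (cnt (M.OutputsAt k x.code) t) = t := Nat.nth_count h
  have h3 := cnt_succ_of_out h
  have h4 := hM.cnt_le (x := x) (t + 1)
  by_contra! hlt
  have h5 := hM.nth_mem (x := x) (i := i) (by omega)
  have h6 := cnt_mono (Out := M.OutputsAt k x.code) (Nat.succ_le_of_lt hlt)
  simp only [Nat.succ_eq_add_one] at h6
  omega

/-- An enumerator with incremental delay `p`. -/
lemma Solves.stream (hM : M.Solves A) {p : ℕ → ℕ} (hp : M.HasIncrementalDelay k p) :
    Stream (M.OutputsAt k x.code) (fun t => M.Halted (M.cfg x.code t)) (p x.length)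
      (M.count x) where
  halt_not_out t h := h.not_out le_rfl
  cnt_le := hM.cnt_le
  cnt_halt t h := hM.cnt_eq h
  halts := hM.halts x
  halt_mono t t' h ht := by
    show M.Halted _
    rwa [cfg_of_halted_le ht h]
  le_of_not_halt t ht hN := by
    have hlt : cnt (M.OutputsAt k x.code) t < M.count x := by
      by_contra! hge
      have hi : M.count x - 1 < M.count x := by omega
      obtain ⟨h1, h2⟩ := hM.nth_mem hi
      set u := Nat.nth (M.OutputsAt k x.code) (M.count x - 1) with hu
      have h3 : u < t := by
        by_contra! hle
        have := cnt_mono (Out := M.OutputsAt k x.code) hle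
        omega
      -- If all solutions had been output before time t, the machine would have stopped right after
      -- the last one.
      have h4 := hM.no_postprocessing x u h1 fun v hv ho => by
        have h5 := cnt_succ_of_out h1
        have h6 := cnt_mono (Out := M.OutputsAt k x.code) (Nat.succ_le_of_lt hv)
        have h7 := cnt_succ_of_out ho
        have h8 := hM.cnt_le (x := x) (v + 1)
        simp only [Nat.succ_eq_add_one] at h6
        omega
      exact ht (by rwa [cfg_of_halted_le h4 h3])
    refine (hM.le_nth hlt le_rfl).trans ((le_time M x.code _).trans ?_)
    exact hp x (cnt (M.OutputsAt k x.code) t + 1) (by omega) (by omega)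

end

/-- A second output comes after at least one step, and every step costs at least 1. -/
lemma Solves.one_le_delay (hM : M.Solves A) {p : ℕ → ℕ} (hp : M.HasIncrementalDelay k p)
    (h : 2 ≤ M.count x) : 1 ≤ p x.length := by
  by_contra! h0
  have h1 := hp x 2 (by omega) h
  have h2 := (hM.le_nth (x := x) (i := 1) (t := 1) h (by
    rw [cnt, Nat.count_succ]
    simp only [Nat.count_zero]
    split_ifs <;> omega)).trans (le_time M x.code _)
  rw [show p x.length = 0 by omega] at h1
  simp only [T] at h1
  norm_num at h1
  omega

lemma code_getD_le (x : Word k) (a : ℕ) : x.code.getD a 0 ≤ k := by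
  rw [Word.code, List.getD_eq_getElem?_getD, List.getElem?_map]
  cases x[a]? with
  | none => simp
  | some v => simp

@[simp] lemma length_code (x : Word k) : x.code.length = x.length := by simp [Word.code]

lemma length_baseRepr_le (hk : 2 ≤ k) (v : ℕ) : (baseRepr k v).length ≤ intSize v := by
  rw [baseRepr]
  split_ifs with h
  · exact one_le_intSize v
  · rw [List.length_reverse, Nat.length_digits k v (by omega) h]
    have h1 := Nat.log_anti_left (b := k) (c := 2) (n := v) (by norm_num) hk
    have h2 := Nat.lt_size.2 (Nat.pow_log_le_self 2 h)
    exact (show Nat.log k v + 1 ≤ Nat.size v by omega).trans (le_max_right _ _)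

/-- Outputs are not longer than the space used. -/
lemma length_le_of_emit (hk : 2 ≤ k) {M : RAM} {x : List ℕ} {S t : ℕ} (hS : ∀ t, M.space x t ≤ S)
    {y : List ℕ} (hy : M.emit k x t = some y) : y.length ≤ S := by
  simp only [emit] at hy
  split at hy
  · rename_i a b heq
    obtain rfl := Option.some.inj hy
    set R := (M.cfg x t).mem with hR
    rcases lt_or_ge (R b) (R a) with hlt | hab
    · simp [show R b + 1 - R a = 0 by omega]
    have hb : R b ≤ (M.cfg x (t + 1)).hi :=
      Code.touched_le_hi heq (by simp [Instr.touched, ← hR, hab])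
    have hmem : (M.cfg x (t + 1)).mem = R := by
      rw [cfg_succ, step_of_some heq]; rfl
    have hsp := hS (t + 1)
    rw [space, hmem] at hsp
    refine le_trans ?_ ((Nat.le_add_left _ _).trans hsp)
    rw [List.length_flatMap]
    calc ((List.range' (R a) (R b + 1 - R a)).map fun r => (baseRepr k (R r)).length).sum
        ≤ ((List.range' (R a) (R b + 1 - R a)).map fun r => intSize (R r)).sum :=
          List.sum_le_sum fun r _ => length_baseRepr_le hk _
      _ = ∑ r ∈ Finset.Ico (R a) (R b + 1), intSize (R r) := by
          rw [Finset.sum_Ico_eq_sum_range, List.range'_eq_map_range, List.map_map]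
          rfl
      _ ≤ _ := Finset.sum_le_sum_of_subset fun r hr => by
          simp only [Finset.mem_Ico, Finset.mem_range] at hr ⊢; omega
  · simp at hy

/-- There are at most exponentially many solutions in the space. -/
lemma Solves.count_le (hk : 2 ≤ k) (hM : M.Solves A) {s : ℕ → ℕ} (hs : M.HasSpace k s) :
    M.count x ≤ k ^ (s x.length + 1) := by
  have key : ∀ y ∈ M.outputs x, (∀ d ∈ y ++ [1], d < k) ∧ (y ++ [1]).length ≤ s x.length + 1 := by
    intro y hy
    have h1 := hy
    rw [hM.outputs_eq] at h1
    obtain ⟨z, -, rfl⟩ := h1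
    obtain ⟨t, ht⟩ := hy
    refine ⟨fun d hd => ?_, by simpa using length_le_of_emit hk (hs x) ht⟩
    rcases List.mem_append.1 hd with hd | hd
    · obtain ⟨a, -, rfl⟩ := List.mem_map.1 hd
      exact a.2
    · rw [List.mem_singleton.1 hd]; omega
  rw [count, ← Finset.card_range (k ^ (s x.length + 1)), ← Set.ncard_coe_finset]
  -- Words are read as numbers in base k. The appended top digit 1 makes this injective, since zeros
  -- at the end of a word would be lost otherwise.
  refine Set.ncard_le_ncard_of_injOn (fun y => Nat.ofDigits k (y ++ [1])) (fun y hy => ?_) ?_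
    (Finset.finite_toSet _)
  · obtain ⟨h1, h2⟩ := key y hy
    simp only [Finset.coe_range, Set.mem_Iio]
    exact (Nat.ofDigits_lt_base_pow_length (by omega) h1).trans_le
      (Nat.pow_le_pow_right (by omega) h2)
  · intro y hy z hz e
    have h := congrArg (Nat.digits k) e
    simp only at h
    rw [Nat.digits_ofDigits k (by omega) _ (key y hy).1 (by simp),
      Nat.digits_ofDigits k (by omega) _ (key z hz).1 (by simp)] at h
    exact List.append_cancel_right h

end RAM

/-! ### Runs of a compiled program in rounds -/

open Amortization

namespace Code

lemma wp_mono {H : ℕ} {x : List ℕ} {Q Q' : (ℕ → ℕ) → Option (ℕ × ℕ) → Bool → Prop} (c : Code)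
    (hQ : ∀ R o st, Q R o st → Q' R o st) : ∀ R, wp H x c R Q → wp H x c R Q' := by
  induction c with
  | leaf o st =>
    intro R h
    cases o with
    | none => exact hQ _ _ _ h
    | some ab => exact ⟨h.1, hQ _ _ _ h.2⟩
  | seq i c ih => exact fun R h => ⟨h.1, h.2.1, ih _ h.2.2⟩
  | br a b c d ihc ihd =>
    rintro R ⟨ha, hb, h⟩
    refine ⟨ha, hb, ?_⟩
    split_ifs at h ⊢
    · exact ihc _ h
    · exact ihd _ h

/-- The machine `M` runs in `L + 1` rounds, the times `τ a` being the starts of the rounds.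
In round `a` it writes the output `o a`, and it stops at the end of round `L`. -/
structure Run (k : ℕ) (M : RAM) (x : List ℕ) (W H L : ℕ) (P : ℕ → (ℕ → ℕ) → Prop)
    (o : ℕ → Option (List ℕ)) (τ : ℕ → ℕ) : Prop where
  zero : τ 0 = 0
  le : ∀ a ≤ L, τ a ≤ τ (a + 1)
  le_add : ∀ a ≤ L, τ (a + 1) ≤ τ a + W
  mem : ∀ a ≤ L, P a (M.cfg x (τ a)).mem
  hi : (M.cfg x (τ (L + 1))).hi ≤ H
  halted : M.Halted (M.cfg x (τ (L + 1)))
  emits : ∀ a ≤ L, Emits k M x (τ a) (τ (a + 1) - τ a) (o a) (decide (a = L))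

/-- Iterates `Code.sound`: the precondition for round a yields the one for round a + 1, and the
decision to quit is taken exactly in round L. -/
theorem exists_run {k : ℕ} {M : RAM} {x : List ℕ} {H L : ℕ} {P : ℕ → (ℕ → ℕ) → Prop}
    {o : ℕ → Option (List ℕ)} (c : Code) (hM : M = ⟨compile 0 c⟩) (h0 : P 0 fun _ => 0)
    (hwp : ∀ a ≤ L, ∀ R, P a R → wp H x c R fun R' ab st => (st = true ↔ a = L) ∧
      (ab.map fun ab => word k R' ab.1 ab.2) = o a ∧ (st = false → P (a + 1) R')) :
    ∃ τ, Run k M x c.depth H L P o τ := by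
  have hat : At M.prog 0 (compile 0 c) := fun i v h => by rw [hM]; simpa using h
  set G : ℕ → ℕ → Prop := fun a t =>
    (M.cfg x t).pc = 0 ∧ P a (M.cfg x t).mem ∧ (M.cfg x t).hi ≤ H with hG
  -- The hypotheses stand behind the existential quantifier, so that `choose` gives a total function
  -- which can be iterated.
  have step : ∀ a t, ∃ t', a ≤ L → G a t → t ≤ t' ∧ t' ≤ t + c.depth ∧ (M.cfg x t').hi ≤ H ∧
      (a < L → G (a + 1) t') ∧ (a = L → M.Halted (M.cfg x t')) ∧
      Emits k M x t (t' - t) (o a) (decide (a = L)) := by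
    intro a t
    by_cases h : a ≤ L ∧ G a t
    · obtain ⟨ha, h1, h2, h3⟩ := h
      obtain ⟨m, R', ab, st, e1, ⟨e2, e3, e4⟩, e5, e6, e7, e8, e9⟩ :=
        sound (k := k) c 0 t _ hat h1 rfl h3 (hwp a ha _ h2)
      refine ⟨t + m, fun _ _ => ⟨by omega, by omega, e6, fun hl => ?_, fun hl => e7 (e2.2 hl), ?_⟩⟩
      · have hst : st = false := by
          cases st with
          | false => rfl
          | true => exact absurd (e2.1 rfl) hl.ne
        exact ⟨(e8 hst).2, e5 ▸ e4 hst, e6⟩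
      · rw [e3] at e9
        rw [Nat.add_sub_cancel_left]
        convert e9
        rw [Bool.eq_iff_iff, e2]
        simp
    · exact ⟨t, fun h1 h2 => absurd ⟨h1, h2⟩ h⟩
  choose f hf using step
  set τ : ℕ → ℕ := fun a => Nat.rec 0 f a with hτ
  have hs : ∀ a, τ (a + 1) = f a (τ a) := fun a => rfl
  have inv : ∀ a ≤ L, G a (τ a) := by
    intro a
    induction a with
    | zero => exact fun _ => ⟨rfl, h0, Nat.zero_le _⟩
    | succ a ih => exact fun ha => (hf a _ (by omega) (ih (by omega))).2.2.2.1 ha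
  have hf' := fun a ha => hf a (τ a) ha (inv a ha)
  exact ⟨τ, rfl, fun a ha => (hf' a ha).1, fun a ha => (hf' a ha).2.1, fun a ha => (inv a ha).2.1,
    (hf' L le_rfl).2.2.1, (hf' L le_rfl).2.2.2.2.1 rfl, fun a ha => (hf' a ha).2.2.2.2.2⟩

namespace Run

variable {k : ℕ} {M : RAM} {x : List ℕ} {W H L : ℕ} {P : ℕ → (ℕ → ℕ) → Prop}
  {o : ℕ → Option (List ℕ)} {τ : ℕ → ℕ} (h : Run k M x W H L P o τ)
include h

lemma le_add_mul (a d : ℕ) (had : a + d ≤ L + 1) : τ (a + d) ≤ τ a + d * W := by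
  induction d with
  | zero => simp
  | succ d ih =>
    have h1 := ih (by omega)
    have h2 := h.le_add (a + d) (by omega)
    rw [← add_assoc, Nat.succ_mul]
    omega

lemma mono {a b : ℕ} (hab : a ≤ b) (hb : b ≤ L + 1) : τ a ≤ τ b := by
  induction b, hab using Nat.le_induction with
  | base => rfl
  | succ b hab ih => exact (ih (by omega)).trans (h.le b (by omega))

lemma exists_round {t : ℕ} (ht : t < τ (L + 1)) : ∃ a ≤ L, τ a ≤ t ∧ t < τ (a + 1) := by
  have key : ∀ b ≤ L + 1, t < τ b → ∃ a < b, τ a ≤ t ∧ t < τ (a + 1) := by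
    intro b
    induction b with
    | zero => intro _ hlt; rw [h.zero] at hlt; omega
    | succ b ih =>
      intro hb hlt
      by_cases hb' : τ b ≤ t
      · exact ⟨b, by omega, hb', hlt⟩
      · obtain ⟨a, ha, h1⟩ := ih (by omega) (by omega)
        exact ⟨a, by omega, h1⟩
  obtain ⟨a, ha, h1⟩ := key (L + 1) le_rfl ht
  exact ⟨a, by omega, h1⟩

lemma emit_eq {t : ℕ} {w : List ℕ} (ht : M.emit k x t = some w) :
    ∃ a ≤ L, o a = some w ∧ τ a ≤ t ∧ t < τ (a + 1) := by
  have hlt : t < τ (L + 1) := by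
    by_contra! hle
    exact h.halted.not_out (k := k) hle (by simp [RAM.OutputsAt, ht])
  obtain ⟨a, ha, h1, h2⟩ := h.exists_round hlt
  refine ⟨a, ha, ?_, h1, h2⟩
  have he := h.emits a ha
  obtain ⟨u, rfl⟩ := Nat.exists_eq_add_of_le h1
  cases ho : o a with
  | none =>
    rw [ho] at he
    rw [he u (by omega)] at ht
    simp at ht
  | some w' =>
    rw [ho] at he
    obtain ⟨e, -, e1, e2, -⟩ := he
    rcases eq_or_ne u e with rfl | hne
    · rw [← e1, ht]
    · rw [e2 u (by omega) hne] at ht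
      simp at ht

lemma exists_emit {a : ℕ} (ha : a ≤ L) {w : List ℕ} (hw : o a = some w) :
    ∃ t, τ a ≤ t ∧ t < τ (a + 1) ∧ M.emit k x t = some w ∧ (a = L → t + 1 = τ (L + 1)) := by
  have he := h.emits a ha
  have hle := h.le a ha
  rw [hw] at he
  obtain ⟨e, e0, e1, -, e3⟩ := he
  refine ⟨τ a + e, by omega, by omega, e1, fun hL => ?_⟩
  have := e3 (by simp [hL])
  subst hL
  omega

lemma out_unique {a t t' : ℕ} (ha : a ≤ L) (ht : M.OutputsAt k x t) (ht' : M.OutputsAt k x t')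
    (h1 : τ a ≤ t ∧ t < τ (a + 1)) (h2 : τ a ≤ t' ∧ t' < τ (a + 1)) : t = t' := by
  have he := h.emits a ha
  obtain ⟨u, rfl⟩ := Nat.exists_eq_add_of_le h1.1
  obtain ⟨v, rfl⟩ := Nat.exists_eq_add_of_le h2.1
  cases ho : o a with
  | none =>
    rw [ho] at he
    simp [RAM.OutputsAt, he u (by omega)] at ht
  | some w' =>
    rw [ho] at he
    obtain ⟨e, -, e1, e2, -⟩ := he
    have key : ∀ u, M.OutputsAt k x (τ a + u) → τ a + u < τ (a + 1) → u = e := by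
      intro u hu hlt
      by_contra hne
      rw [RAM.OutputsAt, e2 u (by omega) hne] at hu
      simp at hu
    rw [key u ht h1.2, key v ht' h2.2]

lemma no_repeat (hinj : ∀ a ≤ L, ∀ b ≤ L, ∀ w, o a = some w → o b = some w → a = b) {t t' : ℕ}
    (ht : M.OutputsAt k x t) (e : M.emit k x t = M.emit k x t') : t = t' := by
  obtain ⟨w, hw⟩ := Option.isSome_iff_exists.1 ht
  have hw' := e ▸ hw
  obtain ⟨a, ha, h1, h2⟩ := h.emit_eq hw
  obtain ⟨b, hb, h3, h4⟩ := h.emit_eq hw'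
  obtain rfl := hinj a ha b hb w h1 h3
  exact h.out_unique ha ht (by simp [RAM.OutputsAt, hw']) h2 h4

/-- The last round writes its output in its final step, and by `hlast` it has one as soon as any
round has one. So the output that nothing follows is this one. -/
lemma halted_of_last (hlast : ∀ a ≤ L, (o a).isSome → (o L).isSome) {t : ℕ}
    (ht : M.OutputsAt k x t) (hl : ∀ t', t < t' → ¬ M.OutputsAt k x t') :
    M.Halted (M.cfg x (t + 1)) := by
  obtain ⟨w, hw⟩ := Option.isSome_iff_exists.1 ht
  obtain ⟨a, ha, h1, h2⟩ := h.emit_eq hw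
  obtain ⟨w', hw'⟩ := Option.isSome_iff_exists.1 (hlast a ha (by simp [h1]))
  obtain ⟨u, u1, u2, u3, u4⟩ := h.exists_emit le_rfl hw'
  have hout : M.OutputsAt k x u := by simp [RAM.OutputsAt, u3]
  have hle : u ≤ t := not_lt.1 fun hlt => hl u hlt hout
  have hut : u = t := by
    have hmono := h.mono (a := a + 1) (b := L + 1) (by omega) le_rfl
    rcases ha.eq_or_lt with rfl | hlt
    · exact h.out_unique le_rfl hout ht ⟨u1, u2⟩ h2
    · have := h.mono (a := a + 1) (b := L) hlt (by omega)
      omega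
  rw [← hut, u4 rfl]
  exact h.halted

/-- The configurations at the ends of rounds are those of the next round, or the last one. -/
lemma exists_start (t : ℕ) : ∃ a ≤ L, ∃ u ≤ W, M.cfg x t = M.cfg x (τ a + u) := by
  rcases lt_or_ge t (τ (L + 1)) with hlt | hge
  · obtain ⟨a, ha, h1, h2⟩ := h.exists_round hlt
    have := h.le_add a ha
    exact ⟨a, ha, t - τ a, by omega, by rw [Nat.add_sub_cancel' h1]⟩
  · have h1 := h.le_add L le_rfl
    have h2 := h.le L le_rfl
    refine ⟨L, le_rfl, τ (L + 1) - τ L, by omega, ?_⟩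
    rw [Nat.add_sub_cancel' h2, RAM.cfg_of_halted_le h.halted hge]

lemma hi_le (t : ℕ) : (M.cfg x t).hi ≤ H := by
  refine le_trans ?_ h.hi
  rcases le_total t (τ (L + 1)) with hle | hge
  · exact RAM.hi_mono M x hle
  · rw [RAM.cfg_of_halted_le h.halted hge]

end Run
end Code

namespace RAM
open Code
variable {k : ℕ} {M : RAM} {x : Word k} {A : EnumProblem k} {W H L : ℕ}
  {P : ℕ → (ℕ → ℕ) → Prop} {o : ℕ → Option (List ℕ)} {τ : ℕ → ℕ} {c : ℕ}

/-- If the first output is written in round `D` or earlier, then the time before it is bounded. -/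
lemma Solves.T_one_le (hM : M.Solves A) (h : Run k M x.code W H L P o τ)
    (hc : ∀ t, M.stepCost x.code t ≤ c) {a : ℕ} (ha : a ≤ L) (ho : (o a).isSome) :
    M.T x 1 ≤ (a + 1) * W * c := by
  classical
  obtain ⟨w, hw⟩ := Option.isSome_iff_exists.1 ho
  obtain ⟨t, t1, t2, t3, -⟩ := h.exists_emit ha hw
  have h1 := hM.nth_le (i := 0) (show M.OutputsAt k x.code t by simp [OutputsAt, t3])
    (Nat.zero_le _)
  have h2 := h.le_add_mul 0 (a + 1) (by omega)
  rw [h.zero, zero_add, zero_add] at h2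
  have h3 := time_add_le hc 0 (Nat.nth (M.OutputsAt k x.code) 0)
  rw [zero_add] at h3
  calc M.T x 1 = M.time x.code (Nat.nth (M.OutputsAt k x.code) 0) := rfl
    _ ≤ 0 + Nat.nth (M.OutputsAt k x.code) 0 * c := by simpa [time] using h3
    _ ≤ _ := by rw [zero_add]; exact Nat.mul_le_mul_right _ (by omega)

/-- Suppose output i is written in round a. A round after it, at most a + 1 + D, writes something,
and this is output i + 1 or a later one. So at most D + 2 rounds, of at most W steps of cost c, lie
between the two. -/
lemma Solves.T_succ_le (hM : M.Solves A) (h : Run k M x.code W H L P o τ)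
    (hc : ∀ t, M.stepCost x.code t ≤ c) {D a₀ : ℕ} (h₀ : ∀ a < a₀, o a = none)
    (hD : ∀ a, a₀ ≤ a → a ≤ L → ∃ b, a ≤ b ∧ b ≤ L ∧ b ≤ a + D ∧ (o b).isSome) {i : ℕ}
    (hi : 1 ≤ i) (hi' : i < M.count x) : M.T x (i + 1) ≤ M.T x i + (D + 2) * W * c := by
  classical
  obtain ⟨u1, u2⟩ := hM.nth_mem (x := x) (i := i - 1) (by omega)
  obtain ⟨v1, v2⟩ := hM.nth_mem (x := x) (i := i) hi'
  have huv : Nat.nth (M.OutputsAt k x.code) (i - 1) < Nat.nth (M.OutputsAt k x.code) i := by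
    by_contra! hle
    have := cnt_mono (Out := M.OutputsAt k x.code) hle
    omega
  have hT : M.T x (i + 1) = M.time x.code (Nat.nth (M.OutputsAt k x.code) i) := rfl
  rw [hT, T]
  set u := Nat.nth (M.OutputsAt k x.code) (i - 1)
  set v := Nat.nth (M.OutputsAt k x.code) i
  obtain ⟨w, hw⟩ := Option.isSome_iff_exists.1 u1
  obtain ⟨w', hw'⟩ := Option.isSome_iff_exists.1 v1
  obtain ⟨a, ha, a1, a2, a3⟩ := h.emit_eq hw
  obtain ⟨b, hb, b1, b2, b3⟩ := h.emit_eq hw'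
  have hab : a < b := by
    by_contra! hle
    rcases hle.eq_or_lt with rfl | hlt
    · exact huv.ne (h.out_unique ha u1 v1 ⟨a2, a3⟩ ⟨b2, b3⟩)
    · have := h.mono (a := b + 1) (b := a) hlt (by omega)
      omega
  have ha₀ : a₀ ≤ a := by
    by_contra! hlt
    rw [h₀ a hlt] at a1
    simp at a1
  obtain ⟨d, d1, d2, d3, d4⟩ := hD (a + 1) (by omega) (by omega)
  obtain ⟨w'', hw''⟩ := Option.isSome_iff_exists.1 d4
  obtain ⟨t, t1, t2, t3, -⟩ := h.exists_emit d2 hw''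
  have htout : M.OutputsAt k x.code t := by simp [OutputsAt, t3]
  have hut : u < t := by
    have := h.mono (a := a + 1) (b := d) d1 (by omega)
    omega
  have hvt : v ≤ t := hM.nth_le htout (by
    have h5 := cnt_succ_of_out u1
    have h6 := cnt_mono (Out := M.OutputsAt k x.code) (Nat.succ_le_of_lt hut)
    simp only [Nat.succ_eq_add_one] at h6
    omega)
  have h7 := h.le_add_mul a (d + 1 - a) (by omega)
  rw [show a + (d + 1 - a) = d + 1 by omega] at h7
  have h8 : (d + 1 - a) * W ≤ (D + 2) * W := Nat.mul_le_mul_right _ (by omega)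
  have h9 := time_add_le hc u (v - u)
  rw [Nat.add_sub_cancel' huv.le] at h9
  exact h9.trans (Nat.add_le_add_left (Nat.mul_le_mul_right _ (by omega)) _)

end RAM

/-! ### Size of the memory contents -/

open Amortization Code

namespace Code

lemma sum_blocks {l₁ l₂ L m : ℕ} {c₁ c₂ : ℕ → ℕ} {c₃ : ℕ → ℕ → ℕ} (f : ℕ → ℕ) :
    ∑ r ∈ Finset.range (l₁ + l₂ + m * L), f (blocks l₁ l₂ L c₁ c₂ c₃ r) =
      ∑ r ∈ Finset.range l₁, f (c₁ r) + ∑ r ∈ Finset.range l₂, f (c₂ r) +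
        ∑ j ∈ Finset.range m, ∑ r ∈ Finset.range L, f (c₃ j r) := by
  induction m with
  | zero =>
    rw [Nat.zero_mul, add_zero, Finset.sum_range_add]
    simp only [Finset.range_zero, Finset.sum_empty, add_zero]
    congr 1
    · exact Finset.sum_congr rfl fun r hr => by rw [blocks_fst (Finset.mem_range.1 hr)]
    · exact Finset.sum_congr rfl fun r hr => by rw [blocks_snd (Finset.mem_range.1 hr)]
  | succ m ih =>
    rw [Nat.succ_mul, ← add_assoc, Finset.sum_range_add, ih, Finset.sum_range_succ _ m, add_assoc]
    congr 2
    exact Finset.sum_congr rfl fun r hr => by rw [blocks_thd (Finset.mem_range.1 hr)]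

/-- The simulated registers are charged to the space of the simulated machine; registers it has not
accessed hold 0 and cost 1 each. Digits are at most 2 and have size at most 2. -/
lemma sum_cell_le {M : RAM} {x : List ℕ} {S t ph q Z T B : ℕ} {bits : ℕ → ℕ}
    (h0 : intSize (M.cfg x t).pc ≤ Z) (h1 : intSize ph ≤ Z) (h2 : intSize q ≤ Z)
    (hm : M.space x t ≤ T) (hb : ∀ i, bits i ≤ 2) :
    ∑ o ∈ Finset.range (3 + S + B), intSize (cell M x S t ph q bits o) ≤
      3 * Z + (T + S) + B * 2 := by
  rw [Finset.sum_range_add, Finset.sum_range_add]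
  refine add_le_add (add_le_add ?_ ?_) ?_
  · simp only [Finset.sum_range_succ, Finset.sum_range_zero, cell_zero, cell_one, cell_two]
    omega
  · refine le_of_eq_of_le (Finset.sum_congr rfl fun a ha => ?_) (RAM.sum_intSize_mem_le hm S)
    rw [cell_mem (Finset.mem_range.1 ha)]
  · refine (Finset.sum_le_card_nsmul _ _ 2 fun i _ => ?_).trans (by simp)
    rw [cell_bits]
    exact intSize_le (by norm_num) ((hb i).trans_lt (by norm_num))

lemma cell_le {M : RAM} {x : List ℕ} {S t ph q V : ℕ} {bits : ℕ → ℕ}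
    (h0 : (M.cfg x t).pc ≤ V) (h1 : ph ≤ V) (h2 : q ≤ V) (hm : ∀ a, (M.cfg x t).mem a ≤ V)
    (hb : ∀ i, bits i ≤ V) (o : ℕ) : cell M x S t ph q bits o ≤ V := by
  unfold cell
  split_ifs
  · exact h0
  · exact h1
  · exact h2
  · exact hm _
  · exact hb _

lemma blocks_le {l₁ l₂ L V : ℕ} {c₁ c₂ : ℕ → ℕ} {c₃ : ℕ → ℕ → ℕ} (h₁ : ∀ o, c₁ o ≤ V)
    (h₂ : ∀ o, c₂ o ≤ V) (h₃ : ∀ j o, c₃ j o ≤ V) (r : ℕ) : blocks l₁ l₂ L c₁ c₂ c₃ r ≤ V := by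
  unfold blocks
  split_ifs
  · exact h₁ _
  · exact h₂ _
  · exact h₃ _ _

end Code

namespace Amortization

variable {Out Halt : ℕ → Prop} {p N : ℕ} {σ : St}

lemma MInv.bits_le {m : ℕ} {M : Mach} (h : MInv Out m M) (i : ℕ) : M.bits i ≤ 2 := by
  rcases lt_trichotomy i m with hi | rfl | hi
  · exact (h.low i hi).trans (by norm_num)
  · exact h.top
  · rw [h.high i hi]; norm_num

lemma Inv.q_le (h : Inv Out Halt p N σ) (m : ℕ) : (σ.mach m).q ≤ σ.K := by
  rcases le_or_gt m σ.K with hm | hm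
  · exact ((h.mach m).q_le).trans hm
  · rw [h.fresh m hm]; exact Nat.zero_le _

end Amortization

/-- The machines of the setup do what they should, and `b` bounds the numbers that they
work with. -/
structure Setup.Valid (E : Setup) (k : ℕ) (A : EnumProblem k) (p s b e : ℕ → ℕ) : Prop where
  two_le : 2 ≤ k
  solves : E.I.Solves A
  delay : E.I.HasIncrementalDelay k p
  space : E.I.HasSpace k s
  space_s : E.Ms.HasSpace k fun n => E.cs * s n
  space_p : E.Mp.HasSpace k fun n => E.cp * s n
  val_s : ∀ (x : Word k) t, E.Ms.Halted (E.Ms.cfg x.code t) → (E.Ms.cfg x.code t).mem 0 = s x.length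
  val_p : ∀ (x : Word k) t, E.Mp.Halted (E.Mp.cfg x.code t) → (E.Mp.cfg x.code t).mem 0 = p x.length
  halts_s : ∀ x : Word k, ∃ t ≤ e x.length, E.Ms.Halted (E.Ms.cfg x.code t)
  halts_p : ∀ x : Word k, ∃ t ≤ e x.length, E.Mp.Halted (E.Mp.cfg x.code t)
  mem_le : ∀ M ∈ [E.Ms, E.Mp, E.I], ∀ (x : Word k) t a, (M.cfg x.code t).mem a ≤ b x.length
  pc_le : ∀ M ∈ [E.Ms, E.Mp, E.I], ∀ (x : Word k) t, (M.cfg x.code t).pc ≤ b x.length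
  ck_eq : E.ck = 2 * Nat.clog 2 k + 2

namespace Setup

variable {E : Setup} {k : ℕ} {A : EnumProblem k} {p s b e : ℕ → ℕ} {x : Word k} {σ : St}
  {C h : ℕ → ℕ} {g ts tp V : ℕ}

/-- The largest register index used on input `x`. -/
noncomputable def top (E : Setup) (S N : ℕ) : ℕ :=
  24 + (E.l₁ S + E.l₂ S + (Nat.log 2 N + 1 + 1) * E.len S)

/-- A bound for `E.top` that depends on the length of the input only. -/
def maxTop (E : Setup) (S : ℕ) : ℕ := 24 + (E.l₁ S + E.l₂ S + (E.ck * S + 1) * E.len S)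

/-- A bound for the register contents at the start of a round. -/
def maxVal (E : Setup) (S b : ℕ) : ℕ := E.maxTop S + 8 * (b + 2)

namespace Valid

variable (hE : E.Valid k A p s b e)
include hE

lemma lt_space (x : Word k) : x.length < s x.length := by
  have := RAM.hi_lt_of_space_le (hE.space x 0)
  rw [RAM.length_code] at this
  omega

lemma hi_lt (x : Word k) (t : ℕ) : (E.I.cfg x.code t).hi < s x.length := by
  have := RAM.hi_lt_of_space_le (hE.space x t); omega

/-- N ≤ k^(s+1), and s ≥ 1, so log N + 1 is less than a constant multiple of s. Thus `E.ck * s`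
registers suffice for the digits of a counter, although N is unknown to the machine. -/
lemma log_lt (x : Word k) : Nat.log 2 (E.I.count x) + 1 < E.ck * s x.length := by
  have h1 := hE.lt_space x
  have h2 := hE.solves.count_le hE.two_le hE.space (x := x)
  have h3 : E.I.count x ≤ 2 ^ (Nat.clog 2 k * (s x.length + 1)) := by
    rw [pow_mul]
    exact h2.trans (Nat.pow_le_pow_left (Nat.le_pow_clog (by norm_num) k) _)
  have h4 : Nat.log 2 (E.I.count x) ≤ Nat.clog 2 k * (s x.length + 1) := by
    have := Nat.log_mono_right (b := 2) h3
    rwa [Nat.log_pow (by norm_num)] at this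
  have h5 : Nat.clog 2 k * (s x.length + 1) ≤ Nat.clog 2 k * (2 * s x.length) :=
    Nat.mul_le_mul_left _ (by omega)
  have h6 : (2 * Nat.clog 2 k + 2) * s x.length =
    Nat.clog 2 k * (2 * s x.length) + 2 * s x.length := by ring
  rw [hE.ck_eq]
  omega

lemma top_le (x : Word k) : E.top (s x.length) (E.I.count x) ≤ E.maxTop (s x.length) := by
  have := Nat.mul_le_mul_right (E.len (s x.length)) (show Nat.log 2 (E.I.count x) + 1 + 1 ≤
    E.ck * s x.length + 1 by have := hE.log_lt x; omega)
  simp only [top, maxTop]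
  omega

/-- The delay is the final content of a register of a machine in the uniform cost model, and
therefore polynomial. -/
lemma p_le (x : Word k) : p x.length ≤ b x.length := by
  obtain ⟨t, -, ht⟩ := hE.halts_p x
  rw [← hE.val_p x t ht]
  exact hE.mem_le _ (by simp) x t 0

section Rep
variable (hrep : E.Rep x.code (s x.length) (p x.length) (E.maxTop (s x.length) + b x.length) g ts tp
    σ C h)
  (hI : Inv (E.I.OutputsAt k x.code) (fun t => E.I.Halted (E.I.cfg x.code t)) (p x.length)
    (E.I.count x) σ)
include hrep hI

lemma heap_le (r : ℕ) : h r ≤ E.maxVal (s x.length) (b x.length) := by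
  have hlog := hE.log_lt x
  have h1 : E.ck * s x.length + 1 ≤ (E.ck * s x.length + 1) * E.len (s x.length) :=
    Nat.le_mul_of_pos_right _ (by simp only [len]; omega)
  have hV : b x.length + 24 + E.ck * s x.length ≤ E.maxVal (s x.length) (b x.length) := by
    simp only [maxVal, maxTop]; omega
  have hmem : ∀ M ∈ [E.Ms, E.Mp, E.I], ∀ t a, (M.cfg x.code t).mem a ≤
      E.maxVal (s x.length) (b x.length) := fun M hM t a => (hE.mem_le M hM x t a).trans (by omega)
  have hpc : ∀ M ∈ [E.Ms, E.Mp, E.I], ∀ t, (M.cfg x.code t).pc ≤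
      E.maxVal (s x.length) (b x.length) := fun M hM t => (hE.pc_le M hM x t).trans (by omega)
  rw [hrep.heap, layout]
  refine blocks_le (fun o => ?_) (fun o => ?_) (fun j o => ?_) r
  · exact cell_le (hpc E.Ms (by simp) _) (Nat.zero_le _) (Nat.zero_le _) (hmem E.Ms (by simp) _)
      (fun _ => Nat.zero_le _) o
  · exact cell_le (hpc E.Mp (by simp) _) (Nat.zero_le _) (Nat.zero_le _) (hmem E.Mp (by simp) _)
      (fun _ => Nat.zero_le _) o
  · have h2 := (hI.mach j).ph_le
    have h3 := (hI.mach j).bits_le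
    have h4 := hI.q_le j
    have h5 := hI.K_le
    exact cell_le (hpc E.I (by simp) _) (by omega) (by omega) (hmem E.I (by simp) _)
      (fun i => (h3 i).trans (by omega)) o

variable (hg : g ≤ 2)
include hg

lemma control_le (r : ℕ) (hr : r < 24) : C r ≤ E.maxVal (s x.length) (b x.length) := by
  have hp := hE.p_le x
  have hK := hI.K_le
  have hj := hI.j_le
  have hf := hI.f_le
  have hlog := hE.log_lt x
  have h1 : E.len (s x.length) ≤ (E.ck * s x.length + 1) * E.len (s x.length) :=
    Nat.le_mul_of_pos_left _ (by omega)
  have h2 : E.len (s x.length) = 3 + s x.length + E.ck * s x.length := by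
    simp only [len]; ring
  rw [maxVal]
  have hT : E.maxTop (s x.length) = 24 + (E.l₁ (s x.length) + E.l₂ (s x.length) +
    (E.ck * s x.length + 1) * E.len (s x.length)) := rfl
  have hlow := hrep.low
  have h14 := hrep.stage
  have h22 := hrep.out₁
  have h23 := hrep.out₂
  have hz := hrep.zero
  have ho := hrep.one
  have ht := hrep.two
  by_cases hr14 : r < 14
  · rw [hlow r hr14]; exact Nat.zero_le _
  rcases (show r = 14 ∨ (15 ≤ r ∧ r < 22) ∨ r = 22 ∨ r = 23 by omega) with rfl | hr' | rfl | rfl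
  · omega
  · rcases (show g = 0 ∨ g = 1 ∨ g = 2 by omega) with hg | hg | hg
    · rw [hz hg r hr'.1 hr'.2]; exact Nat.zero_le _
    · obtain ⟨h1, h2, h3, h4, h5, h6, h7⟩ := ho hg
      obtain ⟨h8, h9⟩ := hr'
      interval_cases r <;> omega
    · obtain ⟨h1, h2, h3, h4, h5, h6, h7⟩ := ht hg
      obtain ⟨h8, h9⟩ := hr'
      interval_cases r <;> omega
  · omega
  · omega

lemma glue_le (r : ℕ) : glue C h r ≤ E.maxVal (s x.length) (b x.length) := by
  rcases lt_or_ge r 24 with hr | hr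
  · rw [glue_low hr]; exact hE.control_le hrep hI hg r hr
  · obtain ⟨o, rfl⟩ := Nat.exists_eq_add_of_le hr
    rw [glue_high]; exact hE.heap_le hrep hI o

/-- The size of the memory contents at the start of a round. -/
lemma sum_glue_le {Z : ℕ} (hZ : intSize (E.maxVal (s x.length) (b x.length)) ≤ Z) :
    ∑ r ∈ Finset.range (E.top (s x.length) (E.I.count x) + 1), intSize (glue C h r) ≤
      30 * Z + 2 * (E.cs + E.cp) * s x.length +
        (Nat.log 2 (E.I.count x) + 3) * (3 * Z + (2 + 2 * E.ck) * s x.length) := by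
  have hval : ∀ v ≤ E.maxVal (s x.length) (b x.length), intSize v ≤ Z := fun v hv =>
    (intSize_mono hv).trans hZ
  have hb : b x.length + 24 ≤ E.maxVal (s x.length) (b x.length) := by
    simp only [maxVal, maxTop]; omega
  have hq : E.ck * s x.length ≤ E.maxVal (s x.length) (b x.length) := by
    have h1 : E.ck * s x.length + 1 ≤ (E.ck * s x.length + 1) * E.len (s x.length) :=
      Nat.le_mul_of_pos_right _ (by simp only [len]; omega)
    simp only [maxVal, maxTop]; omega
  have hpc : ∀ M ∈ [E.Ms, E.Mp, E.I], ∀ t, intSize (M.cfg x.code t).pc ≤ Z := fun M hM t =>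
    hval _ ((hE.pc_le M hM x t).trans (by omega))
  have h6 := hE.log_lt x
  have hlen : E.len (s x.length) = 3 + s x.length + E.ck * s x.length := by
    simp only [len]; ring
  set S := s x.length with hS
  -- One more block than the copies can occupy absorbs the offset by one, so that the range splits
  -- into whole blocks.
  have hle : E.top S (E.I.count x) + 1 ≤
      24 + (E.l₁ S + E.l₂ S + (Nat.log 2 (E.I.count x) + 3) * E.len S) := by
    rw [top]
    have : (Nat.log 2 (E.I.count x) + 3) * E.len S =
      (Nat.log 2 (E.I.count x) + 1 + 1) * E.len S + E.len S := by ring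
    omega
  refine (Finset.sum_le_sum_of_subset (Finset.range_mono hle)).trans ?_
  rw [Finset.sum_range_add]
  simp only [glue_high]
  have e1 : ∑ r ∈ Finset.range 24, intSize (glue C h r) ≤ 24 * Z := by
    refine (Finset.sum_le_card_nsmul _ _ Z fun r _ => ?_).trans (by simp)
    exact hval _ (hE.glue_le hrep hI hg r)
  have e2 : ∑ o ∈ Finset.range (E.l₁ S), intSize (cell E.Ms x.code (E.cs * S) ts 0 0
      (fun _ => 0) o) ≤ 3 * Z + (E.cs * S + E.cs * S) + 0 * 2 :=
    sum_cell_le (B := 0) (hpc E.Ms (by simp) _) (hval _ (Nat.zero_le _)) (hval _ (Nat.zero_le _))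
      (by simpa using hE.space_s x ts) fun _ => Nat.zero_le _
  have e3 : ∑ o ∈ Finset.range (E.l₂ S), intSize (cell E.Mp x.code (E.cp * S) tp 0 0
      (fun _ => 0) o) ≤ 3 * Z + (E.cp * S + E.cp * S) + 0 * 2 :=
    sum_cell_le (B := 0) (hpc E.Mp (by simp) _) (hval _ (Nat.zero_le _)) (hval _ (Nat.zero_le _))
      (by simpa using hE.space_p x tp) fun _ => Nat.zero_le _
  have e4 : ∀ j, ∑ o ∈ Finset.range (E.len S), intSize (cell E.I x.code S (σ.mach j).t
      (σ.mach j).ph (σ.mach j).q (σ.mach j).bits o) ≤ 3 * Z + (S + S) + E.ck * S * 2 := by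
    intro j
    rw [hlen]
    have h4 := hI.q_le j
    have h5 := hI.K_le
    exact sum_cell_le (hpc E.I (by simp) _) (hval _ ((hI.mach j).ph_le.trans (by omega)))
      (hval _ (by omega)) (hE.space x _) (hI.mach j).bits_le
  have e5 : ∑ j ∈ Finset.range (Nat.log 2 (E.I.count x) + 3), ∑ o ∈ Finset.range (E.len S),
      intSize (cell E.I x.code S (σ.mach j).t (σ.mach j).ph (σ.mach j).q (σ.mach j).bits o) ≤
      (Nat.log 2 (E.I.count x) + 3) * (3 * Z + (S + S) + E.ck * S * 2) := by
    refine (Finset.sum_le_card_nsmul _ _ _ fun j _ => e4 j).trans (by simp)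
  have e0 : ∑ r ∈ Finset.range (E.l₁ S + E.l₂ S + (Nat.log 2 (E.I.count x) + 3) * E.len S),
      intSize (h r) ≤ (3 * Z + (E.cs * S + E.cs * S) + 0 * 2) +
        (3 * Z + (E.cp * S + E.cp * S) + 0 * 2) +
        (Nat.log 2 (E.I.count x) + 3) * (3 * Z + (S + S) + E.ck * S * 2) := by
    rw [hrep.heap, layout, sum_blocks]
    exact add_le_add (add_le_add e2 e3) e5
  calc _ ≤ 24 * Z + ((3 * Z + (E.cs * S + E.cs * S) + 0 * 2) +
        (3 * Z + (E.cp * S + E.cp * S) + 0 * 2) +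
        (Nat.log 2 (E.I.count x) + 3) * (3 * Z + (S + S) + E.ck * S * 2)) := add_le_add e1 e0
    _ = _ := by ring

end Rep

end Valid
end Setup

/-! ### The run of the amortized enumerator -/

open Amortization Code

namespace Setup

variable {E : Setup} {k : ℕ} {A : EnumProblem k} {p s b e : ℕ → ℕ} {x : Word k}

/-- The state of the simulated amortized enumerator after `c` units of work. -/
noncomputable def state (E : Setup) (p : ℕ → ℕ) (x : Word k) (c : ℕ) : St :=
  seq (E.I.OutputsAt k x.code) (fun t => E.I.Halted (E.I.cfg x.code t)) (p x.length) c

/-- The memory at the start of round `a`, where the computations of the bounds take `tS` and `tP`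
steps. -/
def Start (E : Setup) (p s b : ℕ → ℕ) (x : Word k) (tS tP B a : ℕ) (R : ℕ → ℕ) : Prop :=
  ∃ C h g ts tp c, R = glue C h ∧ E.Rep x.code (s x.length) (p x.length)
    (E.maxTop (s x.length) + b x.length) g ts tp (E.state p x c) C h ∧
    ((g = 0 ∧ a ≤ tS ∧ ts = a ∧ tp = 0 ∧ c = 0) ∨
    (g = 1 ∧ ts = tS ∧ tp ≤ tP ∧ a = tS + 1 + tp ∧ c = 0) ∨
    (g = 2 ∧ ts = tS ∧ tp = tP ∧ a = tS + tP + 2 + c ∧ c ≤ B))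

/-- The output of round `a`. -/
noncomputable def out (E : Setup) (p : ℕ → ℕ) (x : Word k) (a₀ a : ℕ) : Option (List ℕ) :=
  if a < a₀ then none else (E.state p x (a - a₀)).emit.bind (E.I.emit k x.code)

lemma out_eq_some {a₀ a : ℕ} {w : List ℕ} : E.out p x a₀ a = some w ↔
    ∃ c t, a = a₀ + c ∧ (E.state p x c).emit = some t ∧ E.I.emit k x.code t = some w := by
  unfold out
  split_ifs with h
  · simp only [false_iff]
    rintro ⟨c, t, rfl, -⟩
    omega
  · rw [Option.bind_eq_some_iff]
    constructor
    · rintro ⟨t, h1, h2⟩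
      exact ⟨a - a₀, t, by omega, h1, h2⟩
    · rintro ⟨c, t, rfl, h1, h2⟩
      exact ⟨t, by rwa [Nat.add_sub_cancel_left], h2⟩

namespace Valid

variable (hE : E.Valid k A p s b e)
include hE

/-- The two computations of bounds take tS + 1 and tP + 1 rounds, as the round that notices the
halting is an extra one; then each round is one unit of work. The register bound refers to the
actual number of solutions, which enters only through the invariant. -/
theorem exists_run (x : Word k) : ∃ tS tP B τ, tS ≤ e x.length ∧ tP ≤ e x.length ∧
    Trace (E.I.OutputsAt k x.code) (fun t => E.I.Halted (E.I.cfg x.code t)) (p x.length)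
      (E.I.count x) B ∧
    Run k E.machine x.code E.body.depth (E.top (s x.length) (E.I.count x)) (tS + tP + 2 + B)
      (E.Start p s b x tS tP B) (E.out p x (tS + tP + 2)) τ := by
  classical
  have hexS : ∃ t, E.Ms.Halted (E.Ms.cfg x.code t) := (hE.halts_s x).imp fun _ h => h.2
  have hexP : ∃ t, E.Mp.Halted (E.Mp.cfg x.code t) := (hE.halts_p x).imp fun _ h => h.2
  obtain ⟨uS, huS, huS'⟩ := hE.halts_s x
  obtain ⟨uP, huP, huP'⟩ := hE.halts_p x
  obtain ⟨B, hB⟩ := exists_trace (hE.solves.stream (x := x) hE.delay)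
  set tS := Nat.find hexS with htS
  set tP := Nat.find hexP with htP
  have hS : E.Ms.Halted (E.Ms.cfg x.code tS) := Nat.find_spec hexS
  have hP : E.Mp.Halted (E.Mp.cfg x.code tP) := Nat.find_spec hexP
  have hS' : ∀ t < tS, ¬ E.Ms.Halted (E.Ms.cfg x.code t) := fun t ht => Nat.find_min hexS ht
  have hP' : ∀ t < tP, ¬ E.Mp.Halted (E.Mp.cfg x.code t) := fun t ht => Nat.find_min hexP ht
  have htop := hE.top_le x
  have hH : 24 + (E.l₁ (s x.length) + E.l₂ (s x.length)) ≤
      E.top (s x.length) (E.I.count x) := by simp only [top]; omega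
  have hinit : E.state p x 0 = St.init (p x.length) := rfl
  refine ⟨tS, tP, B, ?_⟩
  suffices hτ : ∃ τ, Run k E.machine x.code E.body.depth (E.top (s x.length) (E.I.count x))
      (tS + tP + 2 + B) (E.Start p s b x tS tP B) (E.out p x (tS + tP + 2)) τ from
    hτ.imp fun τ hτ => ⟨(Nat.find_min' hexS huS').trans huS, (Nat.find_min' hexP huP').trans huP,
      hB, hτ⟩
  refine Code.exists_run E.body rfl ?_ ?_
  · refine ⟨fun _ => 0, fun _ => 0, 0, 0, 0, 0, ?_, ?_, Or.inl ⟨rfl, Nat.zero_le _, rfl, rfl, rfl⟩⟩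
    · funext r; simp [glue]
    -- Initial configurations and fresh copies consist of zeros, so the empty memory already
    -- contains all blocks.
    · have hcell : ∀ (M : RAM) S, cell M x.code S 0 0 0 (fun _ => 0) = fun _ => 0 := fun M S => by
        funext o; simp [cell, RAM.cfg]
      constructor
      · simp only [layout, hinit, St.init, Mach.init, hcell]
        funext r
        simp [blocks]
      all_goals simp
  · rintro a ha R ⟨C, h, g, ts, tp, c, rfl, hrep, hcase⟩
    rcases hcase with ⟨rfl, h1, rfl, rfl, rfl⟩ | ⟨rfl, rfl, h1, rfl, rfl⟩ |
      ⟨rfl, rfl, rfl, rfl, h1⟩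
    · rw [hinit] at hrep
      refine wp_mono _ ?_ _ (wp_stage_zero hrep (by simp only [l₁, l₂] at hH ⊢; omega) ?_ ?_)
      · rintro R o st ⟨rfl, rfl, C', h', rfl, h2, h3⟩
        refine ⟨by simp; omega, ?_, fun _ => ?_⟩
        · rw [out, if_pos (by omega)]; rfl
        · by_cases hh : E.Ms.Halted (E.Ms.cfg x.code ts)
          · have : ts = tS := by
              by_contra hne
              exact hS' ts (by omega) hh
            exact ⟨C', h', 1, ts, 0, 0, rfl, h2 hh, Or.inr (Or.inl
              ⟨rfl, this, Nat.zero_le _, by omega, rfl⟩)⟩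
          · have : ts ≠ tS := fun he => hh (he ▸ hS)
            exact ⟨C', h', 0, ts + 1, 0, 0, rfl, h3 hh, Or.inl ⟨rfl, by omega, rfl, rfl, rfl⟩⟩
      · have := RAM.hi_lt_of_space_le (hE.space_s x (ts + 1)); beta_reduce at this; omega
      · exact hE.val_s x ts
    · rw [hinit] at hrep
      refine wp_mono _ ?_ _ (wp_stage_one hrep (by simp only [l₁, l₂] at hH ⊢; omega) ?_ ?_)
      · rintro R o st ⟨rfl, rfl, C', h', rfl, h2, h3⟩
        refine ⟨by simp; omega, ?_, fun _ => ?_⟩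
        · rw [out, if_pos (by omega)]; rfl
        · by_cases hh : E.Mp.Halted (E.Mp.cfg x.code tp)
          · have : tp = tP := by
              by_contra hne
              exact hP' tp (by omega) hh
            exact ⟨C', h', 2, tS, tp, 0, rfl, h2 hh, Or.inr (Or.inr
              ⟨rfl, rfl, this, by omega, Nat.zero_le _⟩)⟩
          · have : tp ≠ tP := fun he => hh (he ▸ hP)
            exact ⟨C', h', 1, tS, tp + 1, 0, rfl, h3 hh, Or.inr (Or.inl
              ⟨rfl, rfl, by omega, by omega, rfl⟩)⟩
      · have := RAM.hi_lt_of_space_le (hE.space_p x (tp + 1)); beta_reduce at this; omega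
      · exact hE.val_p x tp
    · have hI := hB.inv c h1
      have hK := hI.K_le
      have hlog := hE.log_lt x
      have hquit : (E.state p x c).quit (fun t => E.I.Halted (E.I.cfg x.code t)) ↔ c = B := by
        constructor
        · intro hs
          by_contra hne
          exact hB.not_quit c (by omega) hs
        · rintro rfl
          exact hB.quit
      have hmul := Nat.mul_le_mul_right (E.len (s x.length)) (Nat.succ_le_succ hK)
      simp only [Nat.succ_eq_add_one] at hmul
      refine wp_mono _ ?_ _ (wp_stage_two (k := k) (H := E.top (s x.length) (E.I.count x)) hrep hI
        (hE.hi_lt x) (fun t a => Nat.add_le_add htop (hE.mem_le E.I (by simp) x t a))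
        (hK.trans_lt hlog) (by simp only [top]; unfold state; omega))
      rintro R o st ⟨h2, h3, h4⟩
      refine ⟨?_, ?_, fun hst => ?_⟩
      · rw [h2, hquit]; omega
      · rw [h3, out, if_neg (by omega), Nat.add_sub_cancel_left]
      · obtain ⟨C', h', rfl, h5⟩ := h4 hst
        have hne : c ≠ B := fun he => by rw [h2.2 (hquit.2 he)] at hst; simp at hst
        refine ⟨C', h', 2, tS, tP, c + 1, rfl, ?_, Or.inr (Or.inr
          ⟨rfl, rfl, rfl, by omega, by omega⟩)⟩
        rw [state, seq_succ]
        exact h5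

end Valid
end Setup

/-! ### Correctness, cost, space and delay of the machine -/

open Amortization Code

namespace Setup

section Run

variable {E : Setup} {k : ℕ} {p s b : ℕ → ℕ} {x : Word k} {tS tP B H : ℕ} {τ : ℕ → ℕ}
  (hB : Trace (E.I.OutputsAt k x.code) (fun t => E.I.Halted (E.I.cfg x.code t)) (p x.length)
    (E.I.count x) B)
include hB

lemma exists_out (h : 1 ≤ E.I.count x) (a : ℕ) (ha : tS + tP + 2 ≤ a)
    (ha' : a ≤ tS + tP + 2 + B) : ∃ c, a ≤ c ∧ c ≤ tS + tP + 2 + B ∧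
      c ≤ a + (2 * (Nat.log 2 (E.I.count x) + 1) + 1) * (8 * (p x.length + 2) + 2) ∧
      (E.out p x (tS + tP + 2) c).isSome := by
  obtain ⟨d, rfl⟩ := Nat.exists_eq_add_of_le ha
  obtain ⟨c, h1, h2, h3, h4⟩ := hB.delay h d (by omega)
  obtain ⟨t, ht⟩ := Option.isSome_iff_exists.1 h4
  obtain ⟨w, hw⟩ := Option.isSome_iff_exists.1 (hB.sound c h2 t ht)
  exact ⟨tS + tP + 2 + c, by omega, by omega, by omega,
    Option.isSome_iff_exists.2 ⟨w, out_eq_some.2 ⟨c, t, rfl, ht, hw⟩⟩⟩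

lemma outputs_eq_of_run (hr : Run k E.machine x.code E.body.depth H (tS + tP + 2 + B)
    (E.Start p s b x tS tP B) (E.out p x (tS + tP + 2)) τ) :
    E.machine.outputs x = E.I.outputs x := by
  ext w
  constructor
  · rintro ⟨t, ht⟩
    obtain ⟨a, -, h1, -⟩ := hr.emit_eq ht
    obtain ⟨c, u, -, -, hu⟩ := out_eq_some.1 h1
    exact ⟨u, hu⟩
  · rintro ⟨t, ht⟩
    obtain ⟨c, hc, h1⟩ := hB.complete t (by simp [RAM.OutputsAt, ht])
    obtain ⟨u, -, -, hu, -⟩ := hr.exists_emit (a := tS + tP + 2 + c) (by omega)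
      (out_eq_some.2 ⟨c, t, rfl, h1, ht⟩)
    exact ⟨u, hu⟩

end Run

namespace Valid

variable {E : Setup} {k : ℕ} {A : EnumProblem k} {p s b e : ℕ → ℕ}
  (hE : E.Valid k A p s b e)
include hE

/-- The machine that computes s stops with this value in a register, and there are words of every
length because the alphabet is not empty. -/
lemma s_le (n : ℕ) : s n ≤ b n := by
  have hx : ∃ x : Word k, x.length = n :=
    ⟨List.replicate n ⟨0, by have := hE.two_le; omega⟩, by simp⟩
  obtain ⟨x, rfl⟩ := hx
  obtain ⟨t, -, ht⟩ := hE.halts_s x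
  rw [← hE.val_s x t ht]
  exact hE.mem_le _ (by simp) x t 0

lemma polyBdd_s (hb : PolyBdd b) : PolyBdd s := hb.mono hE.s_le

lemma polyBdd_maxVal (hb : PolyBdd b) : PolyBdd fun n => E.maxVal (s n) (b n) := by
  have hs := hE.polyBdd_s hb
  have hlen : PolyBdd fun n => E.len (s n) := (PolyBdd.const 3).add ((PolyBdd.const _).mul hs)
  have h1 : PolyBdd fun n => E.l₁ (s n) := (PolyBdd.const 3).add ((PolyBdd.const _).mul hs)
  have h2 : PolyBdd fun n => E.l₂ (s n) := (PolyBdd.const 3).add ((PolyBdd.const _).mul hs)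
  have hK : PolyBdd fun n => E.ck * s n + 1 := ((PolyBdd.const _).mul hs).add (.const 1)
  exact ((PolyBdd.const 24).add ((h1.add h2).add (hK.mul hlen))).add
    ((PolyBdd.const 8).mul (hb.add (.const 2)))

lemma one_le_count {x : Word k} {t : ℕ} (h : E.I.OutputsAt k x.code t) : 1 ≤ E.I.count x := by
  have h1 := cnt_succ_of_out h
  have h2 := hE.solves.cnt_le (x := x) (t + 1)
  omega

section Run

variable {x : Word k} {tS tP B H : ℕ} {τ : ℕ → ℕ}
  (hB : Trace (E.I.OutputsAt k x.code) (fun t => E.I.Halted (E.I.cfg x.code t)) (p x.length)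
    (E.I.count x) B)
  (hr : Run k E.machine x.code E.body.depth H (tS + tP + 2 + B) (E.Start p s b x tS tP B)
    (E.out p x (tS + tP + 2)) τ)

include hr in
/-- The memory at the start of a round is small. -/
lemma start_le {a : ℕ} (ha : a ≤ tS + tP + 2 + B)
    (hB : ∀ c ≤ B, Inv (E.I.OutputsAt k x.code) (fun t => E.I.Halted (E.I.cfg x.code t))
      (p x.length) (E.I.count x) (E.state p x c)) :
    (∀ r, (E.machine.cfg x.code (τ a)).mem r ≤ E.maxVal (s x.length) (b x.length)) ∧
    ∀ Z, intSize (E.maxVal (s x.length) (b x.length)) ≤ Z →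
      ∑ r ∈ Finset.range (E.top (s x.length) (E.I.count x) + 1),
        intSize ((E.machine.cfg x.code (τ a)).mem r) ≤
      30 * Z + 2 * (E.cs + E.cp) * s x.length +
        (Nat.log 2 (E.I.count x) + 3) * (3 * Z + (2 + 2 * E.ck) * s x.length) := by
  obtain ⟨C, h, g, ts, tp, c, hR, hrep, hcase⟩ := hr.mem a ha
  have hI := hB c (by omega)
  have hg : g ≤ 2 := by omega
  rw [hR]
  exact ⟨hE.glue_le hrep hI hg, fun Z hZ => hE.sum_glue_le hrep hI hg hZ⟩

include hB hr

lemma no_repeat_of_run {t t' : ℕ} (ht : E.machine.OutputsAt k x.code t)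
    (he : E.machine.emit k x.code t = E.machine.emit k x.code t') : t = t' := by
  refine hr.no_repeat (fun a ha a' ha' w hw hw' => ?_) ht he
  obtain ⟨c, u, rfl, h1, h2⟩ := out_eq_some.1 hw
  obtain ⟨c', u', rfl, h1', h2'⟩ := out_eq_some.1 hw'
  obtain rfl := hE.solves.no_repeat x u u' (by simp [RAM.OutputsAt, h2]) (h2.trans h2'.symm)
  rw [hB.injective c (by omega) c' (by omega) u h1 h1']

lemma halted_of_run {t : ℕ} (ht : E.machine.OutputsAt k x.code t)
    (hl : ∀ t', t < t' → ¬ E.machine.OutputsAt k x.code t') :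
    E.machine.Halted (E.machine.cfg x.code (t + 1)) := by
  refine hr.halted_of_last (fun a ha hs => ?_) ht hl
  obtain ⟨w, hw⟩ := Option.isSome_iff_exists.1 hs
  obtain ⟨c, u, rfl, h1, h2⟩ := out_eq_some.1 hw
  have hN := hE.one_le_count (x := x) (t := u) (by simp [RAM.OutputsAt, h2])
  obtain ⟨d, h3, h4, -, h5⟩ := exists_out (tS := tS) (tP := tP) hB hN _ (by omega) le_rfl
  rwa [show d = tS + tP + 2 + B by omega] at h5

end Run

theorem solves_machine : E.machine.Solves A where
  halts x := by
    obtain ⟨tS, tP, B, τ, -, -, -, hr⟩ := hE.exists_run x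
    exact ⟨_, hr.halted⟩
  outputs_eq x := by
    obtain ⟨tS, tP, B, τ, -, -, hB, hr⟩ := hE.exists_run x
    rw [outputs_eq_of_run hB hr, hE.solves.outputs_eq]
  no_repeat x t t' ht he := by
    obtain ⟨tS, tP, B, τ, -, -, hB, hr⟩ := hE.exists_run x
    exact hE.no_repeat_of_run hB hr ht he
  no_postprocessing x t ht hl := by
    obtain ⟨tS, tP, B, τ, -, -, hB, hr⟩ := hE.exists_run x
    exact hE.halted_of_run hB hr ht hl

lemma count_machine (x : Word k) : E.machine.count x = E.I.count x := by
  rw [RAM.count, RAM.count, hE.solves_machine.outputs_eq, hE.solves.outputs_eq]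

/-- A bound for the numbers that the machine works with. -/
lemma exists_mem_le (hb : PolyBdd b) : ∃ V : ℕ → ℕ, PolyBdd V ∧ (∀ n, n ≤ V n) ∧
    (∀ n, E.machine.maxNum ≤ V n) ∧ (∀ n, E.maxVal (s n) (b n) ≤ V n) ∧
    ∀ (x : Word k) (tS tP B H : ℕ) (τ : ℕ → ℕ),
      (∀ c ≤ B, Inv (E.I.OutputsAt k x.code) (fun t => E.I.Halted (E.I.cfg x.code t))
        (p x.length) (E.I.count x) (E.state p x c)) →
      Run k E.machine x.code E.body.depth H (tS + tP + 2 + B) (E.Start p s b x tS tP B)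
        (E.out p x (tS + tP + 2)) τ →
      ∀ a ≤ tS + tP + 2 + B, ∀ u ≤ E.body.depth, ∀ r,
        (E.machine.cfg x.code (τ a + u)).mem r ≤ V x.length := by
  -- V₀ bounds everything a step can combine at the start of a round. Within a round of at most
  -- `E.body.depth` steps the bound is squared at most that often, so it remains polynomial.
  set V₀ : ℕ → ℕ := fun n => E.maxVal (s n) (b n) + n + k + E.machine.maxNum + 2 with hV₀
  have hpoly : PolyBdd V₀ := ((((hE.polyBdd_maxVal hb).add .id).add (.const k)).add
    (.const _)).add (.const 2)
  have hle : ∀ n u, u ≤ E.body.depth → V₀ n ^ 2 ^ u ≤ V₀ n ^ 2 ^ E.body.depth := fun n u hu =>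
    Nat.pow_le_pow_right (by simp only [hV₀]; omega) (Nat.pow_le_pow_right (by norm_num) hu)
  have h0 : ∀ n, V₀ n ≤ V₀ n ^ 2 ^ E.body.depth := fun n => by
    simpa using hle n 0 (Nat.zero_le _)
  refine ⟨fun n => V₀ n ^ 2 ^ E.body.depth, hpoly.pow _, fun n => ?_, fun n => ?_, fun n => ?_,
    fun x tS tP B H τ hI hr a ha u hu r => ?_⟩
  · exact le_trans (by simp only [hV₀]; omega) (h0 n)
  · exact le_trans (by simp only [hV₀]; omega) (h0 n)
  · exact le_trans (by simp only [hV₀]; omega) (h0 n)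
  · refine le_trans ?_ (hle x.length u hu)
    refine RAM.mem_le_pow (RAM.code_getD_le x) (by simp [hV₀]; omega) (by simp only [hV₀]; omega)
      (by simp only [hV₀]; omega) (by simp only [hV₀]; omega) (fun r => ?_) u r
    refine ((hE.start_le hr ha hI).1 r).trans ?_
    simp only [hV₀]; omega

theorem uniformCost_machine (hb : PolyBdd b) : E.machine.UniformCost k := by
  obtain ⟨V, ⟨c, hc⟩, h1, h2, -, h4⟩ := hE.exists_mem_le hb
  refine ⟨1 + 2 * (2 * c + 1), fun x t => ?_⟩
  obtain ⟨tS, tP, B, τ, -, -, hB, hr⟩ := hE.exists_run x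
  refine RAM.stepCost_le (V := V x.length) (by simpa using h1 x.length) (h2 _) (fun r => ?_)
    (by simpa using hc x.length)
  obtain ⟨a, ha, u, hu, e⟩ := hr.exists_start t
  rw [e]
  exact h4 x tS tP B _ τ hB.inv hr a ha u hu r

theorem space_machine (hb : PolyBdd b) : ∃ C : ℕ, ∀ (x : Word k) (t : ℕ),
    E.machine.space x.code t ≤ C * (s x.length * (1 + Nat.clog 2 (E.I.count x))) := by
  obtain ⟨V, ⟨c, hc⟩, h1, h2, h3, h4⟩ := hE.exists_mem_le hb
  set z := 2 * c + 1 with hz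
  refine ⟨1 + 30 * z + 2 * (E.cs + E.cp) + 3 * (3 * z + (2 + 2 * E.ck)) + E.body.depth * z,
    fun x t => ?_⟩
  obtain ⟨tS, tP, B, τ, -, -, hB, hr⟩ := hE.exists_run x
  obtain ⟨a, ha, u, hu, e⟩ := hr.exists_start t
  have hin : (x.code.map intSize).sum ≤ s x.length :=
    (Nat.le_add_right _ _).trans (hE.space x 0)
  -- Since n < s, log n + 1 is at most s; so a polynomial number takes space O(s), and boundedly
  -- many of them do no harm.
  have hV : intSize (V x.length) ≤ z * s x.length := by
    refine (intSize_le_log (hc x.length)).trans (Nat.mul_le_mul_left _ ?_)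
    have := Nat.log_le_self 2 x.length
    have := hE.lt_space x
    omega
  have h5 := (hE.start_le hr ha hB.inv).2 _ ((intSize_mono (h3 x.length)).trans hV)
  have h6 := RAM.sum_intSize_add_le (M := E.machine) (x := x.code) (t := τ a)
    (H := E.top (s x.length) (E.I.count x) + 1) u
    fun v hv r => h4 x tS tP B _ τ hB.inv hr a ha v (hv.trans hu) r
  have h7 : ∑ r ∈ Finset.range ((E.machine.cfg x.code t).hi + 1),
      intSize ((E.machine.cfg x.code t).mem r) ≤
      ∑ r ∈ Finset.range (E.top (s x.length) (E.I.count x) + 1),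
        intSize ((E.machine.cfg x.code (τ a + u)).mem r) := by
    rw [← e]
    exact Finset.sum_le_sum_of_subset (Finset.range_mono (Nat.succ_le_succ (hr.hi_le t)))
  have h8 : u * intSize (V x.length) ≤ E.body.depth * (z * s x.length) := Nat.mul_le_mul hu hV
  have h9 : Nat.log 2 (E.I.count x) ≤ Nat.clog 2 (E.I.count x) := Nat.log_le_clog 2 _
  set l := Nat.clog 2 (E.I.count x)
  set S := s x.length
  have h10 : (Nat.log 2 (E.I.count x) + 3) * (3 * (z * S) + (2 + 2 * E.ck) * S) ≤
      (3 * (1 + l)) * (3 * (z * S) + (2 + 2 * E.ck) * S) := Nat.mul_le_mul_right _ (by omega)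
  calc E.machine.space x.code t ≤ S + (30 * (z * S) + 2 * (E.cs + E.cp) * S +
        (3 * (1 + l)) * (3 * (z * S) + (2 + 2 * E.ck) * S) + E.body.depth * (z * S)) := by
        rw [RAM.space]; omega
    _ ≤ S * (1 + l) + (30 * (z * (S * (1 + l))) + 2 * (E.cs + E.cp) * (S * (1 + l)) +
        (3 * (1 + l)) * (3 * (z * S) + (2 + 2 * E.ck) * S) +
        E.body.depth * (z * (S * (1 + l)))) := by
        have : S ≤ S * (1 + l) := Nat.le_mul_of_pos_right _ (by omega)
        gcongr
    _ = _ := by ring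

theorem delay_machine (hb : PolyBdd b) : ∃ C : ℕ, ∀ (x : Word k) (i : ℕ), 1 ≤ i →
    i < E.machine.count x → E.machine.T x (i + 1) ≤
      E.machine.T x i + C * (Nat.clog 2 (E.I.count x) * p x.length) := by
  obtain ⟨c, hc⟩ := hE.uniformCost_machine hb
  -- 132 = 5·26 + 2. With at least two solutions the logarithm l and p are at least 1, so 2(log N +
  -- 1) + 1 ≤ 5l and 8(p + 2) + 2 ≤ 26p; the last 2 counts the rounds at both ends.
  refine ⟨132 * E.body.depth * c, fun x i hi hi' => ?_⟩
  obtain ⟨tS, tP, B, τ, -, -, hB, hr⟩ := hE.exists_run x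
  have hN : 2 ≤ E.I.count x := by rw [← hE.count_machine]; omega
  have h1 := hE.solves_machine.T_succ_le hr (hc x) (a₀ := tS + tP + 2)
    (fun a ha => if_pos ha) (exists_out (tS := tS) (tP := tP) hB (by omega)) hi hi'
  refine h1.trans (Nat.add_le_add_left ?_ _)
  have hp := hE.solves.one_le_delay hE.delay hN
  have hl : 1 ≤ Nat.clog 2 (E.I.count x) := Nat.clog_pos (by norm_num) hN
  have h9 : Nat.log 2 (E.I.count x) ≤ Nat.clog 2 (E.I.count x) := Nat.log_le_clog 2 _
  set l := Nat.clog 2 (E.I.count x)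
  set P := p x.length
  have h2 : (2 * (Nat.log 2 (E.I.count x) + 1) + 1) * (8 * (P + 2) + 2) + 2 ≤ 132 * (l * P) := by
    calc _ ≤ (5 * l) * (26 * P) + 2 * (l * P) := by
          have : 1 ≤ l * P := Nat.mul_pos hl hp
          have := Nat.mul_le_mul (show 2 * (Nat.log 2 (E.I.count x) + 1) + 1 ≤ 5 * l by omega)
            (show 8 * (P + 2) + 2 ≤ 26 * P by omega)
          omega
      _ = _ := by ring
  calc _ ≤ 132 * (l * P) * E.body.depth * c := by gcongr
    _ = _ := by ring

/-- The number of rounds between outputs is made a function of n alone by replacing log N + 1 by the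
multiple `E.ck * s` of s, and p by b. The time before the first output includes the computation of
the two bounds. -/
theorem exists_polynomial_delay (hb : PolyBdd b) (he : PolyBdd e) : ∃ q : Polynomial ℕ,
    ∀ x : Word k, (1 ≤ E.machine.count x → E.machine.T x 1 < q.eval x.length) ∧
    ∀ i, 1 < i → i ≤ E.machine.count x →
      E.machine.T x i < E.machine.T x (i - 1) + q.eval x.length := by
  obtain ⟨c, hc⟩ := hE.uniformCost_machine hb
  set D : ℕ → ℕ := fun n => (2 * (E.ck * s n) + 1) * (8 * (b n + 2) + 2) with hD
  have hDp : PolyBdd D := (((PolyBdd.const 2).mul ((PolyBdd.const _).mul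
    (hE.polyBdd_s hb))).add (.const 1)).mul
      (((PolyBdd.const 8).mul (hb.add (.const 2))).add (.const 2))
  obtain ⟨q, hq⟩ := (((((PolyBdd.const 2).mul he).add hDp).add (.const 3)).mul
    (.const E.body.depth)).mul (.const c) |>.exists_polynomial
  refine ⟨q, fun x => ?_⟩
  obtain ⟨tS, tP, B, τ, hS, hP, hB, hr⟩ := hE.exists_run x
  have hDx : (2 * (Nat.log 2 (E.I.count x) + 1) + 1) * (8 * (p x.length + 2) + 2) ≤
      D x.length := by
    have := hE.log_lt x
    have := hE.p_le x
    exact Nat.mul_le_mul (by omega) (by omega)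
  have hx := hq x.length
  rw [hE.count_machine]
  refine ⟨fun h => lt_of_le_of_lt ?_ hx, fun i hi hi' => ?_⟩
  · obtain ⟨a, -, h2, h3, h4⟩ := exists_out (tS := tS) (tP := tP) hB h _ le_rfl (by omega)
    refine (hE.solves_machine.T_one_le hr (hc x) h2 h4).trans ?_
    exact Nat.mul_le_mul_right _ (Nat.mul_le_mul_right _ (by omega))
  · obtain ⟨j, rfl⟩ := Nat.exists_eq_add_of_le' hi.le
    have h1 := hE.solves_machine.T_succ_le hr (hc x) (a₀ := tS + tP + 2)
      (fun a ha => if_pos ha) (exists_out (tS := tS) (tP := tP) hB (by omega)) (i := j)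
      (by omega) (by rw [hE.count_machine]; omega)
    rw [Nat.add_sub_cancel]
    refine h1.trans_lt (Nat.add_lt_add_left (lt_of_le_of_lt ?_ hx) _)
    exact Nat.mul_le_mul_right _ (Nat.mul_le_mul_right _ (by omega))

end Valid
end Setup

/-! ### Conclusion -/

/-- A machine that computes a known function, with bounds for its running time and for the numbers
that it works with. -/
lemma Known.exists_machine {k : ℕ} {s f : ℕ → ℕ} (h : Known k s f) : ∃ (M : RAM) (C : ℕ)
    (b e : ℕ → ℕ), PolyBdd b ∧ PolyBdd e ∧ M.HasSpace k (fun n => C * s n) ∧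
    (∀ (x : Word k) t, M.Halted (M.cfg x.code t) → (M.cfg x.code t).mem 0 = f x.length) ∧
    (∀ x : Word k, ∃ t ≤ e x.length, M.Halted (M.cfg x.code t)) ∧
    (∀ (x : Word k) t a, (M.cfg x.code t).mem a ≤ b x.length) := by
  obtain ⟨M, q, C, ⟨c, hc⟩, hs, hM⟩ := h
  refine ⟨M, C, _, _, RAM.polyBdd_mem k c, PolyBdd.eval q, hs, fun x t ht => ?_, fun x => ?_,
    fun x t a => ?_⟩
  · obtain ⟨u, hu, -, hv⟩ := hM x
    rw [← hv]
    rcases le_total t u with h | h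
    · rw [RAM.cfg_of_halted_le ht h]
    · rw [RAM.cfg_of_halted_le hu h]
  · obtain ⟨u, hu, ht, -⟩ := hM x
    exact ⟨u, (RAM.le_time M x.code u).trans ht, hu⟩
  · simpa using RAM.mem_le_of_stepCost_le (RAM.code_getD_le x) (hc x) t a

theorem mainTheorem1 (k : ℕ) (hk : 2 ≤ k) (A : EnumProblem k) (I : RAM) (p s : ℕ → ℕ)
    (hI : IsIncEnumerator 1 I A) (hIcost : I.UniformCost k)
    (hp : I.HasIncrementalDelay k p) (hs : I.HasSpace k s)
    (hpknown : Known k s p) (hsknown : Known k s s) :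
    ∃ I' : RAM, IsDelayPEnumerator I' A ∧ I'.UniformCost k ∧
      (∃ C : ℕ, ∀ (x : Word k) (i : ℕ), 1 ≤ i → i < I'.count x →
        I'.T x (i + 1) ≤ I'.T x i + C * (Nat.clog 2 (I.count x) * p x.length)) ∧
      (∃ C : ℕ, ∀ (x : Word k) (t : ℕ),
        I'.space x.code t ≤ C * (s x.length * (1 + Nat.clog 2 (I.count x)))) := by
  obtain ⟨hA, hsolves, -⟩ := hI
  obtain ⟨c, hc⟩ := hIcost
  obtain ⟨Ms, cs, bs, es, hbs, hes, hspace, hval, hhalt, hmem⟩ := hsknown.exists_machine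
  obtain ⟨Mp, cp, bp, ep, hbp, hep, pspace, pval, phalt, pmem⟩ := hpknown.exists_machine
  set bI : ℕ → ℕ := fun n => k + (2 * (n + 1)) ^ (2 * c + 1) with hbI
  set pc : RAM → ℕ := fun M => M.prog.length + M.maxNum with hpc
  set b : ℕ → ℕ := fun n => bs n + bp n + bI n + (pc Ms + pc Mp + pc I) with hb
  have hbpoly : PolyBdd b := ((hbs.add hbp).add (RAM.polyBdd_mem k c)).add (.const _)
  -- The number of digit registers, in units of s, is chosen from the bound N ≤ k^(s+1).
  set E : Setup := ⟨Ms, Mp, I, cs, cp, 2 * Nat.clog 2 k + 2⟩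
  have hE : E.Valid k A p s b (fun n => es n + ep n) := by
    refine ⟨hk, hsolves, hp, hs, hspace, pspace, hval, pval, fun x => ?_, fun x => ?_, ?_, ?_, rfl⟩
    · obtain ⟨t, ht, h⟩ := hhalt x
      exact ⟨t, by omega, h⟩
    · obtain ⟨t, ht, h⟩ := phalt x
      exact ⟨t, by omega, h⟩
    · intro M hM x t a
      simp only [List.mem_cons, List.not_mem_nil, or_false] at hM
      rcases hM with rfl | rfl | rfl
      · exact (hmem x t a).trans (by simp only [hb]; omega)
      · exact (pmem x t a).trans (by simp only [hb]; omega)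
      · have h1 := RAM.mem_le_of_stepCost_le (RAM.code_getD_le x) (hc x) t a
        rw [RAM.length_code] at h1
        exact h1.trans (by simp only [hb, hbI]; omega)
    · intro M hM x t
      simp only [List.mem_cons, List.not_mem_nil, or_false] at hM
      have h1 := RAM.pc_le M x.code t
      rcases hM with rfl | rfl | rfl <;> exact h1.trans (by simp only [hb, hpc]; omega)
  exact ⟨E.machine, ⟨hA, hE.solves_machine, hE.exists_polynomial_delay hbpoly (hes.add hep)⟩,
    hE.uniformCost_machine hbpoly, hE.delay_machine hbpoly, hE.space_machine hbpoly⟩
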